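/- Let $V=\mathbb{C}^3$ with standard basis $\xi_1,\xi_2,\xi_3$ and dual coordinates $v_1,v_2,v_3$, and let $G\subset SL(V)$ be the group of diagonal matrices of determinant one whose diagonal entries are fifth roots of unity. Let $\Omega(V)=\mathbb{C}[V]\otimes\Lambda(V^\vee)$ be the polynomial differential forms, $\eta=\sum_k v_k\xi_k$ the Euler vector field, and $\gamma=\sum_k g_k\,dv_k$ with $$g_1=-\tfrac13v_2v_3+v_1^4,\quad g_2=-\tfrac13v_1v_3+v_2^4,\quad g_3=-\tfrac13v_1v_2+v_3^4 .$$ The odd differential $\delta=\iota_\eta-\gamma\wedge\cdot$ on $\Omega(V)$ satisfies $\delta^2=-W\cdot\mathrm{id}$ with $W=-v_1v_2v_3+v_1^5+v_2^5+v_3^5$. Hence $B=\mathrm{Hom}_{\mathbb{C}[V]}(\Omega(V),\Omega(V))$, with composition and $\tilde\partial b=\delta b-(-1)^{|b|}b\delta$, is a $\mathbb{Z}/2$-graded dg algebra $\mathcal{B}$, regarded as an $A_\infty$-algebra by $\mu^1(b)=(-1)^{|b|}\tilde\partial b$, $\mu^2(b_2,b_1)=(-1)^{|b_1|}b_2b_1$.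 Let $\partial$ be the differential on $B$ induced in the same way by $\iota_\eta$ alone. Identify $B=\Omega(V)\otimes\Lambda(V)$, where $\tau\otimes\theta$ sends $f\beta$ (with $f\in\mathbb{C}[V]$, $\beta\in\Lambda(V^\vee)$) to $f\cdot(\iota_\theta\beta)_0\cdot\tau$; here $\theta\mapsto\iota_\theta$ is the algebra homomorphism extending contraction with vectors, and $(\cdot)_0$ is the degree $0$ part. For $J=\{j_1<\dots<j_p\}$ write $dv_J=dv_{j_1}\wedge\cdots\wedge dv_{j_p}$ and $\xi_J=\xi_{j_p}\wedge\cdots\wedge\xi_{j_1}$. Let $p:B\to\Lambda(V)$ be the projection induced by taking the constant term of the degree $0$ part in $\Omega(V)$, let $i(\theta)=\sum_J dv_J\otimes\xi_J\wedge\theta$, and let $$h(f\beta\otimes\theta)=\sum_J\frac{|J|!}{w(w+1)\cdots(w+|J|)}\,df\wedge\beta\wedge dv_J\otimes\xi_J\wedge\theta$$ for $f\in\mathrm{Sym}^r(V^\vee)$, $\beta\in\Lambda^s(V^\vee)$, $w=r+s$ (and $h=0$ if $w=0$). Define $\mu^d:\Lambda(V)^{\otimes d}\to\Lambda(V)$,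 $d\ge1$, as the sum over all ribbon trees with one root, $d$ leaves and at least one vertex, all vertices having valency $2$ or $3$, of the composition of the following operations: $b\mapsto(-1)^{|b|}(\tilde\partial-\partial)b$ at a bivalent vertex, $(b_2,b_1)\mapsto(-1)^{|b_1|}b_2b_1$ at a trivalent vertex, $b\mapsto(-1)^{|b|-1}h(b)$ on a finite edge, $i$ on the incoming and $p$ on the outgoing semi-infinite edges. Then, for each $d$, only finitely many trees contribute to $\mu^d$; $\mathcal{A}=(\Lambda(V),\mu)$ is a $G$-equivariant $\mathbb{Z}/2$-graded $A_\infty$-algebra, and there is a $G$-equivariant $A_\infty$-quasi-isomorphism $\mathcal{A}\to\mathcal{B}$. Moreover $\mu^1=0$; $\mu^2(a_2,a_1)=(-1)^{|a_1|}a_2\wedge a_1$; for $d\ge3$, $\mu^d=\sum_{k\ge0}\mu^d_k$ with $\mu^d_k$ of degree $6-3d+4k$ with respect to the grading of $\Lambda(V)$; and for all $\xi=(\xi_1,\xi_2,\xi_3)\in V$ (here the $\xi_j$ denote the coordinates of $\xi$) $$\mu^3_0(\xi,\xi,\xi)=-\xi_1\xi_2\xi_3,\qquad \mu^5_1(\xi,\xi,\xi,\xi,\xi)=\xi_1^5+\xi_2^5+\xi_3^5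 .$$ In particular, $\mathcal{A}$ with its $G$-action belongs to the class of $A_\infty$-algebras that are $G$-equivariantly $A_\infty$-isomorphic to a $G$-equivariant $\mathbb{Z}/2$-graded $A_\infty$-structure on $\Lambda(V)$ with these properties of $\mu^1$, $\mu^2$, the $\mu^d_k$, $\mu^3_0$ and $\mu^5_1$. -/

import Mathlib

/-!
Conventions.  An operation with an arbitrary number of inputs is a function on lists; the list
`[a_d, …, a_1]` is written in the order in which the inputs are written in `μ^d(a_d, …, a_1)`,
and `μ^d` is the restriction to lists of length `d`.  A `ℤ/2`-grading is given by its parity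
involution `s`, with `s a = (-1)^{|a|} a` for homogeneous `a`.
-/

namespace KoszulMF

open TensorProduct

noncomputable section

/-! ### `ℤ/2`-graded `A_∞`-algebras and their homomorphisms over `ℂ` -/

/-- The function is `ℂ`-linear in each entry of its input list. -/
def IsMultilin {A B : Type} [AddCommGroup A] [Module ℂ A] [AddCommGroup B] [Module ℂ B]
    (m : List A → B) : Prop :=
  ∀ x z : List A, IsLinearMap ℂ (fun a : A => m (x ++ a :: z))

/-- The sum
`∑ (-1)^{|a_1| + ⋯ + |a_k| - k} F(a_d, …, μ(a_{k+l}, …, a_{k+1}), a_k, …, a_1)` over all `k ≥ 0`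
and `l ≥ 1` with `k + l ≤ d`.  Below `i = d - k - l` and `j = l - 1`; the sign is produced
by applying `a ↦ -s a = (-1)^{|a| - 1} a` to the last `k` entries. -/
def insertSum {A B : Type} [AddCommGroup A] [Module ℂ A] [AddCommGroup B] [Module ℂ B]
    (s : A →ₗ[ℂ] A) (μ : List A → A) (F : List A → B) (l : List A) : B :=
  ∑ i ∈ Finset.range l.length, ∑ j ∈ Finset.range (l.length - i),
    F (l.take i ++ μ ((l.drop i).take (j + 1)) :: (l.drop (i + j + 1)).map (fun a => -s a))

/-- `μ` is an (uncurved) `ℤ/2`-graded `A_∞`-structure on the `ℤ/2`-graded space `(A, s)`: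
`μ^d` is multilinear of parity `d`, and the `A_∞`-associativity equations hold. -/
structure IsAInf {A : Type} [AddCommGroup A] [Module ℂ A]
    (s : A →ₗ[ℂ] A) (μ : List A → A) : Prop where
  parity_sq : ∀ a, s (s a) = a
  multilin : IsMultilin μ
  parity : ∀ l : List A, l ≠ [] → μ (l.map s) = (-1 : ℂ) ^ l.length • s (μ l)
  assoc : ∀ l : List A, l ≠ [] → insertSum s μ μ l = 0

/-- `F` is a `ℤ/2`-graded `A_∞`-homomorphism: `F^d` is multilinear of parity `d - 1`, and
`∑ μ_B(F(…), …, F(…)) = ∑ (-1)^{|a_1| + ⋯ + |a_k| - k} F(…, μ_A(…), a_k, …, a_1)`, where the first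
sum is over all ways of cutting the input list into consecutive non-empty blocks. -/
structure IsAInfHom {A B : Type} [AddCommGroup A] [Module ℂ A] [AddCommGroup B] [Module ℂ B]
    (sA : A →ₗ[ℂ] A) (μA : List A → A) (sB : B →ₗ[ℂ] B) (μB : List B → B)
    (F : List A → B) : Prop where
  multilin : IsMultilin F
  parity : ∀ l : List A, l ≠ [] → F (l.map sA) = (-1 : ℂ) ^ (l.length + 1) • sB (F l)
  hom : ∀ l : List A, l ≠ [] →
    ∑ c : Composition l.length, μB ((l.splitWrtComposition c).map F) = insertSum sA μA F l

/-- The linear part of `F` induces an isomorphism from the cohomology of `μ_A^1` to that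
of `μ_B^1`. -/
def IsQuasiIso {A B : Type} [AddCommGroup A] [AddCommGroup B]
    (μA : List A → A) (μB : List B → B) (F : List A → B) : Prop :=
  (∀ a, μA [a] = 0 → (∃ b, F [a] = μB [b]) → ∃ a', a = μA [a']) ∧
  (∀ b, μB [b] = 0 → ∃ a b', μA [a] = 0 ∧ b = F [a] + μB [b'])

/-! ### The spaces -/

/-- `V = ℂ³`. -/
abbrev V : Type := Fin 3 → ℂ

/-- The polynomial functions `ℂ[V]`; the coordinate `v_k` is `MvPolynomial.X k`. -/
abbrev CV : Type := MvPolynomial (Fin 3) ℂ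

/-- `Λ(V)`. -/
abbrev LV : Type := ExteriorAlgebra ℂ V

/-- `Λ(V^∨)`. -/
abbrev LVd : Type := ExteriorAlgebra ℂ (Module.Dual ℂ V)

/-- The polynomial differential forms `Ω(V) = ℂ[V] ⊗ Λ(V^∨)`. -/
abbrev Om : Type := CV ⊗[ℂ] LVd

/-- `B = Hom_{ℂ[V]}(Ω(V), Ω(V))`, with composition as product. -/
abbrev B : Type := Module.End CV Om

/-- The standard basis vector `ξ_k` of `V`. -/
def xi (k : Fin 3) : V := Pi.single k 1

/-- `dv_k ∈ V^∨`. -/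
def dv (k : Fin 3) : Module.Dual ℂ V := LinearMap.proj k

/-- `dv_{j_1} ∧ ⋯ ∧ dv_{j_p}` for `J = {j_1 < ⋯ < j_p}`. -/
def dvJ (J : Finset (Fin 3)) : LVd := ((J.sort (· ≤ ·)).map fun k => ExteriorAlgebra.ι ℂ (dv k)).prod

/-- `ξ_{j_p} ∧ ⋯ ∧ ξ_{j_1}` for `J = {j_1 < ⋯ < j_p}`. -/
def xiJ (J : Finset (Fin 3)) : LV :=
  ((J.sort (· ≤ ·)).reverse.map fun k => ExteriorAlgebra.ι ℂ (xi k)).prod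

/-- Contraction `ι_ξ : Λ(V^∨) → Λ(V^∨)` with `ξ ∈ V`. -/
def contr (ξ : V) : Module.End ℂ LVd :=
  CliffordAlgebra.contractLeft (Q := (0 : QuadraticForm ℂ (Module.Dual ℂ V)))
    (Module.Dual.eval ℂ V ξ)

/-- `θ ↦ ι_θ`, the extension of `ξ ↦ ι_ξ` to an algebra homomorphism on `Λ(V)`. -/
def contrAlg : LV →ₐ[ℂ] Module.End ℂ LVd :=
  ExteriorAlgebra.lift ℂ
    ⟨(CliffordAlgebra.contractLeft (Q := (0 : QuadraticForm ℂ (Module.Dual ℂ V)))).comp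
      (Module.Dual.eval ℂ V), fun ξ => by
        refine LinearMap.ext fun x => ?_
        exact CliffordAlgebra.contractLeft_contractLeft (Module.Dual.eval ℂ V ξ) x⟩

/-- The parity involution of `Λ(V)`. -/
def parLV : LV →ₗ[ℂ] LV :=
  (CliffordAlgebra.involute (Q := (0 : QuadraticForm ℂ V))).toLinearMap

/-- The parity involution of `Ω(V)` (differential forms by their degree mod 2). -/
def parOm : B :=
  LinearMap.baseChange CV
    (CliffordAlgebra.involute (Q := (0 : QuadraticForm ℂ (Module.Dual ℂ V)))).toLinearMap

/-- The parity involution of `B`. -/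
def parB : B →ₗ[ℂ] B where
  toFun b := parOm * b * parOm
  map_add' b c := by rw [mul_add, add_mul]
  map_smul' c b := by rw [mul_smul_comm, smul_mul_assoc, RingHom.id_apply]

/-! ### The matrix factorization and its endomorphism dg algebra -/

/-- Contraction with the Euler vector field, `ι_η = ∑ v_k ι_{ξ_k}`. -/
def iotaEta : B := ∑ k, (MvPolynomial.X k : CV) • LinearMap.baseChange CV (contr (xi k))

/-- Multiplication `γ ∧ ·` with the one-form `γ = ∑ g_k dv_k`. -/
def wedgeForm (g : Fin 3 → CV) : B :=
  ∑ k, g k • LinearMap.baseChange CV (LinearMap.mulLeft ℂ (ExteriorAlgebra.ι ℂ (dv k)))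

/-- The differential `ι_η - γ ∧ ·` on `Ω(V)`. -/
def delta (g : Fin 3 → CV) : B := iotaEta - wedgeForm g

/-- The differential on `B` induced by an odd endomorphism `δ` of `Ω(V)`:
`b ↦ δ b - (-1)^{|b|} b δ`. -/
def inducedDiff (δ b : B) : B := δ * b - parB b * δ

/-- The dg algebra `(B, ∂̃)`, with `∂̃` induced by `δ`, as an `A_∞`-algebra:
`μ^1(b) = (-1)^{|b|} ∂̃ b` and `μ^2(b_2, b_1) = (-1)^{|b_1|} b_2 b_1`. -/
def muB (g : Fin 3 → CV) : List B → B
  | [b] => inducedDiff (delta g) (parB b)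
  | [b₂, b₁] => b₂ * parB b₁
  | _ => 0

/-! ### The contraction data: inclusion, projection and homotopy -/

/-- The pairing `Λ(V) × Λ(V^∨) → ℂ`: the degree zero part of `ι_θ β`. -/
def pairing (θ : LV) : LVd →ₗ[ℂ] ℂ := (ExteriorAlgebra.algebraMapInv).toLinearMap.comp (contrAlg θ)

/-- The element of `B` that corresponds to `τ ⊗ θ` under `Ω(V) ⊗ Λ(V) = B`:
it sends `f β` to `f ⟨θ, β⟩ τ`. -/
def tens (τ : Om) (θ : LV) : B :=
  (LinearMap.toSpanSingleton CV Om τ).comp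
    ((AlgebraTensorModule.rid ℂ CV CV).toLinearMap.comp (LinearMap.baseChange CV (pairing θ)))

/-- The inclusion `i : Λ(V) → B`,
`i(θ) = ∑_J dv_{j_1} ∧ ⋯ ∧ dv_{j_p} ⊗ ξ_{j_p} ∧ ⋯ ∧ ξ_{j_1} ∧ θ`. -/
def incl (θ : LV) : B := ∑ J : Finset (Fin 3), tens (1 ⊗ₜ dvJ J) (xiJ J * θ)

/-- The projection `Ω(V) → ℂ` that takes the constant term of the degree zero part. -/
def augOm : Om →ₗ[ℂ] ℂ :=
  (TensorProduct.lid ℂ ℂ).toLinearMap.comp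
    (TensorProduct.map (MvPolynomial.aeval (fun _ : Fin 3 => (0 : ℂ))).toLinearMap
      (ExteriorAlgebra.algebraMapInv).toLinearMap)

/-- The projection `p : B → Λ(V)`.  Every `b` is `∑_K b(dv_K) ⊗ (ξ_{k_q} ∧ ⋯ ∧ ξ_{k_1})`
in `Ω(V) ⊗ Λ(V)`, over all `K = {k_1 < ⋯ < k_q}`. -/
def proj (b : B) : LV := ∑ K : Finset (Fin 3), augOm (b (1 ⊗ₜ dvJ K)) • xiJ K

/-- `fβ ↦ p! / (w (w + 1) ⋯ (w + p)) df ∧ β`, for `f` and `β` homogeneous of degrees `r` and `s`,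
and `w = r + s` (for `w = 0` the result is `0`). -/
def scaledD (p : ℕ) : Om →ₗ[ℂ] Om :=
  TensorProduct.lift ((MvPolynomial.basisMonomials (Fin 3) ℂ).constr ℂ fun m : Fin 3 →₀ ℕ =>
    ∑ s ∈ Finset.range 4,
      ((p.factorial : ℂ) / ∏ q ∈ Finset.range (p + 1), ((m.degree + s + q : ℕ) : ℂ)) •
        ∑ k : Fin 3,
          (TensorProduct.mk ℂ CV LVd (MvPolynomial.pderiv k (MvPolynomial.monomial m (1 : ℂ)))).comp
            ((LinearMap.mulLeft ℂ (ExteriorAlgebra.ι ℂ (dv k))).comp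
              (GradedAlgebra.proj (fun i : ℕ => ⋀[ℂ]^i (Module.Dual ℂ V)) s)))

/-- Right multiplication `· ∧ β` on `Ω(V)`. -/
def wedgeRight (β : LVd) : B := LinearMap.baseChange CV (LinearMap.mulRight ℂ β)

/-- The homotopy `h` on `τ ⊗ θ`:
`h(fβ ⊗ θ) = ∑_J p!/(w(w+1)⋯(w+p)) df ∧ β ∧ dv_{j_1} ∧ ⋯ ∧ dv_{j_p} ⊗ ξ_{j_p} ∧ ⋯ ∧ ξ_{j_1} ∧ θ`,
where `p` is the size of `J`. -/
def homotopyTens (τ : Om) (θ : LV) : B :=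
  ∑ J : Finset (Fin 3), tens (wedgeRight (dvJ J) (scaledD J.card τ)) (xiJ J * θ)

/-- The homotopy `h : B → B`. -/
def homotopy (b : B) : B := ∑ K : Finset (Fin 3), homotopyTens (b (1 ⊗ₜ dvJ K)) (xiJ K)

/-! ### The sum over ribbon trees -/

/-- Ribbon trees with a root and leaves, all of whose vertices have valency 2 or 3.  `leaf` is a
single edge; the other two constructors put a vertex at the root.  In `tri t u` the leaves of `t`
come before those of `u`. -/
inductive RTree : Type
  | leaf : RTree
  | bi : RTree → RTree
  | tri : RTree → RTree → RTree

/-- The number of leaves. -/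
def RTree.leaves : RTree → ℕ
  | .leaf => 1
  | .bi t => t.leaves
  | .tri t u => t.leaves + u.leaves

/-- The operation on the edge that leaves the root vertex of a subtree, when this
edge is finite: `b ↦ (-1)^{|b| - 1} h(b)`.  For `leaf` the edge is a semi-infinite incoming one,
whose operation `i` is part of `RTree.out`. -/
def RTree.edge : RTree → B → B
  | .leaf, b => b
  | _, b => -homotopy (parB b)

/-- The element of `B` which comes out of the root vertex; for `leaf`, it is `i(a)`.
The operations at the vertices are
`b ↦ (-1)^{|b|} (∂̃ - ∂)(b)` and `(b_2, b_1) ↦ (-1)^{|b_1|} b_2 b_1`. -/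
def RTree.out (g : Fin 3 → CV) : RTree → List LV → B
  | .leaf, l => incl (l.headD 0)
  | .bi t, l =>
      let b := parB (t.edge (t.out g l))
      inducedDiff (delta g) b - inducedDiff iotaEta b
  | .tri t u, l =>
      t.edge (t.out g (l.take t.leaves)) * parB (u.edge (u.out g (l.drop t.leaves)))

/-- The multilinear operation `Λ(V)^{⊗ d} → Λ(V)` of a tree with `d` leaves. -/
def RTree.op (g : Fin 3 → CV) (t : RTree) (l : List LV) : LV := proj (t.out g l)

/-- The transferred operations `μ^d` on `Λ(V)`: the sum of the operations of all trees
with `d` leaves and at least one vertex. -/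
def muTree (g : Fin 3 → CV) (l : List LV) : LV :=
  ∑ᶠ t ∈ {t : RTree | t.leaves = l.length ∧ t ≠ RTree.leaf}, t.op g l

/-- `g_1 = -v_2 v_3 / 3 + v_1^4`, and cyclically. -/
def gW (k : Fin 3) : CV :=
  -MvPolynomial.C (1 / 3 : ℂ) * MvPolynomial.X (k + 1) * MvPolynomial.X (k + 2)
    + MvPolynomial.X k ^ 4

/-- `W = -v_1 v_2 v_3 + v_1^5 + v_2^5 + v_3^5`. -/
def W : CV :=
  -(MvPolynomial.X 0 * MvPolynomial.X 1 * MvPolynomial.X 2)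
    + MvPolynomial.X 0 ^ 5 + MvPolynomial.X 1 ^ 5 + MvPolynomial.X 2 ^ 5

/-! ### The group `G` -/

/-- `G ⊂ SL(V)`: the diagonal matrices whose diagonal entries are fifth roots of unity. -/
def G : Subgroup (Matrix.SpecialLinearGroup (Fin 3) ℂ) where
  carrier := {A | ∃ t : Fin 3 → ℂ, (∀ i, t i ^ 5 = 1) ∧ A.1 = Matrix.diagonal t}
  one_mem' := ⟨1, by simp, by simp⟩
  mul_mem' := by
    rintro A A' ⟨t, ht, hA⟩ ⟨t', ht', hA'⟩
    refine ⟨t * t', fun i => by simp [mul_pow, ht, ht'], ?_⟩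
    change A.1 * A'.1 = _
    rw [hA, hA', Matrix.diagonal_mul_diagonal]
    rfl
  inv_mem' := by
    rintro A ⟨t, ht, hA⟩
    have h0 : ∀ i, t i ≠ 0 := fun i h => by simpa [h] using ht i
    refine ⟨fun i => (t i)⁻¹, fun i => by simp [ht], ?_⟩
    have h1 : A.1 * Matrix.diagonal (fun i => (t i)⁻¹) = 1 := by
      rw [hA, Matrix.diagonal_mul_diagonal, ← Matrix.diagonal_one]
      exact congrArg _ (funext fun i => mul_inv_cancel₀ (h0 i))
    have h2 : (A⁻¹).1 * A.1 = 1 := by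
      rw [← Matrix.SpecialLinearGroup.coe_mul, inv_mul_cancel, Matrix.SpecialLinearGroup.coe_one]
    exact left_inv_eq_right_inv h2 h1

/-- The action of a matrix on `Λ(V)`. -/
def actLV (A : Matrix.SpecialLinearGroup (Fin 3) ℂ) : LV →ₗ[ℂ] LV :=
  (ExteriorAlgebra.map (Matrix.toLin' A.1)).toLinearMap

/-- The action of a matrix on `Ω(V)`, by pullback with the inverse matrix. -/
def actOm (A : Matrix.SpecialLinearGroup (Fin 3) ℂ) : Om →ₗ[ℂ] Om :=
  TensorProduct.map
    (MvPolynomial.aeval fun k : Fin 3 =>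
      ∑ j, MvPolynomial.C ((A⁻¹).1 k j) * (MvPolynomial.X j : CV)).toLinearMap
    (ExteriorAlgebra.map (LinearMap.dualMap (Matrix.toLin' (A⁻¹).1))).toLinearMap

/-- A sequence of multilinear maps from `Λ(V)` to itself is `G`-equivariant. -/
def IsGEquivariant (F : List LV → LV) : Prop :=
  ∀ A ∈ G, ∀ l : List LV, l ≠ [] → F (l.map (actLV A)) = actLV A (F l)

/-- A sequence of multilinear maps from `Λ(V)` to `B` is `G`-equivariant, where `G` acts on `B` by
conjugation. -/
def IsGEquivariantB (F : List LV → B) : Prop :=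
  ∀ A ∈ G, ∀ l : List LV, l ≠ [] → ∀ ω : Om, F (l.map (actLV A)) (actOm A ω) = actOm A (F l ω)

/-! ### The isomorphism class -/

/-- `Λ^n(V)` for an integer `n`; it is zero for `n < 0`. -/
def extPow (n : ℤ) : Submodule ℂ LV := if 0 ≤ n then ⋀[ℂ]^n.toNat V else ⊥

/-- On lists of length `i`, the map `m` has degree `e` with respect to the grading of `Λ(V)`. -/
def HasDegree (m : List LV → LV) (i : ℕ) (e : ℤ) : Prop :=
  ∀ (l : List LV) (n : List ℕ), l.length = i →
    List.Forall₂ (fun a q => a ∈ ⋀[ℂ]^q V) l n → m l ∈ extPow ((n.sum : ℤ) + e)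

/-- `μ` is a `G`-equivariant `ℤ/2`-graded `A_∞`-structure on `Λ(V)` with `μ^1 = 0` and
`μ^2(a_2, a_1) = (-1)^{|a_1|} a_2 ∧ a_1`, such that for `i ≥ 3`, `μ^i` is the sum of components
`μ^i_k` (here `m k` on lists of length `i`) of degree `6 - 3 i + 4 k`, with `k ≥ 0`.
As `Λ(V)` is concentrated in degrees `0, …, 3`, components with `k > i` vanish. -/
structure IsDeformation (μ : List LV → LV) (m : ℕ → List LV → LV) : Prop where
  ainf : IsAInf parLV μ
  equivariant : IsGEquivariant μ
  mu_one : ∀ a, μ [a] = 0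
  mu_two : ∀ a₂ a₁, μ [a₂, a₁] = a₂ * parLV a₁
  comp_multilin : ∀ k, IsMultilin (m k)
  comp_degree : ∀ k i : ℕ, 3 ≤ i → HasDegree (m k) i (6 - 3 * i + 4 * k)
  comp_sum : ∀ l : List LV, 3 ≤ l.length → μ l = ∑ k ∈ Finset.range (l.length + 1), m k l

/-- For all `ξ ∈ V`, `μ^3_0(ξ, ξ, ξ) = -ξ_1 ξ_2 ξ_3` and
`μ^5_1(ξ, ξ, ξ, ξ, ξ) = ξ_1^5 + ξ_2^5 + ξ_3^5`. -/
def HasLeadingTerms (m : ℕ → List LV → LV) : Prop :=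
  ∀ ξ : V,
    m 0 (List.replicate 3 (ExteriorAlgebra.ι ℂ ξ)) = algebraMap ℂ LV (-(ξ 0 * ξ 1 * ξ 2)) ∧
    m 1 (List.replicate 5 (ExteriorAlgebra.ι ℂ ξ)) = algebraMap ℂ LV (ξ 0 ^ 5 + ξ 1 ^ 5 + ξ 2 ^ 5)

/-- `μ` belongs to the isomorphism class of `A_∞`-algebras with `G`-action singled out by the
leading terms: there is a `G`-equivariant `A_∞`-isomorphism from `μ` to a structure `ν` as in
`IsDeformation` which has these leading terms. -/
def BelongsToClass (μ : List LV → LV) : Prop :=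
  ∃ (ν : List LV → LV) (n : ℕ → List LV → LV) (F : List LV → LV),
    IsDeformation ν n ∧ HasLeadingTerms n ∧
    IsAInfHom parLV μ parLV ν F ∧ IsGEquivariant F ∧ Function.Bijective fun a => F [a]

end

end KoszulMF

namespace KoszulMF

open TensorProduct

noncomputable section

/-! Every endomorphism in B is a combination of normally ordered operators `nrm τ θ`: contract with
θ, then multiply by the form τ. In these terms the contraction data are transparent. The inclusion
is θ ↦ ι_θ (`incl_eq`), the commutator with ι_η acts on τ alone (`inducedDiff_iotaEta_nrm`), p
applies the augmentation to τ (`proj_nrm`), and h, whose coefficients look intricate in the basis τ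
⊗ θ, becomes fβ ↦ df ∧ β / (r + s) on τ (`homotopy_nrm`). So (B, ∂) is the Koszul complex tensored
with Λ(V), and Cartan's formula (`iotaEta_koszulHomotopy`) shows that i, p, h form a homotopy
retract.

The A_∞-statements follow by homological perturbation, carried out for an abstract `Retract`. The
sum F over trees solves F = i + H(βF + m(F, F)), by cutting each tree at its root (`outSum_eq`,
`IsBounded.isSolution`). The defect in the A_∞-homomorphism equation then satisfies a homogeneous
linear equation (`IsSolution.defect_eq`), which has only the zero solution by induction on the
number of inputs and nilpotence of Hβ. Applying p gives the A_∞-equations for the transferred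
structure. That F is a quasi-isomorphism rests on nilpotence of Hβ + βH (`exists_of_cocycle`).

The remaining structural claims express homogeneity under v_k ↦ a_k v_k, dv_k ↦ c_k dv_k with a_k =
r c_k: i and p are compatible with it, and h is multiplied by r. Taking c = 2, a = 1 measures form
degree; it gives nilpotence, boundedness and the degrees of the operations. Taking a = 2, c = 1
measures polynomial degree; since γ vanishes to order two at the origin, trees with too many
bivalent vertices project to zero, whence finiteness. Taking a = -1, c = 1 eliminates trees with an
even number of vertices, which reconciles two sign conventions for edges and makes the degrees jump
by 4. Taking a = 1, c = -1 gives parity, and a = c = t⁻¹ gives equivariance.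

The leading terms come from trees with exactly one bivalent vertex. As h ∘ i = 0, with all inputs
equal to ξ these grow from a leaf by attaching further leaves one at a time on either side. They
start with f = ∑ ξ_k g_k, and each attachment acts by -(1/r) ∂_ξ on the part of degree r, so that r
attachments evaluate this part at ξ up to sign (`attach_pow_smul_one`). The transferred structure
thus has all the required properties itself, and it belongs to the isomorphism class by the
identity. -/

/-- `dv_k` as an element of `Λ(V^∨)`. -/
abbrev dvι (k : Fin 3) : LVd := ExteriorAlgebra.ι ℂ (dv k)

/-- `ξ_k` as an element of `Λ(V)`. -/
abbrev xiι (k : Fin 3) : LV := ExteriorAlgebra.ι ℂ (xi k)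

/-! ### The dual bases `dv_J` and `ξ_J` -/

theorem sum_finset_fin_three {M : Type*} [AddCommMonoid M] (f : Finset (Fin 3) → M) :
    ∑ J, f J = f ∅ + f {0} + f {1} + f {2} + f {0, 1} + f {0, 2} + f {1, 2} + f {0, 1, 2} := by
  have h : (Finset.univ : Finset (Finset (Fin 3))) =
      {∅, {0}, {1}, {2}, {0, 1}, {0, 2}, {1, 2}, {0, 1, 2}} := by decide
  rw [h]
  repeat rw [Finset.sum_insert (by decide)]
  rw [Finset.sum_singleton]
  simp only [add_assoc]

theorem forall_finset_fin_three {P : Finset (Fin 3) → Prop} :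
    (∀ J, P J) ↔ P ∅ ∧ P {0} ∧ P {1} ∧ P {2} ∧ P {0, 1} ∧ P {0, 2} ∧ P {1, 2} ∧ P {0, 1, 2} := by
  have h : ∀ J : Finset (Fin 3), J = ∅ ∨ J = {0} ∨ J = {1} ∨ J = {2} ∨ J = {0, 1} ∨ J = {0, 2} ∨
    J = {1, 2} ∨ J = {0, 1, 2} := by decide
  refine ⟨fun H => ⟨H _, H _, H _, H _, H _, H _, H _, H _⟩, fun H J => ?_⟩
  obtain ⟨h0, h1, h2, h3, h4, h5, h6, h7⟩ := H
  rcases h J with h | h | h | h | h | h | h | h <;> rw [h] <;> assumption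

theorem sort_fin_three :
    (∅ : Finset (Fin 3)).sort (· ≤ ·) = [] ∧ ({0} : Finset (Fin 3)).sort (· ≤ ·) = [0] ∧
    ({1} : Finset (Fin 3)).sort (· ≤ ·) = [1] ∧ ({2} : Finset (Fin 3)).sort (· ≤ ·) = [2] ∧
    ({0, 1} : Finset (Fin 3)).sort (· ≤ ·) = [0, 1] ∧
    ({0, 2} : Finset (Fin 3)).sort (· ≤ ·) = [0, 2] ∧
    ({1, 2} : Finset (Fin 3)).sort (· ≤ ·) = [1, 2] ∧
    ({0, 1, 2} : Finset (Fin 3)).sort (· ≤ ·) = [0, 1, 2] := by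
  have key : ∀ l : List (Fin 3), l.SortedLE → l.Nodup → l.toFinset.sort (· ≤ ·) = l :=
    fun l h1 h2 => (List.toFinset_sort (· ≤ ·) h2).2 h1.pairwise
  exact ⟨key [] (by decide) (by decide), key [0] (by decide) (by decide),
    key [1] (by decide) (by decide), key [2] (by decide) (by decide),
    key [0, 1] (by decide) (by decide), key [0, 2] (by decide) (by decide),
    key [1, 2] (by decide) (by decide), key [0, 1, 2] (by decide) (by decide)⟩

theorem dvJ_values : dvJ ∅ = 1 ∧ dvJ {0} = dvι 0 ∧ dvJ {1} = dvι 1 ∧ dvJ {2} = dvι 2 ∧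
    dvJ {0, 1} = dvι 0 * dvι 1 ∧ dvJ {0, 2} = dvι 0 * dvι 2 ∧ dvJ {1, 2} = dvι 1 * dvι 2 ∧
    dvJ {0, 1, 2} = dvι 0 * (dvι 1 * dvι 2) := by
  obtain ⟨h0, h1, h2, h3, h4, h5, h6, h7⟩ := sort_fin_three
  simp [dvJ, h0, h1, h2, h3, h4, h5, h6, h7]

theorem xiJ_values : xiJ ∅ = 1 ∧ xiJ {0} = xiι 0 ∧ xiJ {1} = xiι 1 ∧ xiJ {2} = xiι 2 ∧
    xiJ {0, 1} = xiι 1 * xiι 0 ∧ xiJ {0, 2} = xiι 2 * xiι 0 ∧ xiJ {1, 2} = xiι 2 * xiι 1 ∧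
    xiJ {0, 1, 2} = xiι 2 * (xiι 1 * xiι 0) := by
  obtain ⟨h0, h1, h2, h3, h4, h5, h6, h7⟩ := sort_fin_three
  simp [xiJ, h0, h1, h2, h3, h4, h5, h6, h7]

theorem contr_ι_mul (ξ : V) (φ : Module.Dual ℂ V) (β : LVd) :
    contr ξ (ExteriorAlgebra.ι ℂ φ * β) = φ ξ • β - ExteriorAlgebra.ι ℂ φ * contr ξ β :=
  CliffordAlgebra.contractLeft_ι_mul (Q := (0 : QuadraticForm ℂ (Module.Dual ℂ V))) _ _ _

theorem contr_ι (ξ : V) (φ : Module.Dual ℂ V) :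
    contr ξ (ExteriorAlgebra.ι ℂ φ) = algebraMap ℂ LVd (φ ξ) :=
  CliffordAlgebra.contractLeft_ι (Q := (0 : QuadraticForm ℂ (Module.Dual ℂ V))) _ _

theorem contr_one (ξ : V) : contr ξ 1 = 0 :=
  CliffordAlgebra.contractLeft_one (Q := (0 : QuadraticForm ℂ (Module.Dual ℂ V))) _

theorem contrAlg_ι (ξ : V) : contrAlg (ExteriorAlgebra.ι ℂ ξ) = contr ξ := by
  simp [contrAlg, contr]

theorem contrAlg_mul_apply (θ θ' : LV) (β : LVd) :
    contrAlg (θ * θ') β = contrAlg θ (contrAlg θ' β) := by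
  rw [map_mul]; rfl

theorem dv_xi (j k : Fin 3) : dv j (xi k) = if j = k then 1 else 0 := by
  simp [dv, xi, Pi.single_apply]

theorem dvι_sq (k : Fin 3) : dvι k * dvι k = 0 := ExteriorAlgebra.ι_sq_zero _

theorem dvι_swap (j k : Fin 3) : dvι j * dvι k = -(dvι k * dvι j) :=
  eq_neg_of_add_eq_zero_left (ExteriorAlgebra.ι_add_mul_swap _ _)

theorem xiι_sq (k : Fin 3) : xiι k * xiι k = 0 := ExteriorAlgebra.ι_sq_zero _

theorem xiι_swap (j k : Fin 3) : xiι j * xiι k = -(xiι k * xiι j) :=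
  eq_neg_of_add_eq_zero_left (ExteriorAlgebra.ι_add_mul_swap _ _)

theorem pairing_one (θ : LV) (k : Fin 3) (β : LVd) :
    pairing (θ * xiι k) β = pairing θ (contr (xi k) β) := by
  simp [pairing, contrAlg_ι]

theorem pairing_xiι (k : Fin 3) (β : LVd) :
    pairing (xiι k) β = pairing 1 (contr (xi k) β) := by
  rw [← pairing_one, one_mul]

theorem pairing_one_one : pairing 1 1 = 1 := by simp [pairing]

theorem pairing_one_ι_mul (k : Fin 3) (β : LVd) : pairing 1 (dvι k * β) = 0 := by
  simp [pairing, ExteriorAlgebra.algebraMapInv]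

theorem pairing_one_ι (k : Fin 3) : pairing 1 (dvι k) = 0 := by
  simp [pairing, ExteriorAlgebra.algebraMapInv]

theorem dvι_mul_dvJ (k : Fin 3) (J : Finset (Fin 3)) :
    dvι k * dvJ J = if k ∈ J then 0 else
      (-1 : ℂ) ^ (J.filter (· < k)).card • dvJ (insert k J) := by
  revert k J
  obtain ⟨h0, h1, h2, h3, h4, h5, h6, h7⟩ := dvJ_values
  have a : ({1, 0} : Finset (Fin 3)) = {0, 1} ∧ ({2, 0} : Finset (Fin 3)) = {0, 2} ∧
    ({2, 1} : Finset (Fin 3)) = {1, 2} ∧ ({1, 0, 2} : Finset (Fin 3)) = {0, 1, 2} ∧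
    ({2, 0, 1} : Finset (Fin 3)) = {0, 1, 2} := by decide
  obtain ⟨a1, a2, a3, a4, a5⟩ := a
  -- Only 0 and 1 can lie below an index in `Fin 3`; this puts the sign exponent in a form that can
  -- be evaluated on each explicit subset.
  have c : ∀ (k : Fin 3) (J : Finset (Fin 3)), (J.filter (· < k)).card =
    (if 0 ∈ J ∧ 0 < k then 1 else 0) + (if 1 ∈ J ∧ 1 < k then 1 else 0) := by decide
  have s (i : Fin 3) (x : LVd) : dvι i * (dvι i * x) = 0 := by rw [← mul_assoc, dvι_sq, zero_mul]
  have t (i j : Fin 3) (x : LVd) : dvι i * (dvι j * x) = -(dvι j * (dvι i * x)) := by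
    rw [← mul_assoc, dvι_swap, neg_mul, mul_assoc]
  simp only [forall_finset_fin_three, Fin.forall_fin_succ, Fin.forall_fin_zero, c]
  simp [h0, h1, h2, h3, h4, h5, h6, h7, a1, a2, a3, a4, a5, s, t 1 0, t 2 0, t 2 1,
    dvι_swap 1 0, dvι_swap 2 0, dvι_swap 2 1]

theorem mul_xiι_xiJ (k : Fin 3) (J : Finset (Fin 3)) :
    xiJ J * xiι k = if k ∈ J then 0 else
      (-1 : ℂ) ^ (J.filter (· < k)).card • xiJ (insert k J) := by
  revert k J
  obtain ⟨h0, h1, h2, h3, h4, h5, h6, h7⟩ := xiJ_values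
  have a : ({1, 0} : Finset (Fin 3)) = {0, 1} ∧ ({2, 0} : Finset (Fin 3)) = {0, 2} ∧
    ({2, 1} : Finset (Fin 3)) = {1, 2} ∧ ({1, 0, 2} : Finset (Fin 3)) = {0, 1, 2} ∧
    ({2, 0, 1} : Finset (Fin 3)) = {0, 1, 2} := by decide
  obtain ⟨a1, a2, a3, a4, a5⟩ := a
  have c : ∀ (k : Fin 3) (J : Finset (Fin 3)), (J.filter (· < k)).card =
    (if 0 ∈ J ∧ 0 < k then 1 else 0) + (if 1 ∈ J ∧ 1 < k then 1 else 0) := by decide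
  have s (i : Fin 3) (x : LV) : xiι i * (xiι i * x) = 0 := by rw [← mul_assoc, xiι_sq, zero_mul]
  have t (i j : Fin 3) (x : LV) : xiι i * (xiι j * x) = -(xiι j * (xiι i * x)) := by
    rw [← mul_assoc, xiι_swap, neg_mul, mul_assoc]
  simp only [forall_finset_fin_three, Fin.forall_fin_succ, Fin.forall_fin_zero, c]
  simp [h0, h1, h2, h3, h4, h5, h6, h7, a1, a2, a3, a4, a5, s, t 1 2,
    xiι_swap 0 1, xiι_swap 0 2, xiι_swap 1 2, mul_assoc]

/-- The factors of `ξ_J` are in decreasing order, so the contractions remove the factors of `dv_J`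
from the front one by one, and no sign arises. -/
theorem pairing_xiJ_dvJ (J K : Finset (Fin 3)) :
    pairing (xiJ J) (dvJ K) = if J = K then 1 else 0 := by
  revert K
  revert J
  obtain ⟨h0, h1, h2, h3, h4, h5, h6, h7⟩ := dvJ_values
  obtain ⟨x0, x1, x2, x3, x4, x5, x6, x7⟩ := xiJ_values
  have n : ∀ J K : Finset (Fin 3), J = K ↔ ((0 ∈ J ↔ 0 ∈ K) ∧ (1 ∈ J ↔ 1 ∈ K) ∧ (2 ∈ J ↔ 2 ∈ K)) :=
    by decide
  simp only [forall_finset_fin_three, n]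
  rw [h0, h1, h2, h3, h4, h5, h6, h7, x0, x1, x2, x3, x4, x5, x6, x7]
  simp only [← mul_assoc (xiι _) (xiι _) (xiι _)]
  simp [pairing_one, pairing_xiι, contr_ι_mul, contr_ι, contr_one, dv_xi, pairing_one_one,
    pairing_one_ι, pairing_one_ι_mul]

/-- The forms `dv_J` span `Λ(V^∨)`. -/
theorem dvJ_induction {P : LVd → Prop} (h : ∀ J, P (dvJ J)) (hadd : ∀ x y, P x → P y → P (x + y))
    (hsmul : ∀ (c : ℂ) x, P x → P (c • x)) (β : LVd) : P β := by
  have key : β ∈ Submodule.span ℂ (Set.range dvJ) := by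
    have h1 : (1 : LVd) ∈ Submodule.span ℂ (Set.range dvJ) :=
      Submodule.subset_span ⟨∅, dvJ_values.1⟩
    have hι : ∀ (φ : Module.Dual ℂ V) (x : LVd), x ∈ Submodule.span ℂ (Set.range dvJ) →
        ExteriorAlgebra.ι ℂ φ * x ∈ Submodule.span ℂ (Set.range dvJ) := by
      intro φ x hx
      have hφ : φ = ∑ k, φ (xi k) • dv k := by
        refine LinearMap.pi_ext' fun k => LinearMap.ext_ring ?_
        fin_cases k <;> simp [Fin.sum_univ_three, dv, xi]
      rw [hφ, map_sum, Finset.sum_mul]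
      refine Submodule.sum_mem _ fun k _ => ?_
      rw [map_smul, smul_mul_assoc]
      refine Submodule.smul_mem _ _ ?_
      induction hx using Submodule.span_induction with
      | mem x hx =>
        obtain ⟨J, rfl⟩ := hx
        have := dvι_mul_dvJ k J
        rw [this]
        split_ifs
        · exact Submodule.zero_mem _
        · exact Submodule.smul_mem _ _ (Submodule.subset_span ⟨_, rfl⟩)
      | zero => rw [mul_zero]; exact Submodule.zero_mem _
      | add x y _ _ hx hy => rw [mul_add]; exact Submodule.add_mem _ hx hy
      | smul c x _ hx => rw [mul_smul_comm]; exact Submodule.smul_mem _ _ hx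
    induction β using CliffordAlgebra.left_induction with
    | algebraMap r => rw [Algebra.algebraMap_eq_smul_one]; exact Submodule.smul_mem _ _ h1
    | add x y hx hy => exact Submodule.add_mem _ hx hy
    | ι_mul x φ hx => exact hι φ x hx
  induction key using Submodule.span_induction with
  | mem x hx => obtain ⟨J, rfl⟩ := hx; exact h J
  | zero => simpa using hsmul 0 _ (h ∅)
  | add x y _ _ hx hy => exact hadd x y hx hy
  | smul c x _ hx => exact hsmul c x hx

/-- The elements `ξ_J` span `Λ(V)`. -/
theorem xiJ_induction {P : LV → Prop} (h : ∀ J, P (xiJ J)) (hadd : ∀ x y, P x → P y → P (x + y))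
    (hsmul : ∀ (c : ℂ) x, P x → P (c • x)) (θ : LV) : P θ := by
  have key : θ ∈ Submodule.span ℂ (Set.range xiJ) := by
    have h1 : (1 : LV) ∈ Submodule.span ℂ (Set.range xiJ) :=
      Submodule.subset_span ⟨∅, xiJ_values.1⟩
    have hι : ∀ (φ : V) (x : LV), x ∈ Submodule.span ℂ (Set.range xiJ) →
        x * ExteriorAlgebra.ι ℂ φ ∈ Submodule.span ℂ (Set.range xiJ) := by
      intro φ x hx
      have hφ : φ = ∑ k, φ k • xi k := by
        funext k
        fin_cases k <;> simp [Fin.sum_univ_three, xi]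
      rw [hφ, map_sum, Finset.mul_sum]
      refine Submodule.sum_mem _ fun k _ => ?_
      rw [map_smul, mul_smul_comm]
      refine Submodule.smul_mem _ _ ?_
      induction hx using Submodule.span_induction with
      | mem x hx =>
        obtain ⟨J, rfl⟩ := hx
        have := mul_xiι_xiJ k J
        rw [this]
        split_ifs
        · exact Submodule.zero_mem _
        · exact Submodule.smul_mem _ _ (Submodule.subset_span ⟨_, rfl⟩)
      | zero => rw [zero_mul]; exact Submodule.zero_mem _
      | add x y _ _ hx hy => rw [add_mul]; exact Submodule.add_mem _ hx hy
      | smul c x _ hx => rw [smul_mul_assoc]; exact Submodule.smul_mem _ _ hx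
    induction θ using CliffordAlgebra.right_induction with
    | algebraMap r => rw [Algebra.algebraMap_eq_smul_one]; exact Submodule.smul_mem _ _ h1
    | add x y hx hy => exact Submodule.add_mem _ hx hy
    | mul_ι φ x hx => exact hι φ x hx
  induction key using Submodule.span_induction with
  | mem x hx => obtain ⟨J, rfl⟩ := hx; exact h J
  | zero => simpa using hsmul 0 _ (h ∅)
  | add x y _ _ hx hy => exact hadd x y hx hy
  | smul c x _ hx => exact hsmul c x hx

theorem pairing_add (θ θ' : LV) : pairing (θ + θ') = pairing θ + pairing θ' := by
  simp [pairing, LinearMap.comp_add]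

theorem pairing_smul (c : ℂ) (θ : LV) : pairing (c • θ) = c • pairing θ := by
  simp [pairing, LinearMap.comp_smul]

/-- Expansion in the basis `dv_J`. -/
theorem sum_pairing_dvJ (β : LVd) : ∑ J, pairing (xiJ J) β • dvJ J = β := by
  induction β using dvJ_induction with
  | h K => simp [pairing_xiJ_dvJ]
  | hadd x y hx hy => simp only [map_add, add_smul, Finset.sum_add_distrib, hx, hy]
  | hsmul c x hx => simp only [map_smul, smul_assoc, ← Finset.smul_sum, hx]

/-- Expansion in the basis `ξ_J`. -/
theorem sum_pairing_xiJ (θ : LV) : ∑ J, pairing θ (dvJ J) • xiJ J = θ := by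
  induction θ using xiJ_induction with
  | h K => simp [pairing_xiJ_dvJ]
  | hadd x y hx hy =>
    simp only [pairing_add, LinearMap.add_apply, add_smul, Finset.sum_add_distrib, hx, hy]
  | hsmul c x hx =>
    simp only [pairing_smul, LinearMap.smul_apply, smul_assoc, ← Finset.smul_sum, hx]

theorem pairing_mul (θ θ' : LV) (β : LVd) : pairing (θ * θ') β = pairing θ (contrAlg θ' β) := by
  simp [pairing]

/-- Sorting `dv_J ∧ dv_K` and sorting `ξ_K ∧ ξ_J` are mirror images of each other, so their signs
agree and cancel in the tensor product. A common index kills both factors. -/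
theorem dvJ_mul_tmul_xiJ_mul (J K : Finset (Fin 3)) :
    (dvJ J * dvJ K) ⊗ₜ[ℂ] (xiJ K * xiJ J) =
      if Disjoint J K then dvJ (J ∪ K) ⊗ₜ[ℂ] xiJ (J ∪ K) else 0 := by
  revert K
  revert J
  obtain ⟨h0, h1, h2, h3, h4, h5, h6, h7⟩ := dvJ_values
  obtain ⟨x0, x1, x2, x3, x4, x5, x6, x7⟩ := xiJ_values
  have s (i : Fin 3) (x : LVd) : dvι i * (dvι i * x) = 0 := by rw [← mul_assoc, dvι_sq, zero_mul]
  have t (i j : Fin 3) (x : LVd) : dvι i * (dvι j * x) = -(dvι j * (dvι i * x)) := by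
    rw [← mul_assoc, dvι_swap, neg_mul, mul_assoc]
  have t' (i j : Fin 3) (x : LV) : xiι i * (xiι j * x) = -(xiι j * (xiι i * x)) := by
    rw [← mul_assoc, xiι_swap, neg_mul, mul_assoc]
  have a : ({1, 0} : Finset (Fin 3)) = {0, 1} ∧ ({2, 0} : Finset (Fin 3)) = {0, 2} ∧
    ({2, 1} : Finset (Fin 3)) = {1, 2} ∧ ({1, 0, 2} : Finset (Fin 3)) = {0, 1, 2} := by
    decide
  obtain ⟨a1, a2, a3, a4⟩ := a
  simp only [forall_finset_fin_three]
  simp [a1, a2, a3, a4, h0, h1, h2, h3, h4, h5, h6, h7, x0, x1, x2, x3, x4, x5, x6, x7,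
    mul_assoc, s, t 1 0, t 2 0, t 2 1,
    dvι_swap 1 0, dvι_swap 2 0, dvι_swap 2 1, t' 0 1, t' 0 2, t' 1 2, xiι_swap 0 1, xiι_swap 0 2,
    xiι_swap 1 2, tmul_neg, neg_tmul]

/-- A set of size n is a disjoint union J ∪ K with |J| = j in `n.choose j` ways. This serves both to
invert normal ordering and to evaluate the homotopy. -/
theorem sum_sum_dvJ_xiJ {X : Type*} [AddCommMonoid X] [Module ℂ X] (T : LVd →ₗ[ℂ] LV →ₗ[ℂ] X)
    (c : ℕ → ℕ → ℂ) :
    ∑ J, ∑ K, c J.card K.card • T (dvJ J * dvJ K) (xiJ K * xiJ J) =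
      ∑ L : Finset (Fin 3), (∑ j ∈ Finset.range (L.card + 1),
        (L.card.choose j : ℂ) * c j (L.card - j)) • T (dvJ L) (xiJ L) := by
  have h (J K : Finset (Fin 3)) : T (dvJ J * dvJ K) (xiJ K * xiJ J) =
      if Disjoint J K then T (dvJ (J ∪ K)) (xiJ (J ∪ K)) else 0 := by
    have := congrArg (TensorProduct.lift T) (dvJ_mul_tmul_xiJ_mul J K)
    rw [TensorProduct.lift.tmul] at this
    rw [this]
    split_ifs <;> simp
  have a : ({1, 0} : Finset (Fin 3)) = {0, 1} ∧ ({2, 0} : Finset (Fin 3)) = {0, 2} ∧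
    ({2, 1} : Finset (Fin 3)) = {1, 2} ∧ ({1, 0, 2} : Finset (Fin 3)) = {0, 1, 2} := by
    decide
  obtain ⟨a1, a2, a3, a4⟩ := a
  simp only [h, sum_finset_fin_three]
  simp [a1, a2, a3, a4, Finset.sum_range_succ, Nat.choose]
  module

/-! ### Normal ordering in `B` -/

theorem dvJ_mem (J : Finset (Fin 3)) : dvJ J ∈ ⋀[ℂ]^J.card (Module.Dual ℂ V) := by
  have : ∀ l : List (Fin 3), (l.map fun k => ExteriorAlgebra.ι ℂ (dv k)).prod ∈
      ⋀[ℂ]^l.length (Module.Dual ℂ V) := by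
    intro l
    induction l with
    | nil => exact SetLike.GradedOne.one_mem (A := fun i : ℕ => ⋀[ℂ]^i (Module.Dual ℂ V))
    | cons k l ih =>
      rw [List.map_cons, List.prod_cons, List.length_cons, add_comm]
      refine SetLike.GradedMul.mul_mem (A := fun i : ℕ => ⋀[ℂ]^i (Module.Dual ℂ V)) ?_ ih
      exact (pow_one (LinearMap.range (ExteriorAlgebra.ι ℂ (M := Module.Dual ℂ V)))).ge
        (LinearMap.mem_range_self _ _)
  simpa [dvJ] using this (J.sort (· ≤ ·))

theorem xiJ_mem (J : Finset (Fin 3)) : xiJ J ∈ ⋀[ℂ]^J.card V := by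
  have : ∀ l : List (Fin 3), (l.map fun k => ExteriorAlgebra.ι ℂ (xi k)).prod ∈
      ⋀[ℂ]^l.length V := by
    intro l
    induction l with
    | nil => exact SetLike.GradedOne.one_mem (A := fun i : ℕ => ⋀[ℂ]^i V)
    | cons k l ih =>
      rw [List.map_cons, List.prod_cons, List.length_cons, add_comm]
      refine SetLike.GradedMul.mul_mem (A := fun i : ℕ => ⋀[ℂ]^i V) ?_ ih
      exact (pow_one (LinearMap.range (ExteriorAlgebra.ι ℂ (M := V)))).ge
        (LinearMap.mem_range_self _ _)
  simpa [xiJ] using this (J.sort (· ≤ ·)).reverse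

/-- The projection of `Λ(V^∨)` to the part of degree `s`. -/
abbrev degProj (s : ℕ) : LVd →ₗ[ℂ] LVd :=
  GradedAlgebra.proj (fun i : ℕ => ⋀[ℂ]^i (Module.Dual ℂ V)) s

theorem degProj_of_mem {s : ℕ} {β : LVd} (h : β ∈ ⋀[ℂ]^s (Module.Dual ℂ V)) (i : ℕ) :
    degProj i β = if i = s then β else 0 := by
  rw [GradedAlgebra.proj_apply]
  split_ifs with his
  · subst his
    exact DirectSum.decompose_of_mem_same (fun i : ℕ => ⋀[ℂ]^i (Module.Dual ℂ V)) h
  · exact DirectSum.decompose_of_mem_ne (fun i : ℕ => ⋀[ℂ]^i (Module.Dual ℂ V)) h (Ne.symm his)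

theorem eq_zero_of_mem_exteriorPower {s : ℕ} (hs : 4 ≤ s) {β : LVd}
    (h : β ∈ ⋀[ℂ]^s (Module.Dual ℂ V)) : β = 0 := by
  have h1 := degProj_of_mem h s
  rw [if_pos rfl] at h1
  rw [← h1, ← sum_pairing_dvJ β, map_sum]
  refine Finset.sum_eq_zero fun J _ => ?_
  have : J.card ≤ 3 := by simpa using Finset.card_le_univ J
  rw [map_smul, degProj_of_mem (dvJ_mem J), if_neg (by omega), smul_zero]

/-- The definition sums over form degrees below 4 only; nothing is lost, because the higher exterior
powers vanish. -/
theorem scaledD_monomial (p : ℕ) (m : Fin 3 →₀ ℕ) {s : ℕ} {β : LVd}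
    (h : β ∈ ⋀[ℂ]^s (Module.Dual ℂ V)) :
    scaledD p (MvPolynomial.monomial m (1 : ℂ) ⊗ₜ β) =
      ((p.factorial : ℂ) / ∏ q ∈ Finset.range (p + 1), ((m.degree + s + q : ℕ) : ℂ)) •
        ∑ k : Fin 3, MvPolynomial.pderiv k (MvPolynomial.monomial m (1 : ℂ)) ⊗ₜ (dvι k * β) := by
  by_cases hs : 4 ≤ s
  · simp [eq_zero_of_mem_exteriorPower hs h]
  · have := (MvPolynomial.basisMonomials (Fin 3) ℂ).constr_basis ℂ (fun m : Fin 3 →₀ ℕ =>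
      ∑ s ∈ Finset.range 4,
      ((p.factorial : ℂ) / ∏ q ∈ Finset.range (p + 1), ((m.degree + s + q : ℕ) : ℂ)) •
        ∑ k : Fin 3,
          (TensorProduct.mk ℂ CV LVd (MvPolynomial.pderiv k (MvPolynomial.monomial m (1 : ℂ)))).comp
            ((LinearMap.mulLeft ℂ (ExteriorAlgebra.ι ℂ (dv k))).comp
              (GradedAlgebra.proj (fun i : ℕ => ⋀[ℂ]^i (Module.Dual ℂ V)) s))) m
    rw [MvPolynomial.coe_basisMonomials] at this
    rw [scaledD, TensorProduct.lift.tmul, this, LinearMap.sum_apply,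
      Finset.sum_eq_single_of_mem s (by simp; omega)]
    · simp [degProj_of_mem h, LinearMap.sum_apply]
    · intro i _ hi
      simp [degProj_of_mem h, LinearMap.sum_apply, hi]

/-- The products of monomials and the forms `dv_J` span `Ω(V)`. -/
theorem om_induction {P : Om → Prop}
    (h : ∀ m J, P (MvPolynomial.monomial m (1 : ℂ) ⊗ₜ dvJ J))
    (hadd : ∀ x y, P x → P y → P (x + y)) (hsmul : ∀ (c : ℂ) x, P x → P (c • x)) (τ : Om) :
    P τ := by
  induction τ using TensorProduct.induction_on with
  | zero => simpa using hsmul 0 _ (h 0 ∅)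
  | add x y hx hy => exact hadd x y hx hy
  | tmul f β =>
    induction β using dvJ_induction with
    | h J =>
      induction f using MvPolynomial.induction_on' with
      | monomial m c =>
        have e : MvPolynomial.monomial m c = c • MvPolynomial.monomial m (1 : ℂ) := by
          rw [MvPolynomial.smul_monomial, smul_eq_mul, mul_one]
        rw [e, ← smul_tmul']
        exact hsmul c _ (h m J)
      | add f g hf hg => rw [add_tmul]; exact hadd _ _ hf hg
    | hadd x y hx hy => rw [tmul_add]; exact hadd _ _ hx hy
    | hsmul c x hx => rw [tmul_smul]; exact hsmul _ _ hx

/-- Multiplication with a form from the left. -/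
def wedgeLeft (τ : Om) : B := LinearMap.mulLeft CV τ

/-- Contraction with a polyvector. -/
def contrB (θ : LV) : B := LinearMap.baseChange CV (contrAlg θ)

/-- The normally ordered operator `τ ∧ ι_θ`. -/
def nrm (τ : Om) (θ : LV) : B := wedgeLeft τ * contrB θ

theorem contrB_tmul (θ : LV) (f : CV) (β : LVd) : contrB θ (f ⊗ₜ β) = f ⊗ₜ contrAlg θ β := rfl

theorem contrB_mul (θ θ' : LV) : contrB (θ * θ') = contrB θ * contrB θ' := by
  simp [contrB, Module.End.mul_eq_comp, LinearMap.baseChange_comp]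

theorem contrB_one : contrB 1 = 1 := by
  simp [contrB, Module.End.one_eq_id]

theorem wedgeLeft_apply (τ ω : Om) : wedgeLeft τ ω = τ * ω := rfl

theorem nrm_tmul (τ : Om) (θ : LV) (f : CV) (β : LVd) :
    nrm τ θ (f ⊗ₜ β) = τ * (f ⊗ₜ contrAlg θ β) := rfl

theorem b_ext {b b' : B} (h : ∀ J, b (1 ⊗ₜ dvJ J) = b' (1 ⊗ₜ dvJ J)) : b = b' := by
  have : ∀ β : LVd, b (1 ⊗ₜ β) = b' (1 ⊗ₜ β) := by
    intro β
    rw [← sum_pairing_dvJ β]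
    simp only [tmul_sum, tmul_smul, map_sum, LinearMap.map_smul_of_tower, h]
  refine LinearMap.ext fun ω => ?_
  induction ω using TensorProduct.induction_on with
  | zero => simp
  | add x y hx hy => rw [map_add, map_add, hx, hy]
  | tmul f β =>
    have e : f ⊗ₜ[ℂ] β = f • (1 ⊗ₜ[ℂ] β : Om) := by rw [smul_tmul', smul_eq_mul, mul_one]
    rw [e, map_smul, map_smul, this]

theorem tens_tmul (τ : Om) (θ : LV) (f : CV) (β : LVd) :
    tens τ θ (f ⊗ₜ β) = pairing θ β • f • τ := by
  simp [tens]

theorem tens_one_tmul (τ : Om) (θ : LV) (β : LVd) :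
    tens τ θ (1 ⊗ₜ β) = pairing θ β • τ := by
  rw [tens_tmul, one_smul]

/-- `tens` as a bilinear map. -/
def tensL : Om →ₗ[ℂ] LV →ₗ[ℂ] B :=
  LinearMap.mk₂ ℂ tens
    (fun τ τ' θ => b_ext fun J => by
      rw [LinearMap.add_apply]; simp only [tens_one_tmul, smul_add])
    (fun c τ θ => b_ext fun J => by
      rw [LinearMap.smul_apply]; simp only [tens_one_tmul]; rw [smul_comm])
    (fun τ θ θ' => b_ext fun J => by
      rw [LinearMap.add_apply]
      simp only [tens_one_tmul, pairing_add, LinearMap.add_apply, add_smul])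
    (fun c τ θ => b_ext fun J => by
      rw [LinearMap.smul_apply]
      simp only [tens_one_tmul, pairing_smul, LinearMap.smul_apply, smul_assoc])

/-- Expansion in dual bases shows that ∑ dv_J ⊗ ξ_J represents the identity of Ω(V); multiplying the
second factor by θ on the right precomposes with ι_θ. -/
theorem incl_eq (θ : LV) : incl θ = contrB θ := by
  refine b_ext fun K => ?_
  rw [incl, LinearMap.sum_apply, contrB_tmul]
  simp only [tens_one_tmul, pairing_mul]
  conv_rhs => rw [← sum_pairing_dvJ (contrAlg θ (dvJ K))]
  simp only [tmul_sum, tmul_smul]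

theorem nrm_one (θ : LV) : nrm 1 θ = incl θ := by
  rw [incl_eq, nrm]
  have : wedgeLeft 1 = 1 := by simp [wedgeLeft, Module.End.one_eq_id]
  rw [this, one_mul]

/-- `nrm` as a bilinear map. -/
def nrmL : Om →ₗ[ℂ] LV →ₗ[ℂ] B :=
  LinearMap.mk₂ ℂ nrm
    (fun τ τ' θ => b_ext fun J => by
      rw [LinearMap.add_apply]; simp only [nrm_tmul, add_mul])
    (fun c τ θ => b_ext fun J => by
      rw [LinearMap.smul_apply]; simp only [nrm_tmul, smul_mul_assoc])
    (fun τ θ θ' => b_ext fun J => by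
      rw [LinearMap.add_apply]
      simp only [nrm_tmul, map_add, LinearMap.add_apply, tmul_add, mul_add])
    (fun c τ θ => b_ext fun J => by
      rw [LinearMap.smul_apply]
      simp only [nrm_tmul, map_smul, LinearMap.smul_apply, tmul_smul, mul_smul_comm])

theorem nrm_eq_sum_tens (τ : Om) (θ : LV) :
    nrm τ θ = ∑ J, tens (τ * 1 ⊗ₜ dvJ J) (xiJ J * θ) := by
  refine b_ext fun K => ?_
  rw [LinearMap.sum_apply, nrm_tmul]
  simp only [tens_one_tmul, pairing_mul]
  conv_lhs => rw [← sum_pairing_dvJ (contrAlg θ (dvJ K))]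
  simp only [tmul_sum, tmul_smul, Finset.mul_sum, mul_smul_comm]

theorem eq_sum_tens (b : B) : b = ∑ K, tens (b (1 ⊗ₜ dvJ K)) (xiJ K) := by
  refine b_ext fun J => ?_
  rw [LinearMap.sum_apply]
  simp [tens_one_tmul, pairing_xiJ_dvJ]

theorem tens_add_left (τ τ' : Om) (θ : LV) : tens (τ + τ') θ = tens τ θ + tens τ' θ :=
  LinearMap.map_add₂ tensL τ τ' θ

theorem tens_smul_left (c : ℂ) (τ : Om) (θ : LV) : tens (c • τ) θ = c • tens τ θ :=
  LinearMap.map_smul₂ tensL c τ θ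

theorem tens_add_right (τ : Om) (θ θ' : LV) : tens τ (θ + θ') = tens τ θ + tens τ θ' :=
  (tensL τ).map_add θ θ'

theorem tens_smul_right (c : ℂ) (τ : Om) (θ : LV) : tens τ (c • θ) = c • tens τ θ :=
  (tensL τ).map_smul c θ

theorem nrm_add_left (τ τ' : Om) (θ : LV) : nrm (τ + τ') θ = nrm τ θ + nrm τ' θ :=
  LinearMap.map_add₂ nrmL τ τ' θ

theorem nrm_smul_left (c : ℂ) (τ : Om) (θ : LV) : nrm (c • τ) θ = c • nrm τ θ :=
  LinearMap.map_smul₂ nrmL c τ θ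

theorem nrm_add_right (τ : Om) (θ θ' : LV) : nrm τ (θ + θ') = nrm τ θ + nrm τ θ' :=
  (nrmL τ).map_add θ θ'

theorem nrm_smul_right (c : ℂ) (τ : Om) (θ : LV) : nrm τ (c • θ) = c • nrm τ θ :=
  (nrmL τ).map_smul c θ

/-- The bilinear map `(β, θ') ↦ (τ ∧ β) ⊗ (θ' ∧ θ)`. -/
def tensMul (τ : Om) (θ : LV) : LVd →ₗ[ℂ] LV →ₗ[ℂ] B :=
  LinearMap.mk₂ ℂ (fun β θ' => tens (τ * 1 ⊗ₜ β) (θ' * θ))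
    (fun β β' θ' => by rw [tmul_add, mul_add, tens_add_left])
    (fun c β θ' => by rw [tmul_smul, mul_smul_comm, tens_smul_left])
    (fun β θ' θ'' => by rw [add_mul, tens_add_right])
    (fun c β θ' => by rw [smul_mul_assoc, tens_smul_right])

theorem tensMul_apply (τ : Om) (θ : LV) (β : LVd) (θ' : LV) :
    tensMul τ θ β θ' = tens (τ * 1 ⊗ₜ β) (θ' * θ) := rfl

theorem om_mul_assoc_dvJ (τ : Om) (β β' : LVd) :
    τ * 1 ⊗ₜ β * 1 ⊗ₜ β' = τ * (1 : CV) ⊗ₜ[ℂ] (β * β') := by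
  rw [mul_assoc, Algebra.TensorProduct.tmul_mul_tmul, one_mul]

/-- Inverts `nrm_eq_sum_tens`: after substitution, each set L carries the alternating sum of the
binomial coefficients of |L|, which vanishes unless L is empty. -/
theorem tens_eq_sum_nrm (τ : Om) (θ : LV) :
    tens τ θ = ∑ J : Finset (Fin 3), (-1 : ℂ) ^ J.card • nrm (τ * 1 ⊗ₜ dvJ J) (xiJ J * θ) := by
  have h := sum_sum_dvJ_xiJ (tensMul τ θ) (fun j _ => (-1 : ℂ) ^ j)
  have h2 : ∑ J : Finset (Fin 3), (-1 : ℂ) ^ J.card • nrm (τ * 1 ⊗ₜ dvJ J) (xiJ J * θ) =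
      ∑ J : Finset (Fin 3), ∑ K : Finset (Fin 3), (-1 : ℂ) ^ J.card •
        tensMul τ θ (dvJ J * dvJ K) (xiJ K * xiJ J) := by
    refine Finset.sum_congr rfl fun J _ => ?_
    rw [nrm_eq_sum_tens, Finset.smul_sum]
    refine Finset.sum_congr rfl fun K _ => ?_
    rw [tensMul_apply, om_mul_assoc_dvJ, mul_assoc]
  have h3 : tensMul τ θ (dvJ ∅) (xiJ ∅) = tens τ θ := by
    rw [tensMul_apply, dvJ_values.1, xiJ_values.1, one_mul, ← Algebra.TensorProduct.one_def,
      mul_one]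
  rw [h2, h, Finset.sum_eq_single_of_mem ∅ (Finset.mem_univ _), h3]
  · simp
  · intro L _ hL
    have : L.card ∈ Finset.Icc 1 3 := by
      have := Finset.card_le_univ L
      rw [Finset.mem_Icc]
      exact ⟨Finset.card_pos.2 (Finset.nonempty_iff_ne_empty.2 hL), by simpa using this⟩
    generalize L.card = n at this
    have e : ∑ j ∈ Finset.range (n + 1), (n.choose j : ℂ) * (-1 : ℂ) ^ j = 0 := by
      fin_cases this <;> norm_num [Finset.sum_range_succ, Nat.choose]
    rw [e, zero_smul]

/-- The normally ordered operators span `B`. -/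
theorem b_induction {P : B → Prop}
    (h : ∀ m J K, P (nrm (MvPolynomial.monomial m (1 : ℂ) ⊗ₜ dvJ J) (xiJ K)))
    (hadd : ∀ x y, P x → P y → P (x + y)) (hsmul : ∀ (c : ℂ) x, P x → P (c • x)) (b : B) : P b := by
  have h0 : P 0 := by simpa using hsmul 0 _ (h 0 ∅ ∅)
  have hsum : ∀ f : Finset (Fin 3) → B, (∀ J, P (f J)) → P (∑ J, f J) := fun f hf =>
    Finset.sum_induction f P hadd h0 fun J _ => hf J
  have hn : ∀ τ θ, P (nrm τ θ) := by
    intro τ θ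
    induction θ using xiJ_induction with
    | h K =>
      induction τ using om_induction with
      | h m J => exact h m J K
      | hadd x y hx hy => rw [nrm_add_left]; exact hadd _ _ hx hy
      | hsmul c x hx => rw [nrm_smul_left]; exact hsmul c _ hx
    | hadd x y hx hy => rw [nrm_add_right]; exact hadd _ _ hx hy
    | hsmul c x hx => rw [nrm_smul_right]; exact hsmul c _ hx
  rw [eq_sum_tens b]
  refine hsum _ fun K => ?_
  rw [tens_eq_sum_nrm]
  exact hsum _ fun J => hsmul _ _ (hn _ _)

/-! ### The homotopy on normally ordered operators -/

theorem wedgeRight_apply (β : LVd) (ω : Om) : wedgeRight β ω = ω * 1 ⊗ₜ β := by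
  induction ω using TensorProduct.induction_on with
  | zero => simp
  | add x y hx hy => rw [map_add, hx, hy, add_mul]
  | tmul f γ => simp [wedgeRight]

theorem homotopyTens_eq (τ : Om) (θ : LV) :
    homotopyTens τ θ = ∑ J, tens (scaledD J.card τ * 1 ⊗ₜ dvJ J) (xiJ J * θ) := by
  simp only [homotopyTens, wedgeRight_apply]

/-- `homotopyTens` as a bilinear map. -/
def homotopyTensL : Om →ₗ[ℂ] LV →ₗ[ℂ] B :=
  LinearMap.mk₂ ℂ homotopyTens
    (fun τ τ' θ => by
      simp only [homotopyTens_eq, map_add, add_mul, tens_add_left, Finset.sum_add_distrib])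
    (fun c τ θ => by
      simp only [homotopyTens_eq, map_smul, smul_mul_assoc, tens_smul_left, Finset.smul_sum])
    (fun τ θ θ' => by
      simp only [homotopyTens_eq, mul_add, tens_add_right, Finset.sum_add_distrib])
    (fun c τ θ => by
      simp only [homotopyTens_eq, mul_smul_comm, tens_smul_right, Finset.smul_sum])

theorem homotopyTensL_apply (τ : Om) (θ : LV) : homotopyTensL τ θ = homotopyTens τ θ := rfl

/-- The homotopy `h` as a linear map. -/
def homotopyL : B →ₗ[ℂ] B where
  toFun := homotopy
  map_add' b b' := by
    simp only [homotopy, ← homotopyTensL_apply, LinearMap.add_apply, map_add,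
      Finset.sum_add_distrib]
  map_smul' c b := by
    simp only [homotopy, ← homotopyTensL_apply, LinearMap.smul_apply, map_smul, Finset.smul_sum,
      RingHom.id_apply]

theorem homotopyL_apply (b : B) : homotopyL b = homotopy b := rfl

theorem homotopy_add (b b' : B) : homotopy (b + b') = homotopy b + homotopy b' :=
  homotopyL.map_add b b'

theorem homotopy_smul (z : ℂ) (b : B) : homotopy (z • b) = z • homotopy b := homotopyL.map_smul z b

theorem homotopy_tens (τ : Om) (θ : LV) : homotopy (tens τ θ) = homotopyTens τ θ := by
  have e : homotopyTensL τ θ = homotopyTensL τ (∑ J, pairing θ (dvJ J) • xiJ J) := by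
    rw [sum_pairing_xiJ]
  rw [← homotopyTensL_apply, e, map_sum, homotopy]
  refine Finset.sum_congr rfl fun K _ => ?_
  rw [tens_one_tmul, ← homotopyTensL_apply, map_smul, map_smul, LinearMap.smul_apply]

/-- This identity makes the coefficients of h collapse after normal ordering. For n = 1 it reads
1/(w(w+1)) + 1/(w+1) = 1/w; only sizes of subsets of three elements are needed. -/
theorem sum_choose_mul_factorial_div {w : ℕ} (hw : w ≠ 0) {n : ℕ} (hn : n ≤ 3) :
    ∑ j ∈ Finset.range (n + 1), (n.choose j : ℂ) *
      (((n - j).factorial : ℂ) / ∏ q ∈ Finset.range (n - j + 1), ((w + j + q : ℕ) : ℂ)) =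
      1 / (w : ℂ) := by
  have h0 : (w : ℂ) ≠ 0 := by exact_mod_cast hw
  have h1 : (w : ℂ) + 1 ≠ 0 := by exact_mod_cast Nat.succ_ne_zero w
  have h2 : (w : ℂ) + 2 ≠ 0 := by exact_mod_cast Nat.succ_ne_zero (w + 1)
  have h3 : (w : ℂ) + 3 ≠ 0 := by exact_mod_cast Nat.succ_ne_zero (w + 2)
  have h11 : (w : ℂ) + 1 + 1 ≠ 0 := by rwa [add_assoc, one_add_one_eq_two]
  have h12 : (w : ℂ) + 1 + 2 ≠ 0 := by convert h3 using 1; ring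
  have h21 : (w : ℂ) + 2 + 1 ≠ 0 := by convert h3 using 1; ring
  interval_cases n <;>
    simp [Finset.sum_range_succ, Finset.prod_range_succ, Nat.choose, Nat.factorial] <;>
    field_simp <;> ring

/-- The homotopy `f β ↦ df ∧ β / (r + s)` of the Koszul complex `Ω(V)`. -/
def koszulHomotopy : Om →ₗ[ℂ] Om := scaledD 0

theorem koszulHomotopy_monomial (m : Fin 3 →₀ ℕ) {s : ℕ} {β : LVd}
    (h : β ∈ ⋀[ℂ]^s (Module.Dual ℂ V)) :
    koszulHomotopy (MvPolynomial.monomial m (1 : ℂ) ⊗ₜ β) = (1 / ((m.degree + s : ℕ) : ℂ)) •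
      ∑ k : Fin 3, MvPolynomial.pderiv k (MvPolynomial.monomial m (1 : ℂ)) ⊗ₜ (dvι k * β) := by
  rw [koszulHomotopy, scaledD_monomial 0 m h]
  simp

/-- Expanding the normal ordering gives a set J, which raises the weight by |J|, and h contributes a
second set K. Grouping by L = J ∪ K, the total coefficient is 1/w for every L, which is again the
pattern of a normally ordered operator. -/
theorem homotopy_nrm (τ : Om) (θ : LV) : homotopy (nrm τ θ) = nrm (koszulHomotopy τ) θ := by
  induction τ using om_induction with
  | hadd x y hx hy =>
    rw [nrm_add_left, map_add, nrm_add_left, ← hx, ← hy]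
    exact homotopyL.map_add _ _
  | hsmul c x hx =>
    rw [nrm_smul_left, map_smul, nrm_smul_left, ← hx]
    exact homotopyL.map_smul _ _
  | h m I =>
    set dI : Om := ∑ k : Fin 3,
      MvPolynomial.pderiv k (MvPolynomial.monomial m (1 : ℂ)) ⊗ₜ (dvι k * dvJ I) with hdI
    have h := sum_sum_dvJ_xiJ (tensMul dI θ) (fun j k => ((k.factorial : ℂ) /
      ∏ q ∈ Finset.range (k + 1), ((m.degree + I.card + j + q : ℕ) : ℂ)))
    have hl : homotopy (nrm (MvPolynomial.monomial m (1 : ℂ) ⊗ₜ dvJ I) θ) =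
        ∑ J : Finset (Fin 3), ∑ K : Finset (Fin 3), ((K.card.factorial : ℂ) /
          ∏ q ∈ Finset.range (K.card + 1), ((m.degree + I.card + J.card + q : ℕ) : ℂ)) •
          tensMul dI θ (dvJ J * dvJ K) (xiJ K * xiJ J) := by
      rw [nrm_eq_sum_tens, ← homotopyL_apply, map_sum]
      refine Finset.sum_congr rfl fun J _ => ?_
      rw [homotopyL_apply, homotopy_tens, homotopyTens_eq]
      refine Finset.sum_congr rfl fun K _ => ?_
      have hmem : dvJ I * dvJ J ∈ ⋀[ℂ]^(I.card + J.card) (Module.Dual ℂ V) :=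
        SetLike.GradedMul.mul_mem (A := fun i : ℕ => ⋀[ℂ]^i (Module.Dual ℂ V))
          (dvJ_mem I) (dvJ_mem J)
      rw [Algebra.TensorProduct.tmul_mul_tmul, mul_one, scaledD_monomial _ _ hmem,
        smul_mul_assoc, tens_smul_left, tensMul_apply, ← om_mul_assoc_dvJ, mul_assoc (xiJ K)]
      have e : (∑ k : Fin 3, MvPolynomial.pderiv k (MvPolynomial.monomial m (1 : ℂ)) ⊗ₜ[ℂ]
          (dvι k * (dvJ I * dvJ J)) : Om) = dI * 1 ⊗ₜ dvJ J := by
        rw [hdI, Finset.sum_mul]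
        refine Finset.sum_congr rfl fun k _ => ?_
        rw [Algebra.TensorProduct.tmul_mul_tmul, mul_one, mul_assoc]
      rw [e, add_assoc]
    rw [hl, h, koszulHomotopy_monomial m (dvJ_mem I), ← hdI, nrm_smul_left, nrm_eq_sum_tens,
      Finset.smul_sum]
    refine Finset.sum_congr rfl fun L _ => ?_
    rw [tensMul_apply]
    -- In weight zero the form is constant, so df = 0 and both sides vanish, whatever the quotients
    -- with denominator zero are.
    by_cases hw : m.degree + I.card = 0
    · have hm : m = 0 := by
        rw [← Finsupp.degree_eq_zero_iff]; omega
      have : dI = 0 := by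
        rw [hdI, hm]; simp
      rw [this, zero_mul]
      have z : tens 0 (xiJ L * θ) = 0 := LinearMap.map_zero₂ tensL _
      rw [z, smul_zero, smul_zero]
    · rw [sum_choose_mul_factorial_div hw (by simpa using Finset.card_le_univ L)]

theorem augOm_tmul (f : CV) (β : LVd) :
    augOm (f ⊗ₜ β) = MvPolynomial.aeval (fun _ : Fin 3 => (0 : ℂ)) f *
      ExteriorAlgebra.algebraMapInv β := by
  simp [augOm]

theorem augOm_mul (τ ω : Om) : augOm (τ * ω) = augOm τ * augOm ω := by
  induction τ using TensorProduct.induction_on with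
  | zero => simp
  | add x y hx hy => rw [add_mul, map_add, map_add, hx, hy, add_mul]
  | tmul f β =>
    induction ω using TensorProduct.induction_on with
    | zero => simp
    | add x y hx hy => rw [mul_add, map_add, map_add, hx, hy, mul_add]
    | tmul g γ =>
      rw [Algebra.TensorProduct.tmul_mul_tmul, augOm_tmul, augOm_tmul, augOm_tmul, map_mul, map_mul]
      ring

/-- The projection `p` as a linear map. -/
def projL : B →ₗ[ℂ] LV where
  toFun := proj
  map_add' b b' := by
    simp only [proj, LinearMap.add_apply, map_add, add_smul, Finset.sum_add_distrib]
  map_smul' c b := by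
    simp only [proj, LinearMap.smul_apply, map_smul, smul_assoc, Finset.smul_sum, RingHom.id_apply]

theorem projL_apply (b : B) : projL b = proj b := rfl

theorem proj_add (b b' : B) : proj (b + b') = proj b + proj b' := projL.map_add b b'

theorem proj_smul (z : ℂ) (b : B) : proj (z • b) = z • proj b := projL.map_smul z b

theorem proj_nrm (τ : Om) (θ : LV) : proj (nrm τ θ) = augOm τ • θ := by
  rw [proj]
  conv_rhs => rw [← sum_pairing_xiJ θ, Finset.smul_sum]
  refine Finset.sum_congr rfl fun K _ => ?_
  rw [nrm_tmul, augOm_mul, augOm_tmul, map_one, one_mul, smul_smul]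
  rfl

theorem proj_incl (θ : LV) : proj (incl θ) = θ := by
  rw [← nrm_one, proj_nrm, Algebra.TensorProduct.one_def, augOm_tmul]
  simp

theorem augOm_koszulHomotopy (τ : Om) : augOm (koszulHomotopy τ) = 0 := by
  induction τ using om_induction with
  | hadd x y hx hy => rw [map_add, map_add, hx, hy, add_zero]
  | hsmul c x hx => rw [map_smul, map_smul, hx, smul_zero]
  | h m I =>
    rw [koszulHomotopy_monomial m (dvJ_mem I), map_smul, map_sum]
    simp [augOm_tmul, ExteriorAlgebra.algebraMapInv]

theorem koszulHomotopy_one : koszulHomotopy 1 = 0 := by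
  have := koszulHomotopy_monomial 0 (dvJ_mem ∅)
  rw [dvJ_values.1] at this
  rw [Algebra.TensorProduct.one_def, ← MvPolynomial.C_1, MvPolynomial.C_apply, this]
  simp

theorem proj_homotopy (b : B) : proj (homotopy b) = 0 := by
  induction b using b_induction with
  | h m J K => rw [homotopy_nrm, proj_nrm, augOm_koszulHomotopy, zero_smul]
  | hadd x y hx hy =>
    rw [homotopy_add, proj_add, hx, hy, add_zero]
  | hsmul c x hx =>
    rw [homotopy_smul, proj_smul, hx, smul_zero]

/-- This side condition is what removes the trees without bivalent vertices beyond the product of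
two inputs. -/
theorem homotopy_incl (θ : LV) : homotopy (incl θ) = 0 := by
  rw [← nrm_one, homotopy_nrm, koszulHomotopy_one]
  exact LinearMap.map_zero₂ nrmL θ

/-! ### Rescaling the coordinates and their differentials -/

/-- The linear map `ξ_k ↦ c_k ξ_k` of `V`. -/
abbrev diagV (c : Fin 3 → ℂ) : V →ₗ[ℂ] V := Matrix.toLin' (Matrix.diagonal c)

/-- The algebra endomorphism `ξ_k ↦ c_k ξ_k` of `Λ(V)`. -/
def scaleLV (c : Fin 3 → ℂ) : LV →ₐ[ℂ] LV := ExteriorAlgebra.map (diagV c)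

/-- The algebra endomorphism `dv_k ↦ c_k dv_k` of `Λ(V^∨)`. -/
def scaleLVd (c : Fin 3 → ℂ) : LVd →ₐ[ℂ] LVd := ExteriorAlgebra.map (diagV c).dualMap

/-- The algebra endomorphism `v_k ↦ a_k v_k` of `ℂ[V]`. -/
def scaleCV (a : Fin 3 → ℂ) : CV →ₐ[ℂ] CV :=
  MvPolynomial.aeval fun k => MvPolynomial.C (a k) * MvPolynomial.X k

/-- The algebra endomorphism `v_k ↦ a_k v_k`, `dv_k ↦ c_k dv_k` of `Ω(V)`. -/
def scaleOm (a c : Fin 3 → ℂ) : Om →ₐ[ℂ] Om :=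
  Algebra.TensorProduct.map (scaleCV a) (scaleLVd c)

theorem scaleOm_tmul (a c : Fin 3 → ℂ) (f : CV) (β : LVd) :
    scaleOm a c (f ⊗ₜ β) = scaleCV a f ⊗ₜ scaleLVd c β := by
  simp [scaleOm]

theorem dualMap_diagV_dv (c : Fin 3 → ℂ) (k : Fin 3) : (diagV c).dualMap (dv k) = c k • dv k := by
  refine LinearMap.ext fun ξ => ?_
  simp [dv, LinearMap.dualMap_apply, Matrix.mulVec_diagonal]

theorem diagV_xi (c : Fin 3 → ℂ) (k : Fin 3) : diagV c (xi k) = c k • xi k := by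
  ext j
  by_cases h : j = k
  · subst h; simp [xi, Matrix.mulVec_diagonal]
  · simp [xi, Matrix.mulVec_diagonal, h]

theorem scaleLVd_dvι (c : Fin 3 → ℂ) (k : Fin 3) : scaleLVd c (dvι k) = c k • dvι k := by
  rw [scaleLVd, ExteriorAlgebra.map_apply_ι, dualMap_diagV_dv, map_smul]

theorem scaleLV_xiι (c : Fin 3 → ℂ) (k : Fin 3) : scaleLV c (xiι k) = c k • xiι k := by
  rw [scaleLV, ExteriorAlgebra.map_apply_ι, diagV_xi, map_smul]

theorem scaleLVd_dvJ (c : Fin 3 → ℂ) (J : Finset (Fin 3)) :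
    scaleLVd c (dvJ J) = (∏ k ∈ J, c k) • dvJ J := by
  have : ∀ l : List (Fin 3), scaleLVd c (l.map dvι).prod = (l.map c).prod • (l.map dvι).prod := by
    intro l
    induction l with
    | nil => simp
    | cons k l ih =>
      rw [List.map_cons, List.prod_cons, map_mul, ih, scaleLVd_dvι, List.map_cons, List.prod_cons,
        smul_mul_smul_comm]
  have h := this (J.sort (· ≤ ·))
  have e : ((J.sort (· ≤ ·)).map c).prod = ∏ k ∈ J, c k := by
    rw [Finset.prod, ← Multiset.prod_coe, ← Multiset.map_coe, Finset.sort_eq]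
  rw [e] at h
  exact h

theorem scaleLV_xiJ (c : Fin 3 → ℂ) (J : Finset (Fin 3)) :
    scaleLV c (xiJ J) = (∏ k ∈ J, c k) • xiJ J := by
  have : ∀ l : List (Fin 3), scaleLV c (l.map xiι).prod = (l.map c).prod • (l.map xiι).prod := by
    intro l
    induction l with
    | nil => simp
    | cons k l ih =>
      rw [List.map_cons, List.prod_cons, map_mul, ih, scaleLV_xiι, List.map_cons, List.prod_cons,
        smul_mul_smul_comm]
  have h := this (J.sort (· ≤ ·)).reverse
  have e : ((J.sort (· ≤ ·)).reverse.map c).prod = ∏ k ∈ J, c k := by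
    rw [List.map_reverse, List.prod_reverse, Finset.prod, ← Multiset.prod_coe, ← Multiset.map_coe,
      Finset.sort_eq]
  rw [e] at h
  exact h

theorem scaleCV_monomial (a : Fin 3 → ℂ) (m : Fin 3 →₀ ℕ) :
    scaleCV a (MvPolynomial.monomial m 1) = (∏ k, a k ^ m k) • MvPolynomial.monomial m (1 : ℂ) := by
  rw [scaleCV, MvPolynomial.aeval_monomial, map_one, one_mul, Finsupp.prod_fintype _ _ (by simp),
    MvPolynomial.monomial_eq, map_one, one_mul, Finsupp.prod_fintype _ _ (by simp)]
  simp only [mul_pow, Finset.prod_mul_distrib, MvPolynomial.smul_eq_C_mul, map_prod, map_pow]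

theorem pderiv_scaleCV (a : Fin 3 → ℂ) (k : Fin 3) (f : CV) :
    MvPolynomial.pderiv k (scaleCV a f) = a k • scaleCV a (MvPolynomial.pderiv k f) := by
  induction f using MvPolynomial.induction_on with
  | C c => simp [scaleCV]
  | add f g hf hg => simp only [map_add, hf, hg, smul_add]
  | mul_X f j hf =>
    have hX : scaleCV a (MvPolynomial.X j) = MvPolynomial.C (a j) * MvPolynomial.X j := by
      simp [scaleCV]
    rw [map_mul, Derivation.leibniz, hf, Derivation.leibniz, map_add, smul_eq_mul, smul_eq_mul,
      smul_eq_mul, smul_eq_mul, map_mul, map_mul, hX]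
    by_cases h : j = k
    · subst h
      simp [MvPolynomial.smul_eq_C_mul]
      ring
    · simp [MvPolynomial.pderiv_X_of_ne h, MvPolynomial.smul_eq_C_mul]
      ring

theorem scaleLVd_mem (c : Fin 3 → ℂ) {s : ℕ} {β : LVd} (h : β ∈ ⋀[ℂ]^s (Module.Dual ℂ V)) :
    scaleLVd c β ∈ ⋀[ℂ]^s (Module.Dual ℂ V) := by
  have h1 := Submodule.mem_map_of_mem (f := (scaleLVd c).toLinearMap) h
  rw [Submodule.map_pow] at h1
  have h2 : Submodule.map (scaleLVd c).toLinearMap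
      (LinearMap.range (ExteriorAlgebra.ι ℂ (M := Module.Dual ℂ V))) ≤
      LinearMap.range (ExteriorAlgebra.ι ℂ (M := Module.Dual ℂ V)) := by
    rw [scaleLVd, ExteriorAlgebra.ι_range_map_map]
    rintro _ ⟨x, _, rfl⟩
    exact ⟨x, rfl⟩
  exact pow_le_pow_left' h2 s h1

theorem contr_scale {c c' : Fin 3 → ℂ} (hc : ∀ k, c k * c' k = 1) (ξ : V) (β : LVd) :
    contr (diagV c' ξ) (scaleLVd c β) = scaleLVd c (contr ξ β) := by
  induction β using CliffordAlgebra.left_induction with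
  | algebraMap r =>
    rw [AlgHom.commutes, Algebra.algebraMap_eq_smul_one, map_smul, map_smul, contr_one, contr_one]
    simp
  | add x y hx hy => rw [map_add, map_add, hx, hy, map_add, map_add]
  | ι_mul x φ hx =>
    have e : diagV c (diagV c' ξ) = ξ := by
      ext k
      simp [Matrix.mulVec_diagonal, ← mul_assoc, hc]
    have h1 := contr_ι_mul ξ φ x
    have h2 : scaleLVd c (ExteriorAlgebra.ι ℂ φ * x) =
        ExteriorAlgebra.ι ℂ ((diagV c).dualMap φ) * scaleLVd c x := by
      rw [map_mul, scaleLVd, ExteriorAlgebra.map_apply_ι]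
    have h3 := contr_ι_mul (diagV c' ξ) ((diagV c).dualMap φ) (scaleLVd c x)
    refine (congrArg _ h2).trans (h3.trans ?_)
    refine Eq.trans ?_ (congrArg _ h1).symm
    rw [map_sub, map_smul, map_mul, hx, LinearMap.dualMap_apply, e]
    rw [scaleLVd, ExteriorAlgebra.map_apply_ι]

theorem contrAlg_scale {c c' : Fin 3 → ℂ} (hc : ∀ k, c k * c' k = 1) (θ : LV) (β : LVd) :
    contrAlg (scaleLV c' θ) (scaleLVd c β) = scaleLVd c (contrAlg θ β) := by
  induction θ using ExteriorAlgebra.induction generalizing β with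
  | algebraMap r => simp [AlgHom.commutes, Module.algebraMap_end_apply]
  | ι ξ =>
    rw [scaleLV, ExteriorAlgebra.map_apply_ι, contrAlg_ι, contrAlg_ι, contr_scale hc]
  | mul x y hx hy => rw [map_mul, contrAlg_mul_apply, hy, hx, contrAlg_mul_apply]
  | add x y hx hy =>
    rw [map_add, map_add, LinearMap.add_apply, hx, hy, map_add, LinearMap.add_apply, map_add]

theorem algebraMapInv_scaleLVd (c : Fin 3 → ℂ) (β : LVd) :
    ExteriorAlgebra.algebraMapInv (scaleLVd c β) = ExteriorAlgebra.algebraMapInv β := by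
  have : (ExteriorAlgebra.algebraMapInv (R := ℂ)).comp (scaleLVd c) =
      ExteriorAlgebra.algebraMapInv := by
    ext φ
    simp [scaleLVd, ExteriorAlgebra.algebraMapInv]
  exact DFunLike.congr_fun this β

theorem augOm_scaleOm (a c : Fin 3 → ℂ) (τ : Om) : augOm (scaleOm a c τ) = augOm τ := by
  induction τ using TensorProduct.induction_on with
  | zero => simp
  | add x y hx hy => rw [map_add, map_add, map_add, hx, hy]
  | tmul f β =>
    have : (MvPolynomial.aeval (fun _ : Fin 3 => (0 : ℂ))).comp (scaleCV a) =
        MvPolynomial.aeval (fun _ : Fin 3 => (0 : ℂ)) := by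
      ext k
      simp [scaleCV]
    rw [scaleOm_tmul, augOm_tmul, augOm_tmul, algebraMapInv_scaleLVd]
    exact congrArg (· * _) (DFunLike.congr_fun this f)

/-- The exterior derivative trades one v_k for one dv_k and so picks up a_k / c_k = r, while the
weight in the denominator does not change. -/
theorem koszulHomotopy_scaleOm {a c : Fin 3 → ℂ} {r : ℂ} (h : ∀ k, a k = r * c k) (τ : Om) :
    koszulHomotopy (scaleOm a c τ) = r • scaleOm a c (koszulHomotopy τ) := by
  induction τ using om_induction with
  | hadd x y hx hy => rw [map_add, map_add, map_add, map_add, hx, hy, smul_add]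
  | hsmul z x hx => rw [map_smul, map_smul, map_smul, map_smul, hx, smul_comm]
  | h m I =>
    rw [koszulHomotopy_monomial m (dvJ_mem I), scaleOm_tmul, scaleCV_monomial, ← smul_tmul',
      map_smul, koszulHomotopy_monomial m (scaleLVd_mem c (dvJ_mem I)), map_smul,
      smul_comm r, smul_comm (∏ k, a k ^ m k), map_sum]
    simp only [Finset.smul_sum]
    refine Finset.sum_congr rfl fun k _ => ?_
    congr 1
    rw [smul_tmul', ← Derivation.map_smul, ← scaleCV_monomial, pderiv_scaleCV, scaleOm_tmul,
      map_mul, scaleLVd_dvι, smul_mul_assoc, tmul_smul, ← smul_tmul', smul_smul, h k]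

/-- The operators `b` and `b'` are intertwined by the rescaling. -/
def Intertw (a c : Fin 3 → ℂ) (b b' : B) : Prop := ∀ ω, scaleOm a c (b ω) = b' (scaleOm a c ω)

theorem scaleOm_surjective {a c : Fin 3 → ℂ} (ha : ∀ k, a k ≠ 0) (hc : ∀ k, c k ≠ 0) :
    Function.Surjective (scaleOm a c) := by
  intro τ
  induction τ using om_induction with
  | hadd x y hx hy =>
    obtain ⟨x, rfl⟩ := hx
    obtain ⟨y, rfl⟩ := hy
    exact ⟨x + y, map_add _ _ _⟩
  | hsmul z x hx =>
    obtain ⟨x, rfl⟩ := hx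
    exact ⟨z • x, map_smul _ _ _⟩
  | h m I =>
    have h1 : ∏ k, a k ^ m k ≠ 0 := Finset.prod_ne_zero_iff.2 fun k _ => pow_ne_zero _ (ha k)
    have h2 : ∏ k ∈ I, c k ≠ 0 := Finset.prod_ne_zero_iff.2 fun k _ => hc k
    refine ⟨((∏ k, a k ^ m k)⁻¹ * (∏ k ∈ I, c k)⁻¹) •
      (MvPolynomial.monomial m (1 : ℂ) ⊗ₜ dvJ I), ?_⟩
    rw [map_smul, scaleOm_tmul, scaleCV_monomial, scaleLVd_dvJ, smul_tmul_smul, smul_smul,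
      mul_mul_mul_comm, inv_mul_cancel₀ h1, inv_mul_cancel₀ h2, one_mul, one_smul]

namespace Intertw

variable {a c : Fin 3 → ℂ} {b b' x x' : B}

theorem add (h : Intertw a c b b') (h' : Intertw a c x x') : Intertw a c (b + x) (b' + x') :=
  fun ω => by rw [LinearMap.add_apply, map_add, h, h', LinearMap.add_apply]

theorem smul (z : ℂ) (h : Intertw a c b b') : Intertw a c (z • b) (z • b') :=
  fun ω => by rw [LinearMap.smul_apply, map_smul, h, LinearMap.smul_apply]

theorem sub (h : Intertw a c b b') (h' : Intertw a c x x') : Intertw a c (b - x) (b' - x') :=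
  fun ω => by rw [LinearMap.sub_apply, map_sub, h, h', LinearMap.sub_apply]

theorem mul (h : Intertw a c b b') (h' : Intertw a c x x') : Intertw a c (b * x) (b' * x') :=
  fun ω => by rw [Module.End.mul_apply, h, h', Module.End.mul_apply]

theorem wedgeLeft (τ : Om) : Intertw a c (wedgeLeft τ) (wedgeLeft (scaleOm a c τ)) :=
  fun _ => map_mul _ _ _

theorem contrB {c' : Fin 3 → ℂ} (hc : ∀ k, c k * c' k = 1) (θ : LV) :
    Intertw a c (contrB θ) (contrB (scaleLV c' θ)) := by
  intro ω
  induction ω using TensorProduct.induction_on with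
  | zero => simp
  | add x y hx hy => simp only [map_add, hx, hy]
  | tmul f β => rw [contrB_tmul, scaleOm_tmul, scaleOm_tmul, contrB_tmul, contrAlg_scale hc]

theorem nrm {c' : Fin 3 → ℂ} (hc : ∀ k, c k * c' k = 1) (τ : Om) (θ : LV) :
    Intertw a c (nrm τ θ) (nrm (scaleOm a c τ) (scaleLV c' θ)) :=
  (Intertw.wedgeLeft τ).mul (Intertw.contrB hc θ)

theorem eq (ha : ∀ k, a k ≠ 0) (hc : ∀ k, c k ≠ 0) (h : Intertw a c b b')
    (h' : Intertw a c b x') : b' = x' := by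
  refine LinearMap.ext fun ω => ?_
  obtain ⟨ω, rfl⟩ := scaleOm_surjective ha hc ω
  rw [← h, h']

/-- A rescaling of Ω(V) is in general not ℂ[V]-linear and so not an element of B; the relation
`Intertw` replaces conjugation by it. A partner b' is built from normally ordered operators, on
which h and p are explicit; `Intertw.eq` makes it unique when the scale factors are nonzero. -/
theorem exists_homotopy_proj {c' : Fin 3 → ℂ} (hc : ∀ k, c k * c' k = 1) {r : ℂ}
    (hr : ∀ k, a k = r * c k) (b : B) :
    ∃ b', Intertw a c b b' ∧ Intertw a c (r • homotopy b) (homotopy b') ∧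
      proj b' = scaleLV c' (proj b) := by
  induction b using b_induction with
  | h m J K =>
    refine ⟨_, Intertw.nrm hc _ _, ?_, ?_⟩
    · rw [homotopy_nrm, homotopy_nrm, koszulHomotopy_scaleOm hr, nrm_smul_left]
      exact (Intertw.nrm hc _ _).smul r
    · rw [proj_nrm, proj_nrm, augOm_scaleOm, map_smul]
  | hadd x y hx hy =>
    obtain ⟨x', h1, h2, h3⟩ := hx
    obtain ⟨y', h4, h5, h6⟩ := hy
    refine ⟨x' + y', h1.add h4, ?_, ?_⟩
    · have := h2.add h5
      rwa [homotopy_add, homotopy_add, smul_add]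
    · rw [proj_add, proj_add, map_add, h3, h6]
  | hsmul z x hx =>
    obtain ⟨x', h1, h2, h3⟩ := hx
    refine ⟨z • x', h1.smul z, ?_, ?_⟩
    · have := h2.smul z
      rwa [homotopy_smul, homotopy_smul, smul_comm r z]
    · rw [proj_smul, proj_smul, map_smul, h3]

theorem homotopy {c' : Fin 3 → ℂ} (ha : ∀ k, a k ≠ 0) (hc : ∀ k, c k * c' k = 1) {r : ℂ}
    (hr : ∀ k, a k = r * c k) (h : Intertw a c b b') :
    Intertw a c (r • homotopy b) (homotopy b') := by
  obtain ⟨x, h1, h2, _⟩ := exists_homotopy_proj hc hr b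
  rwa [h.eq ha (fun k => left_ne_zero_of_mul_eq_one (hc k)) h1]

theorem proj {c' : Fin 3 → ℂ} (ha : ∀ k, a k ≠ 0) (hc : ∀ k, c k * c' k = 1) {r : ℂ}
    (hr : ∀ k, a k = r * c k) (h : Intertw a c b b') : proj b' = scaleLV c' (proj b) := by
  obtain ⟨x, h1, _, h3⟩ := exists_homotopy_proj hc hr b
  rwa [h.eq ha (fun k => left_ne_zero_of_mul_eq_one (hc k)) h1]

end Intertw

/-! ### Parity -/

theorem involute_eq_scaleLVd (β : LVd) :
    CliffordAlgebra.involute (Q := (0 : QuadraticForm ℂ (Module.Dual ℂ V))) β =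
      scaleLVd (fun _ => -1) β := by
  have : CliffordAlgebra.involute (Q := (0 : QuadraticForm ℂ (Module.Dual ℂ V))) =
      scaleLVd (fun _ => -1) := by
    refine CliffordAlgebra.hom_ext (LinearMap.ext fun φ => ?_)
    have h1 : (diagV fun _ => -1).dualMap φ = -φ := by
      refine LinearMap.ext fun ξ => ?_
      have : diagV (fun _ => -1) ξ = -ξ := by
        ext k; simp [Matrix.mulVec_diagonal]
      rw [LinearMap.dualMap_apply, this, map_neg, LinearMap.neg_apply]
    have h2 : scaleLVd (fun _ => -1) (ExteriorAlgebra.ι ℂ φ) = -ExteriorAlgebra.ι ℂ φ := by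
      rw [scaleLVd, ExteriorAlgebra.map_apply_ι, h1, map_neg]
    exact (CliffordAlgebra.involute_ι φ).trans h2.symm
  rw [this]

theorem parLV_eq (θ : LV) : parLV θ = scaleLV (fun _ => -1) θ := by
  have : CliffordAlgebra.involute (Q := (0 : QuadraticForm ℂ V)) = scaleLV (fun _ => -1) := by
    refine CliffordAlgebra.hom_ext (LinearMap.ext fun ξ => ?_)
    have h1 : diagV (fun _ => -1) ξ = -ξ := by
      ext k; simp [Matrix.mulVec_diagonal]
    have h2 : scaleLV (fun _ => -1) (ExteriorAlgebra.ι ℂ ξ) = -ExteriorAlgebra.ι ℂ ξ := by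
      rw [scaleLV, ExteriorAlgebra.map_apply_ι, h1, map_neg]
    exact (CliffordAlgebra.involute_ι ξ).trans h2.symm
  rw [← this]
  rfl

theorem parLV_mul (θ θ' : LV) : parLV (θ * θ') = parLV θ * parLV θ' := by
  simp only [parLV_eq, map_mul]

theorem parLV_ι (ξ : V) : parLV (ExteriorAlgebra.ι ℂ ξ) = -ExteriorAlgebra.ι ℂ ξ :=
  CliffordAlgebra.involute_ι ξ

theorem parLV_parLV (θ : LV) : parLV (parLV θ) = θ :=
  CliffordAlgebra.involute_involute θ

theorem parOm_tmul (f : CV) (β : LVd) : parOm (f ⊗ₜ β) = f ⊗ₜ scaleLVd (fun _ => -1) β := by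
  rw [← involute_eq_scaleLVd]
  rfl

theorem parOm_eq (ω : Om) : parOm ω = scaleOm (fun _ => 1) (fun _ => -1) ω := by
  induction ω using TensorProduct.induction_on with
  | zero => simp
  | add x y hx hy => rw [map_add, map_add, hx, hy]
  | tmul f β =>
    have : scaleCV (fun _ => 1) = AlgHom.id ℂ CV := by
      refine MvPolynomial.algHom_ext fun k => ?_
      simp [scaleCV]
    rw [parOm_tmul, scaleOm_tmul, this]
    rfl

theorem parOm_mul_parOm : parOm * parOm = 1 := by
  refine b_ext fun J => ?_
  rw [Module.End.mul_apply, parOm_tmul, parOm_tmul, ← involute_eq_scaleLVd,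
    ← involute_eq_scaleLVd, CliffordAlgebra.involute_involute, Module.End.one_apply]

theorem parB_apply (b : B) : parB b = parOm * b * parOm := rfl

theorem parB_mul (b b' : B) : parB (b * b') = parB b * parB b' := by
  rw [parB_apply, parB_apply, parB_apply]
  calc parOm * (b * b') * parOm = parOm * b * 1 * (b' * parOm) := by noncomm_ring
    _ = _ := by rw [← parOm_mul_parOm]; noncomm_ring

theorem parB_parB (b : B) : parB (parB b) = b := by
  rw [parB_apply, parB_apply]
  calc parOm * (parOm * b * parOm) * parOm = (parOm * parOm) * b * (parOm * parOm) := by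
        noncomm_ring
    _ = b := by rw [parOm_mul_parOm, one_mul, mul_one]

/-- Parity is the rescaling of the dv_k alone by -1, so that statements about signs become cases of
the rescaling lemmas. -/
theorem intertw_parB (b : B) : Intertw (fun _ => 1) (fun _ => -1) b (parB b) := by
  intro ω
  rw [← parOm_eq, ← parOm_eq, parB_apply, Module.End.mul_apply, Module.End.mul_apply,
    ← Module.End.mul_apply parOm parOm, parOm_mul_parOm, Module.End.one_apply]

theorem Intertw.parB_eq {b b' : B} (h : Intertw (fun _ => 1) (fun _ => -1) b b') : parB b = b' :=
  (intertw_parB b).eq (by simp) (by simp) h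

theorem parB_homotopy (b : B) : parB (homotopy b) = -homotopy (parB b) := by
  have := (intertw_parB b).homotopy (c' := fun _ => -1) (r := -1) (by simp) (by simp) (by simp)
  have := this.parB_eq
  rw [map_smul] at this
  rw [← this]
  module

theorem parB_nrm (τ : Om) (θ : LV) : parB (nrm τ θ) = nrm (parOm τ) (parLV θ) := by
  rw [parOm_eq, parLV_eq]
  exact (Intertw.nrm (by simp) τ θ).parB_eq

theorem parB_contrB (θ : LV) : parB (contrB θ) = contrB (parLV θ) := by
  rw [parLV_eq]
  exact (Intertw.contrB (by simp) θ).parB_eq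

theorem parB_wedgeLeft (τ : Om) : parB (wedgeLeft τ) = wedgeLeft (parOm τ) := by
  rw [parOm_eq]
  exact (Intertw.wedgeLeft τ).parB_eq

theorem parB_incl (θ : LV) : parB (incl θ) = incl (parLV θ) := by
  rw [incl_eq, incl_eq, parB_contrB]

/-! ### Contraction with the Euler vector field -/

theorem contr_mul (ξ : V) (α β : LVd) :
    contr ξ (α * β) = contr ξ α * β + scaleLVd (fun _ => -1) α * contr ξ β := by
  induction α using CliffordAlgebra.left_induction with
  | algebraMap r =>
    rw [AlgHom.commutes, Algebra.algebraMap_eq_smul_one, map_smul, contr_one]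
    simp
  | add x y hx hy => rw [add_mul, map_add, hx, hy, map_add, map_add]; noncomm_ring
  | ι_mul x φ hx =>
    have e : scaleLVd (fun _ => -1) (CliffordAlgebra.ι 0 φ * x) =
        -(ExteriorAlgebra.ι ℂ φ * scaleLVd (fun _ => -1) x) := by
      rw [map_mul, ← involute_eq_scaleLVd, CliffordAlgebra.involute_ι, neg_mul]
    rw [e]
    change contr ξ (ExteriorAlgebra.ι ℂ φ * x * β) = contr ξ (ExteriorAlgebra.ι ℂ φ * x) * β + _
    rw [mul_assoc, contr_ι_mul, contr_ι_mul, hx]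
    rw [sub_mul, smul_mul_assoc]
    noncomm_ring

theorem contr_contrAlg (ξ : V) (θ : LV) (β : LVd) :
    contr ξ (contrAlg θ β) = contrAlg (parLV θ) (contr ξ β) := by
  induction θ using ExteriorAlgebra.induction generalizing β with
  | algebraMap r => simp [parLV_eq, AlgHom.commutes, Module.algebraMap_end_apply]
  | ι ξ' =>
    rw [contrAlg_ι, parLV_ι, map_neg, contrAlg_ι, LinearMap.neg_apply]
    exact CliffordAlgebra.contractLeft_comm _ _ _
  | mul x y hx hy => rw [contrAlg_mul_apply, hx, hy, parLV_mul, contrAlg_mul_apply]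
  | add x y hx hy =>
    rw [map_add, LinearMap.add_apply, map_add, hx, hy, map_add, map_add, LinearMap.add_apply]

theorem iotaEta_tmul (f : CV) (β : LVd) :
    iotaEta (f ⊗ₜ β) = ∑ k, (MvPolynomial.X k * f) ⊗ₜ contr (xi k) β := by
  rw [iotaEta, LinearMap.sum_apply]
  rfl

theorem iotaEta_mul (τ ω : Om) : iotaEta (τ * ω) = iotaEta τ * ω + parOm τ * iotaEta ω := by
  induction τ using TensorProduct.induction_on with
  | zero => simp
  | add x y hx hy => rw [add_mul, map_add, hx, hy, map_add, map_add]; noncomm_ring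
  | tmul f α =>
    induction ω using TensorProduct.induction_on with
    | zero => simp
    | add x y hx hy => rw [mul_add, map_add, hx, hy, map_add]; noncomm_ring
    | tmul g β =>
      rw [Algebra.TensorProduct.tmul_mul_tmul, iotaEta_tmul, iotaEta_tmul, iotaEta_tmul,
        parOm_tmul, Finset.sum_mul, Finset.mul_sum, ← Finset.sum_add_distrib]
      refine Finset.sum_congr rfl fun k _ => ?_
      rw [Algebra.TensorProduct.tmul_mul_tmul, Algebra.TensorProduct.tmul_mul_tmul, contr_mul,
        tmul_add, mul_assoc, mul_left_comm f]

theorem iotaEta_one : iotaEta 1 = 0 := by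
  rw [Algebra.TensorProduct.one_def, iotaEta_tmul]
  simp [contr_one]

theorem iotaEta_mul_wedgeLeft (τ : Om) :
    iotaEta * wedgeLeft τ = wedgeLeft (iotaEta τ) + wedgeLeft (parOm τ) * iotaEta :=
  LinearMap.ext fun ω => iotaEta_mul τ ω

theorem iotaEta_mul_contrB (θ : LV) : iotaEta * contrB θ = contrB (parLV θ) * iotaEta := by
  refine b_ext fun J => ?_
  rw [Module.End.mul_apply, Module.End.mul_apply, contrB_tmul, iotaEta_tmul, iotaEta_tmul, map_sum]
  simp only [contrB_tmul, contr_contrAlg]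

/-- As ι_η is an odd derivation of Ω(V) and supercommutes with ι_θ, the terms that end in ι_η cancel
in the graded commutator. -/
theorem inducedDiff_iotaEta_nrm (τ : Om) (θ : LV) :
    inducedDiff iotaEta (nrm τ θ) = nrm (iotaEta τ) θ := by
  rw [inducedDiff, parB_nrm, nrm, nrm, nrm, ← mul_assoc, iotaEta_mul_wedgeLeft, mul_assoc,
    add_mul, mul_assoc, iotaEta_mul_contrB]
  abel

/-- Euler's identity for the odd variables dv_k. -/
theorem sum_dvι_mul_contr (J : Finset (Fin 3)) :
    ∑ k, dvι k * contr (xi k) (dvJ J) = (J.card : ℂ) • dvJ J := by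
  revert J
  obtain ⟨h0, h1, h2, h3, h4, h5, h6, h7⟩ := dvJ_values
  have t (i j : Fin 3) (x : LVd) : dvι i * (dvι j * x) = -(dvι j * (dvι i * x)) := by
    rw [← mul_assoc, dvι_swap, neg_mul, mul_assoc]
  simp only [forall_finset_fin_three, Fin.sum_univ_three]
  simp [h0, h1, h2, h3, h4, h5, h6, h7, contr_ι_mul, contr_ι, contr_one, dv_xi, t 1 0, t 2 0,
    dvι_swap 1 0, dvι_swap 2 0, dvι_swap 2 1]
  refine ⟨?_, ?_, ?_, ?_⟩ <;> module

theorem contr_dvJ_mem (ξ : V) (J : Finset (Fin 3)) :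
    contr ξ (dvJ J) ∈ ⋀[ℂ]^(J.card - 1) (Module.Dual ℂ V) := by
  have hι (k : Fin 3) : dvι k ∈ ⋀[ℂ]^1 (Module.Dual ℂ V) := by
    have : dvι k = dvJ {k} := by simp [dvJ]
    rw [this]
    simpa using dvJ_mem {k}
  have : ∀ l : List (Fin 3), (l.map dvι).prod ∈ ⋀[ℂ]^l.length (Module.Dual ℂ V) ∧
      contr ξ (l.map dvι).prod ∈ ⋀[ℂ]^(l.length - 1) (Module.Dual ℂ V) := by
    intro l
    induction l with
    | nil =>
      refine ⟨SetLike.GradedOne.one_mem (A := fun i : ℕ => ⋀[ℂ]^i (Module.Dual ℂ V)), ?_⟩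
      rw [List.map_nil, List.prod_nil, contr_one]
      exact Submodule.zero_mem _
    | cons k l ih =>
      rw [List.map_cons, List.prod_cons, List.length_cons, add_tsub_cancel_right]
      refine ⟨?_, ?_⟩
      · rw [add_comm]
        exact SetLike.GradedMul.mul_mem (A := fun i : ℕ => ⋀[ℂ]^i (Module.Dual ℂ V)) (hι k) ih.1
      · rw [contr_ι_mul]
        refine Submodule.sub_mem _ (Submodule.smul_mem _ _ ih.1) ?_
        cases l with
        | nil => simp [contr_one]
        | cons j l =>
          have := SetLike.GradedMul.mul_mem (A := fun i : ℕ => ⋀[ℂ]^i (Module.Dual ℂ V))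
            (hι k) ih.2
          rwa [List.length_cons, add_tsub_cancel_right, add_comm] at this
  have h := (this (J.sort (· ≤ ·))).2
  rw [Finset.length_sort] at h
  exact h

/-- Cartan's formula: dι_η + ι_η d is the Lie derivative along η, which multiplies fβ by r + s.
Dividing by the weight contracts everything except weight zero, which is spanned by 1. -/
theorem iotaEta_koszulHomotopy (τ : Om) :
    iotaEta (koszulHomotopy τ) + koszulHomotopy (iotaEta τ) = τ - augOm τ • 1 := by
  induction τ using om_induction with
  | hadd x y hx hy =>
    simp only [map_add, add_smul]
    rw [add_sub_add_comm, ← hx, ← hy]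
    abel
  | hsmul c x hx =>
    simp only [map_smul, LinearMap.map_smul_of_tower, smul_assoc]
    rw [← smul_add, hx, smul_sub]
  | h m I =>
    set f : CV := MvPolynomial.monomial m 1 with hf
    have hX (k : Fin 3) :
        MvPolynomial.X k * f = MvPolynomial.monomial (Finsupp.single k 1 + m) 1 := by
      rw [hf, MvPolynomial.X, MvPolynomial.monomial_mul, one_mul]
    by_cases hI : I = ∅ ∧ m = 0
    · obtain ⟨rfl, rfl⟩ := hI
      have e : (f ⊗ₜ[ℂ] dvJ ∅ : Om) = 1 := by rw [dvJ_values.1, hf]; rfl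
      have e' : augOm 1 = 1 := by rw [Algebra.TensorProduct.one_def, augOm_tmul]; simp
      rw [e, koszulHomotopy_one, iotaEta_one, e', map_zero, map_zero, one_smul, sub_self, add_zero]
    · have hw : ((m.degree + I.card : ℕ) : ℂ) ≠ 0 := by
        rw [Nat.cast_ne_zero]
        intro h
        refine hI ⟨Finset.card_eq_zero.1 (by omega), ?_⟩
        rw [← Finsupp.degree_eq_zero_iff]
        omega
      have haug : augOm (f ⊗ₜ dvJ I) = 0 := by
        rw [augOm_tmul]
        by_cases hm : m = 0
        · have hI' : I ≠ ∅ := fun h => hI ⟨h, hm⟩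
          have := pairing_xiJ_dvJ ∅ I
          rw [if_neg hI'.symm, xiJ_values.1] at this
          have e : ExteriorAlgebra.algebraMapInv (dvJ I) = pairing 1 (dvJ I) := by simp [pairing]
          rw [e, this, mul_zero]
        · have : MvPolynomial.aeval (fun _ : Fin 3 => (0 : ℂ)) f = 0 := by
            rw [hf, MvPolynomial.aeval_monomial, map_one, one_mul]
            obtain ⟨k, hk⟩ := Finsupp.ne_iff.1 hm
            exact Finset.prod_eq_zero (Finsupp.mem_support_iff.2 hk) (zero_pow hk)
          rw [this, zero_mul]
      have hD (k : Fin 3) : koszulHomotopy ((MvPolynomial.X k * f) ⊗ₜ contr (xi k) (dvJ I)) =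
          (1 / ((m.degree + I.card : ℕ) : ℂ)) • ∑ j : Fin 3,
            MvPolynomial.pderiv j (MvPolynomial.X k * f) ⊗ₜ (dvι j * contr (xi k) (dvJ I)) := by
        -- The factor v_k raises the weight by one and the contraction lowers it by one. Empty I is
        -- separate because `I.card - 1` truncates there; the contraction is then zero.
        rcases Finset.eq_empty_or_nonempty I with rfl | hI'
        · simp [dvJ_values.1, contr_one]
        · rw [hX, koszulHomotopy_monomial _ (contr_dvJ_mem (xi k) I)]
          have := hI'.card_pos
          have e : (Finsupp.single k 1 + m).degree + (I.card - 1) = m.degree + I.card := by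
            rw [map_add, Finsupp.degree_single]; omega
          rw [e]
      have hE : ∑ k, MvPolynomial.X k * MvPolynomial.pderiv k f = (m.degree : ℂ) • f := by
        have := (MvPolynomial.isHomogeneous_monomial (1 : ℂ)
          (rfl : m.degree = m.degree)).sum_X_mul_pderiv
        rw [this, Nat.cast_smul_eq_nsmul]
      rw [haug, zero_smul, sub_zero, koszulHomotopy_monomial m (dvJ_mem I),
        LinearMap.map_smul_of_tower, iotaEta_tmul, map_sum, map_sum]
      simp only [hD, iotaEta_tmul]
      rw [← Finset.smul_sum, ← smul_add]
      have key : (∑ k, ∑ j, (MvPolynomial.X j * MvPolynomial.pderiv k f) ⊗ₜ[ℂ]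
            contr (xi j) (dvι k * dvJ I) +
          ∑ k, ∑ j, MvPolynomial.pderiv j (MvPolynomial.X k * f) ⊗ₜ[ℂ]
            (dvι j * contr (xi k) (dvJ I)) : Om) =
          ((m.degree + I.card : ℕ) : ℂ) • (f ⊗ₜ dvJ I) := by
        -- The terms which both differentiate f and contract dv_I occur in `e1` and `e2` with
        -- opposite signs; what remains are the two Euler identities.
        have e1 : (∑ k, ∑ j, (MvPolynomial.X j * MvPolynomial.pderiv k f) ⊗ₜ[ℂ]
            contr (xi j) (dvι k * dvJ I) : Om) = (m.degree : ℂ) • (f ⊗ₜ dvJ I) -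
            ∑ k, ∑ j, (MvPolynomial.X j * MvPolynomial.pderiv k f) ⊗ₜ[ℂ]
              (dvι k * contr (xi j) (dvJ I)) := by
          rw [smul_tmul', ← hE, sum_tmul, ← Finset.sum_sub_distrib]
          refine Finset.sum_congr rfl fun k _ => ?_
          simp only [contr_ι_mul, dv_xi, tmul_sub, Finset.sum_sub_distrib, ite_smul, zero_smul,
            one_smul]
          congr 1
          rw [Finset.sum_eq_single_of_mem k (Finset.mem_univ _)]
          · simp
          · intro j _ hj; simp [hj.symm]
        have e2 : (∑ k, ∑ j, MvPolynomial.pderiv j (MvPolynomial.X k * f) ⊗ₜ[ℂ]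
            (dvι j * contr (xi k) (dvJ I)) : Om) = (I.card : ℂ) • (f ⊗ₜ dvJ I) +
            ∑ k, ∑ j, (MvPolynomial.X j * MvPolynomial.pderiv k f) ⊗ₜ[ℂ]
              (dvι k * contr (xi j) (dvJ I)) := by
          rw [← tmul_smul, ← sum_dvι_mul_contr, tmul_sum]
          rw [Finset.sum_comm (f := fun k j => (MvPolynomial.X j * MvPolynomial.pderiv k f) ⊗ₜ[ℂ]
              (dvι k * contr (xi j) (dvJ I)))]
          rw [← Finset.sum_add_distrib]
          refine Finset.sum_congr rfl fun k _ => ?_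
          have (j : Fin 3) : MvPolynomial.pderiv j (MvPolynomial.X k * f) =
              (if j = k then f else 0) + MvPolynomial.X k * MvPolynomial.pderiv j f := by
            rw [Derivation.leibniz, smul_eq_mul, smul_eq_mul, add_comm]
            split_ifs with h
            · subst h; simp
            · rw [MvPolynomial.pderiv_X_of_ne (Ne.symm h), mul_zero]
          simp only [this, add_tmul, Finset.sum_add_distrib]
          congr 1
          rw [Finset.sum_eq_single_of_mem k (Finset.mem_univ _)]
          · simp
          · intro j _ hj; simp [hj]
        rw [e1, e2]
        push_cast
        module
      rw [key, smul_smul, one_div, inv_mul_cancel₀ hw, one_smul]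

/-! ### Sums over decompositions of lists -/

/-- The sum of `K x y` over all decompositions `l = x ++ y`. -/
def splitSum {A X : Type} [AddCommMonoid X] : (List A → List A → X) → List A → X
  | K, [] => K [] []
  | K, a :: l => K [] (a :: l) + splitSum (fun x y => K (a :: x) y) l

section SplitSum

variable {A X Y : Type} [AddCommMonoid X] [AddCommMonoid Y]

theorem splitSum_cons (K : List A → List A → X) (a : A) (l : List A) :
    splitSum K (a :: l) = K [] (a :: l) + splitSum (fun x y => K (a :: x) y) l := rfl

theorem splitSum_congr {K K' : List A → List A → X} {l : List A}
    (h : ∀ x y, x ++ y = l → K x y = K' x y) : splitSum K l = splitSum K' l := by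
  induction l generalizing K K' with
  | nil => exact h [] [] rfl
  | cons a l ih =>
    rw [splitSum_cons, splitSum_cons, h [] (a :: l) rfl, ih fun x y hxy => h _ _ (by simp [hxy])]

theorem splitSum_add (K K' : List A → List A → X) (l : List A) :
    splitSum (fun x y => K x y + K' x y) l = splitSum K l + splitSum K' l := by
  induction l generalizing K K' with
  | nil => rfl
  | cons a l ih => simp only [splitSum_cons, ih]; rw [add_add_add_comm]

theorem splitSum_eq_zero {K : List A → List A → X} {l : List A}
    (h : ∀ x y, x ++ y = l → K x y = 0) : splitSum K l = 0 := by
  induction l generalizing K with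
  | nil => exact h [] [] rfl
  | cons a l ih =>
    rw [splitSum_cons, h [] (a :: l) rfl, ih fun x y hxy => h _ _ (by simp [hxy]), add_zero]

theorem map_splitSum {F : Type} [FunLike F X Y] [AddMonoidHomClass F X Y] (f : F)
    (K : List A → List A → X) (l : List A) :
    f (splitSum K l) = splitSum (fun x y => f (K x y)) l := by
  induction l generalizing K with
  | nil => rfl
  | cons a l ih => rw [splitSum_cons, map_add, ih, splitSum_cons]

theorem splitSum_map {A' : Type} (f : A' → A) (K : List A → List A → X) (l : List A') :
    splitSum K (l.map f) = splitSum (fun x y => K (x.map f) (y.map f)) l := by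
  induction l generalizing K with
  | nil => rfl
  | cons a l ih => rw [List.map_cons, splitSum_cons, ih, splitSum_cons]; rfl

/-- Coassociativity of deconcatenation: both sides run over all decompositions into three pieces. -/
theorem splitSum_splitSum_left (K : List A → List A → List A → X) (l : List A) :
    splitSum (fun w z => splitSum (fun x y => K x y z) w) l =
      splitSum (fun x w => splitSum (fun y z => K x y z) w) l := by
  induction l generalizing K with
  | nil => rfl
  | cons a l ih =>
    simp only [splitSum_cons]
    rw [splitSum_add, ih (fun x y z => K (a :: x) y z)]
    rw [add_assoc]
    rfl

theorem splitSum_append_cons (K : List A → List A → X) (x : List A) (b : A) (z : List A) :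
    splitSum K (x ++ b :: z) = splitSum (fun x' x'' => K x' (x'' ++ b :: z)) x +
      splitSum (fun z' z'' => K (x ++ b :: z') z'') z := by
  induction x generalizing K with
  | nil => rfl
  | cons a x ih => rw [List.cons_append, splitSum_cons, ih, splitSum_cons, add_assoc]; rfl

theorem splitSum_eq_sum_range (K : List A → List A → X) (l : List A) :
    splitSum K l = ∑ i ∈ Finset.range (l.length + 1), K (l.take i) (l.drop i) := by
  induction l generalizing K with
  | nil => simp [splitSum]
  | cons a l ih =>
    rw [splitSum_cons, ih, List.length_cons, Finset.sum_range_succ' _ (l.length + 1), add_comm]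
    rfl

theorem splitSum_sum {ι : Type} (s : Finset ι) (K : ι → List A → List A → X) (l : List A) :
    splitSum (fun x y => ∑ i ∈ s, K i x y) l = ∑ i ∈ s, splitSum (K i) l := by
  simp only [splitSum_eq_sum_range]
  rw [Finset.sum_comm]

end SplitSum

section Conv

variable {A X : Type} [AddCommGroup X] [Module ℂ X]

/-- The convolution `l ↦ ∑ m(F x, G y)` over all decompositions `l = x ++ y`. -/
def conv (m : X →ₗ[ℂ] X →ₗ[ℂ] X) (F G : List A → X) (l : List A) : X :=
  splitSum (fun x y => m (F x) (G y)) l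

variable (m : X →ₗ[ℂ] X →ₗ[ℂ] X)

theorem conv_cons (F G : List A → X) (a : A) (l : List A) :
    conv m F G (a :: l) = m (F []) (G (a :: l)) + conv m (fun x => F (a :: x)) G l := rfl

theorem conv_add_left (F F' G : List A → X) (l : List A) :
    conv m (fun x => F x + F' x) G l = conv m F G l + conv m F' G l := by
  simp only [conv, map_add, LinearMap.add_apply, splitSum_add]

theorem conv_add_right (F G G' : List A → X) (l : List A) :
    conv m F (fun x => G x + G' x) l = conv m F G l + conv m F G' l := by
  simp only [conv, map_add, splitSum_add]

theorem conv_neg_left (F G : List A → X) (l : List A) :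
    conv m (fun x => -F x) G l = -conv m F G l := by
  simp only [conv, map_neg, LinearMap.neg_apply]
  exact (map_splitSum (-LinearMap.id : X →ₗ[ℂ] X) _ _).symm

theorem conv_neg_right (F G : List A → X) (l : List A) :
    conv m F (fun x => -G x) l = -conv m F G l := by
  simp only [conv, map_neg]
  exact (map_splitSum (-LinearMap.id : X →ₗ[ℂ] X) _ _).symm

end Conv

section InsertSum

variable {A X Y : Type} [AddCommGroup A] [Module ℂ A] [AddCommGroup X] [Module ℂ X]
  [AddCommGroup Y] [Module ℂ Y] (s : A →ₗ[ℂ] A) (μ : List A → A)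

theorem insertSum_nil (F : List A → X) : insertSum s μ F [] = 0 := by simp [insertSum]

theorem insertSum_cons (F : List A → X) (a : A) (l : List A) :
    insertSum s μ F (a :: l) =
      splitSum (fun y z => F (μ (a :: y) :: z.map fun b => -s b)) l +
        insertSum s μ (fun x => F (a :: x)) l := by
  rw [insertSum, List.length_cons, Finset.sum_range_succ', add_comm, splitSum_eq_sum_range]
  congr 1
  · simp
  · rw [insertSum]
    refine Finset.sum_congr rfl fun i _ => ?_
    rw [Nat.add_sub_add_right]
    refine Finset.sum_congr rfl fun j _ => ?_
    have : i + 1 + j + 1 = (i + j + 1) + 1 := by ring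
    rw [this]
    simp

theorem insertSum_add (F G : List A → X) (l : List A) :
    insertSum s μ (fun x => F x + G x) l = insertSum s μ F l + insertSum s μ G l := by
  simp only [insertSum, Finset.sum_add_distrib]

theorem map_insertSum (f : X →ₗ[ℂ] Y) (F : List A → X) (l : List A) :
    f (insertSum s μ F l) = insertSum s μ (fun x => f (F x)) l := by
  simp only [insertSum, map_sum]

variable (m : X →ₗ[ℂ] X →ₗ[ℂ] X)

/-- Insertion is a coderivation for the deconcatenation coproduct. -/
theorem insertSum_conv (F G : List A → X) (l : List A) :
    insertSum s μ (conv m F G) l =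
      conv m (insertSum s μ F) (fun y => G (y.map fun b => -s b)) l +
        conv m F (insertSum s μ G) l := by
  induction l generalizing F with
  | nil => simp [insertSum_nil, conv, splitSum]
  | cons a l ih =>
    rw [insertSum_cons]
    simp only [conv_cons]
    rw [splitSum_add, insertSum_add, ih, ← map_insertSum s μ (m (F [])), ← map_splitSum (m (F [])),
      insertSum_nil, map_zero, LinearMap.zero_apply, zero_add]
    -- An insertion that swallows the first entry, combined with a cut after it, divides the tail
    -- into three pieces; coassociativity exchanges the order of the two divisions.
    have h1 : conv m (fun x => insertSum s μ F (a :: x)) (fun y => G (y.map fun b => -s b)) l =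
        splitSum (fun y w => conv m (fun x => F (μ (a :: y) :: x)) G (w.map fun b => -s b)) l +
        conv m (insertSum s μ fun x => F (a :: x)) (fun y => G (y.map fun b => -s b)) l := by
      simp only [insertSum_cons, conv_add_left]
      congr 1
      simp only [conv, splitSum_map]
      rw [← splitSum_splitSum_left (fun y z' z'' => m (F (μ (a :: y) :: z'.map fun b => -s b))
        (G (z''.map fun b => -s b)))]
      refine splitSum_congr fun x y _ => ?_
      exact map_splitSum (m.flip (G (y.map fun b => -s b))) _ _
    rw [h1, insertSum_cons, map_add]
    abel

end InsertSum

/-- A sum over all ways of cutting a list into consecutive blocks, for a function of the blocks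
which vanishes on more than two of them. -/
theorem sum_composition_eq {A X : Type} [AddCommGroup X] (F : List A → X) (G : List X → X)
    (hG : ∀ l : List X, 3 ≤ l.length → G l = 0) (h1 : ∀ y, G [F [], y] = 0)
    (h2 : ∀ y, G [y, F []] = 0) (l : List A) (hl : l ≠ []) :
    ∑ c : Composition l.length, G ((l.splitWrtComposition c).map F) =
      G [F l] + splitSum (fun x y => G [F x, F y]) l := by
  have hn : 0 < l.length := List.length_pos_iff.2 hl
  -- The compositions with at most two blocks are indexed by the length of the first of two blocks,
  -- with 0 standing for the single block.
  let φ : ℕ → Composition l.length := fun i =>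
    if h : 0 < i ∧ i < l.length then ⟨[i, l.length - i], by simp; omega, by simp; omega⟩
    else ⟨[l.length], by simp; omega, by simp⟩
  have hφ0 : (φ 0).blocks = [l.length] := by simp [φ]
  have hφ (i : ℕ) (h : 0 < i ∧ i < l.length) : (φ i).blocks = [i, l.length - i] := by
    simp [φ, dif_pos h]
  have hsub : ∑ c : Composition l.length, G ((l.splitWrtComposition c).map F) =
      ∑ c ∈ (Finset.range l.length).image φ, G ((l.splitWrtComposition c).map F) := by
    symm
    refine Finset.sum_subset (Finset.subset_univ _) fun c _ hc => ?_
    refine hG _ ?_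
    rw [List.length_map, List.length_splitWrtComposition]
    by_contra hlt
    refine hc (Finset.mem_image.2 ?_)
    have hs := c.blocks_sum
    have hlen : c.blocks.length < 3 := by
      have := c.blocks_length; omega
    match hb : c.blocks, hlen with
    | [], _ => rw [hb] at hs; simp at hs; omega
    | [b], _ =>
      rw [hb] at hs
      refine ⟨0, by simpa using hn, Composition.ext ?_⟩
      rw [hφ0, hb]
      simpa using hs.symm
    | [b, b'], _ =>
      have hb1 : 0 < b := c.blocks_pos (by rw [hb]; simp)
      have hb2 : 0 < b' := c.blocks_pos (by rw [hb]; simp)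
      rw [hb] at hs
      simp at hs
      refine ⟨b, by simp; omega, Composition.ext ?_⟩
      rw [hφ b (by omega), hb]
      have : l.length - b = b' := by omega
      rw [this]
    | _ :: _ :: _ :: _, h => simp at h; omega
  have hinj : Set.InjOn φ (Finset.range l.length) := by
    intro i hi j hj hij
    have := congrArg Composition.blocks hij
    simp only [Finset.coe_range, Set.mem_Iio] at hi hj
    rcases Nat.eq_zero_or_pos i with rfl | hi0 <;> rcases Nat.eq_zero_or_pos j with rfl | hj0
    · rfl
    · rw [hφ0, hφ j ⟨hj0, hj⟩] at this; simp at this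
    · rw [hφ0, hφ i ⟨hi0, hi⟩] at this; simp at this
    · rw [hφ i ⟨hi0, hi⟩, hφ j ⟨hj0, hj⟩] at this; simp at this; exact this.1
  have hg0 : G ((l.splitWrtComposition (φ 0)).map F) = G [F l] := by
    rw [List.splitWrtComposition, hφ0]
    simp [List.splitWrtCompositionAux]
  have hg (i : ℕ) (h : 0 < i ∧ i < l.length) :
      G ((l.splitWrtComposition (φ i)).map F) = G [F (l.take i), F (l.drop i)] := by
    rw [List.splitWrtComposition, hφ i h]
    have e : (l.drop i).take (l.length - i) = l.drop i := List.take_of_length_le (by simp)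
    simp [List.splitWrtCompositionAux, e]
  -- The cuts at the two ends, present in `splitSum` but not among the compositions, vanish by `h1`
  -- and `h2`.
  rw [hsub, Finset.sum_image hinj, splitSum_eq_sum_range, Finset.sum_range_succ, List.drop_length,
    h2, add_zero, ← Finset.add_sum_erase _ _ (Finset.mem_range.2 hn), hg0,
    ← Finset.add_sum_erase _ (fun i => G [F (l.take i), F (l.drop i)]) (Finset.mem_range.2 hn),
    List.take_zero, h1, zero_add]
  congr 1
  refine Finset.sum_congr rfl fun i hi => ?_
  rw [Finset.mem_erase, Finset.mem_range] at hi
  exact hg i (by omega)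

/-! ### Homological perturbation -/

section Single

variable {A X : Type} [AddCommGroup A] [Module ℂ A] [AddCommGroup X] [Module ℂ X]

/-- A linear map, as a function of lists with one entry. -/
def single (f : A →ₗ[ℂ] X) : List A → X
  | [a] => f a
  | _ => 0

/-- Only the insertion that consumes the whole list leaves exactly one entry. -/
theorem insertSum_single (s : A →ₗ[ℂ] A) (f : A →ₗ[ℂ] X) (μ : List A → A) (hμ : μ [] = 0)
    (l : List A) : insertSum s μ (single f) l = f (μ l) := by
  cases l with
  | nil => rw [insertSum_nil, hμ, map_zero]
  | cons a l =>
    have h2 : ∀ (a : A) (l : List A), insertSum s μ (fun x => single f (a :: x)) l = 0 := by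
      intro a l
      refine Finset.sum_eq_zero fun i _ => Finset.sum_eq_zero fun j _ => ?_
      cases l.take i <;> rfl
    rw [insertSum_cons, h2, add_zero]
    have h1 : ∀ (g : List A → A) (l : List A),
        splitSum (fun y z => single f (g y :: z.map fun b => -s b)) l = f (g l) := by
      intro g l
      induction l generalizing g with
      | nil => rfl
      | cons b l ih =>
        rw [splitSum_cons, ih (fun y => g (b :: y))]
        exact zero_add _
    exact h1 (fun y => μ (a :: y)) l

end Single

/-- A dg algebra `(X, d + β)` with product `m` (with the signs of an `A_∞`-algebra), together with a
homotopy retract of `(X, d)` onto a graded space `A` with zero differential, such that the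
perturbation `β` is locally nilpotent relative to the homotopy `H`. -/
structure Retract (A X : Type) [AddCommGroup A] [Module ℂ A] [AddCommGroup X] [Module ℂ X] where
  sA : A →ₗ[ℂ] A
  s : X →ₗ[ℂ] X
  d : X →ₗ[ℂ] X
  β : X →ₗ[ℂ] X
  H : X →ₗ[ℂ] X
  i : A →ₗ[ℂ] X
  p : X →ₗ[ℂ] A
  m : X →ₗ[ℂ] X →ₗ[ℂ] X
  d_i : ∀ a, d (i a) = 0
  p_d : ∀ x, p (d x) = 0
  p_β : ∀ x, p (β x) = 0
  p_H : ∀ x, p (H x) = 0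
  p_i : ∀ a, p (i a) = a
  homotopy : ∀ x, d (H x) + H (d x) = i (p x) - x
  d_d : ∀ x, d (d x) = 0
  d_β : ∀ x, d (β x) + β (d x) + β (β x) = 0
  d_m : ∀ x y, d (m x y) + m x (d y) + m (d x) (-s y) = 0
  β_m : ∀ x y, β (m x y) + m x (β y) + m (β x) (-s y) = 0
  m_m : ∀ x y z, m (m x y) (-s z) + m x (m y z) = 0
  nilp : IsNilpotent (H * β : Module.End ℂ X)
  nilp_comm : IsNilpotent (H * β + β * H : Module.End ℂ X)

namespace Retract

variable {A X : Type} [AddCommGroup A] [Module ℂ A] [AddCommGroup X] [Module ℂ X]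
  (T : Retract A X)

/-- The inclusion as a function of lists. -/
abbrev lin : List A → X := single T.i

/-- The sum over trees, before the homotopy or the projection is applied. -/
def root (F : List A → X) (l : List A) : X := T.β (F l) + conv T.m F F l

/-- `F` solves the recursive equation for the sum over trees. -/
structure IsSolution (F : List A → X) : Prop where
  nil : F [] = 0
  eq : ∀ l, F l = T.lin l + T.H (T.root F l)
  parity : ∀ l, F (l.map fun a => -T.sA a) = -T.s (F l)

/-- The transferred structure. -/
def transfer (F : List A → X) (l : List A) : A := T.p (T.root F l)

variable {T} {F : List A → X}

theorem IsSolution.root_nil (hF : T.IsSolution F) : T.root F [] = 0 := by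
  simp [root, conv, splitSum, hF.nil]

theorem conv_conv (l : List A) :
    conv T.m F (conv T.m F F) l + conv T.m (conv T.m F F) (fun x => -T.s (F x)) l = 0 := by
  have h1 : conv T.m (conv T.m F F) (fun x => -T.s (F x)) l =
      splitSum (fun x w => splitSum (fun y z => T.m (T.m (F x) (F y)) (-T.s (F z))) w) l := by
    rw [← splitSum_splitSum_left]
    refine splitSum_congr fun x y _ => ?_
    exact map_splitSum (T.m.flip (-T.s (F y))) _ _
  have h2 : conv T.m F (conv T.m F F) l =
      splitSum (fun x w => splitSum (fun y z => T.m (F x) (T.m (F y) (F z))) w) l :=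
    splitSum_congr fun x y _ => map_splitSum (T.m (F x)) _ _
  rw [h1, h2, ← splitSum_add]
  refine splitSum_eq_zero fun x w _ => ?_
  rw [← splitSum_add]
  refine splitSum_eq_zero fun y z _ => ?_
  rw [add_comm, T.m_m]

theorem conv_derivation {D : X →ₗ[ℂ] X}
    (hD : ∀ x y, D (T.m x y) + T.m x (D y) + T.m (D x) (-T.s y) = 0)
    (l : List A) :
    D (conv T.m F F l) + conv T.m F (fun x => D (F x)) l +
      conv T.m (fun x => D (F x)) (fun x => -T.s (F x)) l = 0 := by
  rw [conv, map_splitSum, conv, conv, ← splitSum_add, ← splitSum_add]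
  exact splitSum_eq_zero fun x y _ => hD _ _

/-- The failure of the equation for an `A_∞`-homomorphism. -/
def defect (T : Retract A X) (F : List A → X) (l : List A) : X :=
  T.d (F l) + T.root F l - insertSum T.sA (T.transfer F) F l

/-- The Leibniz rules for d and β, associativity of m, and the identity dβ + βd + β² = 0 cancel
everything that does not contain the defect. -/
theorem IsSolution.d_root (hF : T.IsSolution F) (l : List A) :
    T.d (T.root F l) + insertSum T.sA (T.transfer F) (T.root F) l =
      -(T.β (T.defect F l) + conv T.m F (T.defect F) l +
        conv T.m (T.defect F) (fun x => -T.s (F x)) l) := by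
  set N := insertSum T.sA (T.transfer F) F with hN
  have e1 : insertSum T.sA (T.transfer F) (T.root F) l = T.β (N l) +
      (conv T.m N (fun x => -T.s (F x)) l + conv T.m F N l) := by
    have := insertSum_add T.sA (T.transfer F) (fun l => T.β (F l)) (conv T.m F F) l
    rw [insertSum_conv, ← map_insertSum] at this
    simp only [hF.parity] at this
    exact this
  have e2 := conv_derivation (F := F) T.d_m l
  have e3 := conv_derivation (F := F) T.β_m l
  have e4 := T.d_β (F l)
  have e5 := conv_conv (T := T) (F := F) l
  have hdef : T.defect F = fun x => (T.d (F x) + (T.β (F x) + conv T.m F F x)) + -N x := by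
    funext x
    rw [defect, root, sub_eq_add_neg]
  rw [e1, hdef]
  simp only [conv_add_left, conv_add_right, conv_neg_left, conv_neg_right, map_add, map_neg, root]
    at *
  have e6 : T.d (T.β (F l)) = -T.β (T.d (F l)) - T.β (T.β (F l)) := by
    rw [← sub_eq_zero, ← e4]; abel
  have e7 : T.d (conv T.m F F l) = - conv T.m F (fun x => T.d (F x)) l +
      conv T.m (fun x => T.d (F x)) (fun x => T.s (F x)) l := by
    rw [← sub_eq_zero, ← e2]; abel
  have e8 : T.β (conv T.m F F l) = - conv T.m F (fun x => T.β (F x)) l +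
      conv T.m (fun x => T.β (F x)) (fun x => T.s (F x)) l := by
    rw [← sub_eq_zero, ← e3]; abel
  have e9 : conv T.m F (conv T.m F F) l = conv T.m (conv T.m F F) (fun x => T.s (F x)) l := by
    rw [← sub_eq_zero, ← e5]; abel
  rw [e6, e7, e8, e9]
  abel

/-- Substituting F = i + H(root F) and using di = 0 and dH + Hd = ip - 1, the terms with ip cancel,
and -H of the left side of `d_root` remains. -/
theorem IsSolution.defect_eq (hF : T.IsSolution F) (l : List A) :
    T.defect F l = T.H (T.β (T.defect F l) + conv T.m F (T.defect F) l +
        conv T.m (T.defect F) (fun x => -T.s (F x)) l) := by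
  have h1 : T.d (T.lin l) = 0 := by
    match l with
    | [] => exact map_zero _
    | [a] => exact T.d_i a
    | _ :: _ :: _ => exact map_zero _
  have h2 : insertSum T.sA (T.transfer F) F l = T.i (T.transfer F l) +
      T.H (insertSum T.sA (T.transfer F) (T.root F) l) := by
    rw [map_insertSum, ← insertSum_single _ _ _ (by rw [transfer, hF.root_nil, map_zero]),
      ← insertSum_add]
    simp only [← hF.eq]
  have h3 := T.homotopy (T.root F l)
  have h4 : T.d (F l) = T.d (T.H (T.root F l)) := by
    conv_lhs => rw [hF.eq l, map_add, h1, zero_add]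
  have h5 := congrArg T.H (hF.d_root l)
  rw [map_neg] at h5
  rw [← neg_eq_iff_eq_neg.2 h5, map_add]
  conv_lhs => rw [defect, h2, h4]
  have h6 : T.d (T.H (T.root F l)) =
      T.i (T.p (T.root F l)) - T.root F l - T.H (T.d (T.root F l)) := by
    rw [← h3]; abel
  rw [h6, transfer]
  abel

/-- Since F vanishes on the empty list, the convolution terms in `defect_eq` see the defect only on
shorter lists, where it is zero by induction. What is left says that the defect is fixed by the
nilpotent operator Hβ. -/
theorem IsSolution.defect_eq_zero (hF : T.IsSolution F) (l : List A) : T.defect F l = 0 := by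
  induction hn : l.length using Nat.strong_induction_on generalizing l with
  | _ n ih =>
    subst hn
    have h0 : T.defect F [] = 0 := by
      rw [defect, hF.nil, hF.root_nil, insertSum_nil, map_zero, add_zero, sub_zero]
    have h1 : conv T.m F (T.defect F) l = 0 := by
      refine splitSum_eq_zero fun x y hxy => ?_
      cases x with
      | nil => rw [hF.nil, map_zero, LinearMap.zero_apply]
      | cons a x => rw [ih y.length (by rw [← hxy]; simp) y rfl, map_zero]
    have h2 : conv T.m (T.defect F) (fun x => -T.s (F x)) l = 0 := by
      refine splitSum_eq_zero fun x y hxy => ?_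
      cases y with
      | nil =>
        change T.m _ (-T.s (F [])) = 0
        rw [hF.nil, map_zero, neg_zero, map_zero]
      | cons a y => rw [ih x.length (by rw [← hxy]; simp) x rfl, map_zero, LinearMap.zero_apply]
    have h3 : (T.H * T.β : Module.End ℂ X) (T.defect F l) = T.defect F l := by
      have := hF.defect_eq l
      rw [h1, h2, add_zero, add_zero] at this
      exact this.symm
    obtain ⟨k, hk⟩ := T.nilp
    have h4 : ∀ k : ℕ, ((T.H * T.β : Module.End ℂ X) ^ k) (T.defect F l) = T.defect F l := by
      intro k
      induction k with
      | zero => rfl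
      | succ k ih => rw [pow_succ, Module.End.mul_apply, h3, ih]
    rw [← h4 k, hk, LinearMap.zero_apply]

/-- The sum over trees is an `A_∞`-homomorphism. -/
theorem IsSolution.hom (hF : T.IsSolution F) (l : List A) :
    T.d (F l) + T.β (F l) + conv T.m F F l = insertSum T.sA (T.transfer F) F l := by
  have := hF.defect_eq_zero l
  rw [defect, sub_eq_zero, root, ← add_assoc] at this
  exact this

/-- The transferred structure satisfies the `A_∞`-equations. -/
theorem IsSolution.assoc (hF : T.IsSolution F) (l : List A) :
    insertSum T.sA (T.transfer F) (T.transfer F) l = 0 := by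
  have h := congrArg T.p (hF.d_root l)
  have h0 : T.defect F = fun _ => 0 := funext hF.defect_eq_zero
  have h1 : conv T.m F (fun _ => 0) l = 0 := splitSum_eq_zero fun x y _ => by simp
  have h2 : conv T.m (fun _ => 0) (fun x => -T.s (F x)) l = 0 :=
    splitSum_eq_zero fun x y _ => by simp
  rw [h0, h1, h2, map_zero, add_zero, add_zero, neg_zero, map_zero, map_add, T.p_d, zero_add,
    map_insertSum] at h
  exact h

theorem IsSolution.p_apply (hF : T.IsSolution F) (a : A) : T.p (F [a]) = a := by
  rw [hF.eq, map_add, T.p_H, add_zero]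
  exact T.p_i a

/-- On such cocycles Q = Hβ + βH satisfies Qx = x + (d + β)Hx. Thus x and Qx are cohomologous, and
Qx is again such a cocycle; nilpotence of Q makes x exact. -/
theorem exists_of_cocycle (x : X) (hx : T.d x + T.β x = 0) (hp : T.p x = 0) :
    ∃ y, x = T.d y + T.β y := by
  set Q : Module.End ℂ X := T.H * T.β + T.β * T.H with hQ
  have key : ∀ k : ℕ, ∀ x, T.d x + T.β x = 0 → T.p x = 0 → (Q ^ k) x = 0 →
      ∃ y, x = T.d y + T.β y := by
    intro k
    induction k with
    | zero =>
      intro x _ _ h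
      exact ⟨0, by simpa using h⟩
    | succ k ih =>
      intro x hx hp h
      have e : Q x = x + (T.d (T.H x) + T.β (T.H x)) := by
        have h1 := T.homotopy x
        rw [hp, map_zero, zero_sub] at h1
        have h2 : T.d x = -T.β x := eq_neg_of_add_eq_zero_left hx
        rw [h2, map_neg] at h1
        have h3 : T.d (T.H x) = T.H (T.β x) - x := by
          rw [sub_eq_add_neg, ← h1]; abel
        rw [h3]
        change T.H (T.β x) + T.β (T.H x) = _
        abel
      have hD : ∀ y, T.d (T.d y + T.β y) + T.β (T.d y + T.β y) = T.d (T.d y) := by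
        intro y
        have := T.d_β y
        rw [map_add, map_add]
        calc _ = T.d (T.d y) + (T.d (T.β y) + T.β (T.d y) + T.β (T.β y)) := by abel
          _ = _ := by rw [this, add_zero]
      obtain ⟨y, hy⟩ := ih (Q x) (by
        rw [e, T.d.map_add x, T.β.map_add x, add_add_add_comm, hx, zero_add, hD, T.d_d]) (by
        rw [e, map_add, map_add, hp, T.p_d, T.p_β, add_zero, add_zero]) (by
        rw [← Module.End.mul_apply, ← pow_succ, h])
      refine ⟨y - T.H x, ?_⟩
      rw [map_sub, map_sub, sub_add_sub_comm, ← hy, e, add_sub_cancel_right]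
  obtain ⟨k, hk⟩ := T.nilp_comm
  exact key k x hx hp (by rw [← hQ] at hk; rw [hk]; rfl)

end Retract

/-! ### Signs in `B`

The general lemmas of the same names, with the instances with which signs in `B` are elaborated. -/

theorem b_sub_mul (x y z : B) : (x - y) * z = x * z - y * z := sub_mul x y z

theorem b_mul_sub (x y z : B) : x * (y - z) = x * y - x * z := mul_sub x y z

theorem b_neg_mul (x y : B) : -x * y = -(x * y) := rfl

theorem b_mul_neg (x y : B) : x * -y = -(x * y) :=
  LinearMap.ext fun ω => map_neg x (y ω)

theorem b_smul_sub (c : ℂ) (x y : B) : c • (x - y) = c • x - c • y := smul_sub c x y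

theorem b_sum_neg (f : Fin 3 → B) : ∑ k, -f k = -∑ k, f k := Finset.sum_neg_distrib f

theorem parB_sub (x y : B) : parB (x - y) = parB x - parB y := map_sub parB x y

theorem parB_neg (x : B) : parB (-x) = -parB x := map_neg parB x

/-! ### The endomorphism dg algebra -/

/-- The one-form `∑ g_k dv_k`. -/
def oneForm (g : Fin 3 → CV) : Om := ∑ k, g k ⊗ₜ dvι k

theorem wedgeForm_eq (g : Fin 3 → CV) : wedgeForm g = wedgeLeft (oneForm g) := by
  refine b_ext fun J => ?_
  rw [wedgeForm, LinearMap.sum_apply, wedgeLeft_apply, oneForm, Finset.sum_mul]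
  refine Finset.sum_congr rfl fun k _ => ?_
  rw [Algebra.TensorProduct.tmul_mul_tmul, mul_one, LinearMap.smul_apply]
  simp [smul_tmul']

theorem parOm_oneForm (g : Fin 3 → CV) : parOm (oneForm g) = -oneForm g := by
  rw [oneForm, map_sum, ← Finset.sum_neg_distrib]
  refine Finset.sum_congr rfl fun k _ => ?_
  rw [parOm_tmul, scaleLVd_dvι, neg_one_smul, tmul_neg]

theorem oneForm_mul_oneForm (g : Fin 3 → CV) : oneForm g * oneForm g = 0 := by
  rw [oneForm, Finset.sum_mul_sum]
  simp only [Algebra.TensorProduct.tmul_mul_tmul, Fin.sum_univ_three]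
  rw [dvι_sq, dvι_sq, dvι_sq, dvι_swap 1 0, dvι_swap 2 0, dvι_swap 2 1, mul_comm (g 1) (g 0),
    mul_comm (g 2) (g 0), mul_comm (g 2) (g 1)]
  simp only [tmul_zero, tmul_neg]
  abel

theorem iotaEta_oneForm (g : Fin 3 → CV) :
    iotaEta (oneForm g) = (∑ k, MvPolynomial.X k * g k) • (1 : Om) := by
  rw [oneForm, map_sum, Finset.sum_smul]
  refine Finset.sum_congr rfl fun k _ => ?_
  rw [iotaEta_tmul, Finset.sum_eq_single_of_mem k (Finset.mem_univ _)]
  · rw [contr_ι, dv_xi, if_pos rfl, map_one, Algebra.TensorProduct.one_def, smul_tmul',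
      smul_eq_mul, mul_one]
  · intro j _ hj
    rw [contr_ι, dv_xi, if_neg hj.symm, map_zero, tmul_zero]

theorem iotaEta_eq : iotaEta = ∑ k, (MvPolynomial.X k : CV) • contrB (xiι k) := by
  simp only [iotaEta, contrB, contrAlg_ι]

theorem parB_cv_smul (f : CV) (b : B) : parB (f • b) = f • parB b := by
  rw [parB_apply, parB_apply, mul_smul_comm, smul_mul_assoc]

theorem parB_iotaEta : parB iotaEta = -iotaEta := by
  rw [iotaEta_eq, map_sum, ← b_sum_neg]
  refine Finset.sum_congr rfl fun k _ => ?_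
  rw [parB_cv_smul, parB_contrB, parLV_ι]
  refine b_ext fun J => ?_
  rw [LinearMap.smul_apply, LinearMap.neg_apply, LinearMap.smul_apply, contrB_tmul, map_neg,
    LinearMap.neg_apply, tmul_neg, contrB_tmul, smul_neg]

theorem parB_wedgeForm (g : Fin 3 → CV) : parB (wedgeForm g) = -wedgeForm g := by
  rw [wedgeForm_eq, parB_wedgeLeft, parOm_oneForm]
  exact LinearMap.ext fun ω => neg_mul (oneForm g) ω

theorem parB_delta (g : Fin 3 → CV) : parB (delta g) = -delta g := by
  rw [delta, parB_sub, parB_iotaEta, parB_wedgeForm]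
  abel

theorem iotaEta_mul_iotaEta : iotaEta * iotaEta = 0 := by
  refine b_ext fun J => ?_
  have hc (j k : Fin 3) : contr (xi j) (contr (xi k) (dvJ J)) =
      -contr (xi k) (contr (xi j) (dvJ J)) := CliffordAlgebra.contractLeft_comm _ _ _
  have h0 (k : Fin 3) : contr (xi k) (contr (xi k) (dvJ J)) = 0 :=
    CliffordAlgebra.contractLeft_contractLeft _ _
  rw [Module.End.mul_apply, iotaEta_tmul, map_sum]
  simp only [iotaEta_tmul, Fin.sum_univ_three, mul_one, LinearMap.zero_apply]
  rw [h0, h0, h0, hc 1 0, hc 2 0, hc 2 1, mul_comm (MvPolynomial.X 1) (MvPolynomial.X 0),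
    mul_comm (MvPolynomial.X 2) (MvPolynomial.X 0), mul_comm (MvPolynomial.X 2) (MvPolynomial.X 1)]
  simp only [tmul_zero, tmul_neg]
  abel

/-- Both ι_η and γ ∧ · square to zero, and their anticommutator is multiplication by ι_η γ. -/
theorem delta_mul_delta (g : Fin 3 → CV) :
    delta g * delta g = (-∑ k, MvPolynomial.X k * g k) • (1 : B) := by
  have h1 : wedgeForm g * wedgeForm g = 0 := by
    rw [wedgeForm_eq]
    refine LinearMap.ext fun ω => ?_
    rw [Module.End.mul_apply, wedgeLeft_apply, wedgeLeft_apply, ← mul_assoc, oneForm_mul_oneForm,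
      zero_mul, LinearMap.zero_apply]
  have h2 : iotaEta * wedgeForm g =
      (∑ k, MvPolynomial.X k * g k) • (1 : B) - wedgeForm g * iotaEta := by
    rw [wedgeForm_eq, iotaEta_mul_wedgeLeft, parOm_oneForm, iotaEta_oneForm]
    have e1 : wedgeLeft ((∑ k, MvPolynomial.X k * g k) • (1 : Om)) =
        (∑ k, MvPolynomial.X k * g k) • (1 : B) := by
      refine LinearMap.ext fun ω => ?_
      rw [wedgeLeft_apply, smul_mul_assoc, one_mul, LinearMap.smul_apply, Module.End.one_apply]
    have e2 : wedgeLeft (-oneForm g) = -wedgeLeft (oneForm g) :=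
      LinearMap.ext fun ω => neg_mul (oneForm g) ω
    rw [e1, e2, b_neg_mul]
    abel
  have h3 : (-∑ k, MvPolynomial.X k * g k) • (1 : B) = -((∑ k, MvPolynomial.X k * g k) • (1 : B)) :=
    LinearMap.ext fun ω => neg_smul (∑ k, MvPolynomial.X k * g k) ω
  rw [delta, b_sub_mul, b_mul_sub, b_mul_sub, h1, h2, iotaEta_mul_iotaEta, h3]
  abel

theorem sum_X_mul_gW : ∑ k, MvPolynomial.X k * gW k = W := by
  have h : (MvPolynomial.C (1 / 3 : ℂ) : CV) * 3 = 1 := by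
    have : (3 : CV) = MvPolynomial.C 3 := rfl
    rw [this, ← map_mul]
    norm_num
  simp only [Fin.sum_univ_three, gW, W, Fin.isValue, zero_add, Fin.reduceAdd]
  linear_combination (-MvPolynomial.X 0 * MvPolynomial.X 1 * MvPolynomial.X 2) * h

/-- The operation `b ↦ (-1)^{|b|} (δ b - (-1)^{|b|} b δ)`. -/
def muDiff (δ : B) : B →ₗ[ℂ] B where
  toFun b := inducedDiff δ (parB b)
  map_add' b c := by
    simp only [inducedDiff, map_add, mul_add, add_mul]; abel
  map_smul' c b := by
    simp only [inducedDiff, map_smul, mul_smul_comm, smul_mul_assoc, RingHom.id_apply]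
    exact (b_smul_sub _ _ _).symm

theorem muDiff_apply (δ b : B) : muDiff δ b = δ * parB b - b * δ := by
  change inducedDiff δ (parB b) = _
  rw [inducedDiff, parB_parB]

/-- The product `(b_2, b_1) ↦ (-1)^{|b_1|} b_2 b_1`. -/
def muProd : B →ₗ[ℂ] B →ₗ[ℂ] B := (LinearMap.mul ℂ B).compl₂ parB

theorem muProd_apply (x y : B) : muProd x y = x * parB y := rfl

theorem parB_muDiff {δ : B} (h : parB δ = -δ) (b : B) :
    parB (muDiff δ b) = -(δ * b) + parB b * δ := by
  rw [muDiff_apply, parB_sub, parB_mul, parB_mul, h, parB_parB, b_neg_mul, b_mul_neg]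
  abel

/-- The square of the differential is, up to sign, the commutator with δ², which is multiplication
by a function and hence central. The lemma covers both ι_η, with f = 0, and the full δ. -/
theorem muDiff_muDiff {δ : B} (h : parB δ = -δ) {f : CV} (hf : δ * δ = f • (1 : B)) (b : B) :
    muDiff δ (muDiff δ b) = 0 := by
  rw [muDiff_apply δ (muDiff δ b), parB_muDiff h, muDiff_apply]
  have h1 : δ * (δ * b) = f • b := by rw [← mul_assoc, hf, smul_mul_assoc, one_mul]
  have h2 : b * δ * δ = f • b := by rw [mul_assoc, hf, mul_smul_comm, mul_one]
  rw [mul_add, b_mul_neg, h1, b_sub_mul, h2, mul_assoc]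
  abel

theorem muDiff_muProd {δ : B} (h : parB δ = -δ) (x y : B) :
    muDiff δ (muProd x y) + muProd x (muDiff δ y) + muProd (muDiff δ x) (-parB y) = 0 := by
  rw [muProd_apply, muProd_apply, muProd_apply, parB_muDiff h, muDiff_apply, muDiff_apply,
    parB_neg, parB_mul, parB_parB, mul_add, b_mul_neg, b_mul_neg, b_sub_mul]
  simp only [mul_assoc]
  abel

theorem muProd_muProd (x y z : B) :
    muProd (muProd x y) (-parB z) + muProd x (muProd y z) = 0 := by
  rw [muProd_apply, muProd_apply, muProd_apply, muProd_apply, parB_neg, parB_mul, parB_parB,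
    b_mul_neg, mul_assoc]
  abel

/-- The operation at the bivalent vertices. -/
def pert (g : Fin 3 → CV) : B →ₗ[ℂ] B := muDiff (-wedgeForm g)

theorem inducedDiff_sub_inducedDiff (g : Fin 3 → CV) (b : B) :
    inducedDiff (delta g) (parB b) - inducedDiff iotaEta (parB b) = pert g b := by
  change muDiff (delta g) b - muDiff iotaEta b = _
  rw [pert, muDiff_apply, muDiff_apply, muDiff_apply, delta, b_sub_mul, b_mul_sub,
    b_neg_mul, b_mul_neg]
  abel

theorem muDiff_delta (g : Fin 3 → CV) (b : B) :
    muDiff (delta g) b = muDiff iotaEta b + pert g b := by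
  rw [← inducedDiff_sub_inducedDiff]
  change _ = muDiff iotaEta b + (muDiff (delta g) b - muDiff iotaEta b)
  abel

theorem muB_single (g : Fin 3 → CV) (b : B) : muB g [b] = muDiff (delta g) b := rfl

theorem muB_pair (g : Fin 3 → CV) (x y : B) : muB g [x, y] = muProd x y := rfl

theorem muB_of_three_le (g : Fin 3 → CV) {l : List B} (h : 3 ≤ l.length) : muB g l = 0 := by
  match l, h with
  | _ :: _ :: _ :: _, _ => rfl

theorem muB_isMultilin (g : Fin 3 → CV) : IsMultilin (muB g) := by
  intro x z
  by_cases h : 2 ≤ x.length + z.length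
  · have h0 (a : B) : muB g (x ++ a :: z) = 0 := muB_of_three_le g (by simp; omega)
    simp only [h0]
    exact (0 : B →ₗ[ℂ] B).isLinear
  · match x, z, h with
    | [], [], _ => exact (muDiff (delta g)).isLinear
    | [], [y], _ => exact (muProd.flip y).isLinear
    | [y], [], _ => exact (muProd y).isLinear
    | [], _ :: _ :: _, h => simp at h
    | [_], _ :: _, h => simp at h
    | _ :: _ :: _, _, h => simp at h; omega

theorem IsMultilin.map_zero {A X : Type} [AddCommGroup A] [Module ℂ A] [AddCommGroup X] [Module ℂ X]
    {m : List A → X} (hm : IsMultilin m) (x z : List A) : m (x ++ 0 :: z) = 0 := by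
  have := (hm x z).map_smul 0 0
  rwa [zero_smul, zero_smul] at this

theorem isAInf_muB : IsAInf parB (muB gW) where
  parity_sq := parB_parB
  multilin := muB_isMultilin gW
  parity l hl := by
    match l, hl with
    | [b], _ =>
      change muDiff (delta gW) (parB b) = (-1 : ℂ) ^ 1 • parB (muDiff (delta gW) b)
      rw [parB_muDiff (parB_delta gW), muDiff_apply, parB_parB]
      module
    | [x, y], _ =>
      change muProd (parB x) (parB y) = (-1 : ℂ) ^ 2 • parB (muProd x y)
      rw [muProd_apply, muProd_apply, parB_mul]
      module
    | x :: y :: z :: l, _ =>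
      rw [muB_of_three_le gW (by simp), muB_of_three_le gW (by simp), map_zero, smul_zero]
  assoc l hl := by
    match l, hl with
    | [b], _ =>
      simp only [insertSum_cons, insertSum_nil, splitSum, List.map_nil, muB_single]
      rw [muDiff_muDiff (parB_delta gW) (delta_mul_delta gW), add_zero]
    | [x, y], _ =>
      simp only [insertSum_cons, insertSum_nil, splitSum, List.map_nil, List.map_cons, muB_single,
        muB_pair]
      refine Eq.trans ?_ (muDiff_muProd (parB_delta gW) x y)
      abel
    | [x, y, z], _ =>
      simp only [insertSum_cons, insertSum_nil, splitSum, List.map_nil, List.map_cons, muB_single,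
        muB_pair]
      have h3 (x y z : B) : muB gW [x, y, z] = 0 := rfl
      simp only [h3, (muDiff (delta gW)).map_zero]
      refine Eq.trans ?_ (muProd_muProd x y z)
      abel
    | w :: x :: y :: z :: l, _ =>
      refine Finset.sum_eq_zero fun i hi => Finset.sum_eq_zero fun j hj => ?_
      rw [Finset.mem_range] at hi hj
      -- The inner operation takes j + 1 entries. With four or more inputs, either it or the outer
      -- one has at least three entries.
      by_cases h : 2 ≤ j
      · rw [muB_of_three_le gW (l := List.take _ _) (by
          simp only [List.length_take, List.length_drop] at *; omega)]
        exact (muB_isMultilin gW).map_zero _ _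
      · refine muB_of_three_le gW ?_
        simp only [List.length_append, List.length_cons, List.length_take, List.length_map,
          List.length_drop] at *
        omega

/-! ### The contraction onto `Λ(V)` -/

/-- The inclusion `i` as a linear map. -/
def inclL : LV →ₗ[ℂ] B where
  toFun := incl
  map_add' θ θ' := by simp only [← nrm_one, nrm_add_right]
  map_smul' c θ := by simp only [← nrm_one, nrm_smul_right, RingHom.id_apply]

theorem inclL_apply (θ : LV) : inclL θ = incl θ := rfl

/-- The homotopy on the finite edges, `b ↦ (-1)^{|b|} h(b)`. -/
def edgeL : B →ₗ[ℂ] B := homotopyL ∘ₗ parB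

theorem edgeL_apply (b : B) : edgeL b = homotopy (parB b) := rfl

theorem nrm_sub_left (τ τ' : Om) (θ : LV) : nrm (τ - τ') θ = nrm τ θ - nrm τ' θ := by
  have h : nrm (τ - τ') θ + nrm τ' θ = nrm τ θ := by rw [← nrm_add_left, sub_add_cancel]
  rw [← h]
  abel

theorem inducedDiff_homotopy (b : B) :
    inducedDiff iotaEta (homotopy b) + homotopy (inducedDiff iotaEta b) = b - incl (proj b) := by
  have hlin (x : B) : inducedDiff iotaEta x = muDiff iotaEta (parB x) := by
    change _ = inducedDiff iotaEta (parB (parB x))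
    rw [parB_parB]
  simp only [hlin, ← homotopyL_apply, ← projL_apply, ← inclL_apply]
  induction b using b_induction with
  | h m J K =>
    simp only [← hlin, homotopyL_apply, projL_apply, inclL_apply]
    rw [homotopy_nrm, inducedDiff_iotaEta_nrm, inducedDiff_iotaEta_nrm, homotopy_nrm, proj_nrm,
      ← nrm_one, nrm_smul_right, ← nrm_smul_left, ← nrm_add_left, iotaEta_koszulHomotopy]
    rw [nrm_sub_left]
  | hadd x y hx hy =>
    simp only [map_add]
    rw [add_add_add_comm, hx, hy]
    abel
  | hsmul c x hx =>
    simp only [map_smul]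
    rw [← smul_add, hx, b_smul_sub]

/-- The parity signs in `muDiff` and `edgeL` turn ∂h + h∂ = 1 - ip into its negative, the convention
of `Retract`. -/
theorem muDiff_edgeL (b : B) :
    muDiff iotaEta (edgeL b) + edgeL (muDiff iotaEta b) = incl (proj b) - b := by
  have h1 : muDiff iotaEta (edgeL b) = -inducedDiff iotaEta (homotopy b) := by
    change inducedDiff iotaEta (parB (homotopy (parB b))) = _
    rw [parB_homotopy, parB_parB, inducedDiff, inducedDiff, parB_neg, b_mul_neg, b_neg_mul]
    abel
  have h2 : edgeL (muDiff iotaEta b) = -homotopy (inducedDiff iotaEta b) := by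
    have e : parB (muDiff iotaEta b) = -inducedDiff iotaEta b := by
      rw [parB_muDiff parB_iotaEta, inducedDiff]
      abel
    rw [edgeL_apply, e]
    exact map_neg homotopyL _
  have h3 := inducedDiff_homotopy b
  rw [h1, h2]
  calc _ = -(inducedDiff iotaEta (homotopy b) + homotopy (inducedDiff iotaEta b)) := by abel
    _ = _ := by rw [h3]; abel

theorem augOm_smul (f : CV) (ω : Om) :
    augOm (f • ω) = MvPolynomial.aeval (fun _ : Fin 3 => (0 : ℂ)) f * augOm ω := by
  have e : f • ω = (f ⊗ₜ[ℂ] (1 : LVd)) * ω := Algebra.smul_def f ω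
  rw [e, augOm_mul, augOm_tmul, map_one, mul_one]

theorem augOm_iotaEta (τ : Om) : augOm (iotaEta τ) = 0 := by
  rw [iotaEta_eq, LinearMap.sum_apply, map_sum]
  refine Finset.sum_eq_zero fun k _ => ?_
  rw [LinearMap.smul_apply, augOm_smul, MvPolynomial.aeval_X, zero_mul]

theorem proj_muDiff_iotaEta (b : B) : proj (muDiff iotaEta b) = 0 := by
  induction b using b_induction with
  | h m J K =>
    change proj (inducedDiff iotaEta (parB _)) = 0
    rw [parB_nrm, inducedDiff_iotaEta_nrm, proj_nrm, augOm_iotaEta, zero_smul]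
  | hadd x y hx hy => rw [map_add, proj_add, hx, hy, add_zero]
  | hsmul c x hx => rw [map_smul, proj_smul, hx, smul_zero]

theorem muDiff_iotaEta_incl (θ : LV) : muDiff iotaEta (incl θ) = 0 := by
  change inducedDiff iotaEta (parB _) = 0
  rw [parB_incl, ← nrm_one, inducedDiff_iotaEta_nrm, iotaEta_one]
  exact LinearMap.map_zero₂ nrmL _

/-- All g_k vanish at the origin, so composition with γ ∧ · on either side leaves nothing for the
augmentation. -/
theorem proj_pert {g : Fin 3 → CV}
    (hg : ∀ k, MvPolynomial.aeval (fun _ : Fin 3 => (0 : ℂ)) (g k) = 0) (b : B) :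
    proj (pert g b) = 0 := by
  rw [pert, muDiff_apply, proj]
  refine Finset.sum_eq_zero fun K _ => ?_
  have hγ : augOm (oneForm g) = 0 := by
    rw [oneForm, map_sum]
    exact Finset.sum_eq_zero fun k _ => by rw [augOm_tmul, hg, zero_mul]
  have h1 : augOm ((-wedgeForm g * parB b) (1 ⊗ₜ dvJ K)) = 0 := by
    rw [b_neg_mul, LinearMap.neg_apply, Module.End.mul_apply, wedgeForm_eq, wedgeLeft_apply, map_neg,
      augOm_mul, hγ, zero_mul, neg_zero]
  have h2 : augOm ((b * -wedgeForm g) (1 ⊗ₜ dvJ K)) = 0 := by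
    rw [b_mul_neg, LinearMap.neg_apply, Module.End.mul_apply, wedgeForm, LinearMap.sum_apply,
      map_neg, map_sum, map_sum, neg_eq_zero]
    refine Finset.sum_eq_zero fun k _ => ?_
    rw [LinearMap.smul_apply, map_smul, augOm_smul, hg, zero_mul]
  rw [LinearMap.sub_apply, map_sub, h1, h2, sub_zero, zero_smul]

/-! ### Filtrations by weight -/

/-- The operators all of whose weights under rescaling are powers `2 ^ j` with `j ≥ k`. -/
def filt (a c : Fin 3 → ℂ) (k : ℤ) : Submodule ℂ B :=
  Submodule.span ℂ {b | ∃ j ≥ k, Intertw a c b ((2 : ℂ) ^ j • b)}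

theorem mem_filt {a c : Fin 3 → ℂ} {k j : ℤ} {b : B} (hj : k ≤ j)
    (h : Intertw a c b ((2 : ℂ) ^ j • b)) : b ∈ filt a c k := Submodule.subset_span ⟨j, hj, h⟩

theorem filt_mul_mem {a c : Fin 3 → ℂ} {k l : ℤ} {b b' : B} (hb : b ∈ filt a c k)
    (hb' : b' ∈ filt a c l) : b * b' ∈ filt a c (k + l) := by
  have h := Submodule.mul_mem_mul hb hb'
  rw [filt, filt, Submodule.span_mul_span] at h
  refine Submodule.span_mono ?_ h
  rintro _ ⟨x, ⟨i, hi, hx⟩, y, ⟨j, hj, hy⟩, rfl⟩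
  refine ⟨i + j, add_le_add hi hj, ?_⟩
  have := hx.mul hy
  rwa [smul_mul_smul_comm, ← zpow_add₀ two_ne_zero] at this

theorem filt_map_mem {a c : Fin 3 → ℂ} {k l : ℤ} (f : B →ₗ[ℂ] B)
    (hf : ∀ j ≥ k, ∀ b, Intertw a c b ((2 : ℂ) ^ j • b) → f b ∈ filt a c l) {b : B}
    (hb : b ∈ filt a c k) : f b ∈ filt a c l := by
  have : filt a c k ≤ (filt a c l).comap f :=
    Submodule.span_le.2 fun b ⟨j, hj, h⟩ => hf j hj b h
  exact this hb

theorem intertw_parOm (a c : Fin 3 → ℂ) : Intertw a c parOm parOm := by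
  intro ω
  rw [parOm_eq, parOm_eq]
  have : (scaleOm a c).comp (scaleOm (fun _ => 1) (fun _ => -1)) =
      (scaleOm (fun _ => 1) (fun _ => -1)).comp (scaleOm a c) := by
    refine Algebra.TensorProduct.ext ?_ ?_
    · ext k
      simp [scaleOm, scaleCV]
    · ext φ
      have h (ξ : V) : diagV (fun _ => -1) ξ = -ξ := by
        ext k
        simp [Matrix.mulVec_diagonal]
      have e : (diagV c).dualMap ((diagV fun _ => -1).dualMap φ) =
          (diagV fun _ => -1).dualMap ((diagV c).dualMap φ) :=
        LinearMap.ext fun ξ => by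
          simp only [LinearMap.dualMap_apply, h, map_neg]
      simp [scaleOm, scaleLVd, e]
  exact DFunLike.congr_fun this ω

theorem Intertw.parB {a c : Fin 3 → ℂ} {b b' : B} (h : Intertw a c b b') :
    Intertw a c (parB b) (parB b') :=
  ((intertw_parOm a c).mul h).mul (intertw_parOm a c)

theorem filt_parB_mem {a c : Fin 3 → ℂ} {k : ℤ} {b : B} (hb : b ∈ filt a c k) :
    parB b ∈ filt a c k :=
  filt_map_mem parB (fun j hj b h => mem_filt hj (by simpa using h.parB)) hb

/-- With r = 2^(-e), the homotopy shifts weights by e. This is +1 for form degree and -1 for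
polynomial degree. -/
theorem filt_edgeL_mem {a c c' : Fin 3 → ℂ} (ha : ∀ k, a k ≠ 0) (hc : ∀ k, c k * c' k = 1) {e : ℤ}
    (he : ∀ k, a k = (2 : ℂ) ^ (-e) * c k) {k : ℤ} {b : B} (hb : b ∈ filt a c k) :
    edgeL b ∈ filt a c (k + e) := by
  refine filt_map_mem homotopyL (fun j hj b h => mem_filt (j := j + e) (by linarith) ?_)
    (filt_parB_mem hb)
  have h1 := (h.homotopy ha hc he).smul ((2 : ℂ) ^ e)
  rw [homotopy_smul, smul_smul, smul_smul, ← zpow_add₀ two_ne_zero, ← zpow_add₀ two_ne_zero,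
    add_neg_cancel, zpow_zero, one_smul] at h1
  rw [homotopyL_apply, add_comm]
  exact h1

theorem pert_apply (g : Fin 3 → CV) (b : B) :
    pert g b = b * wedgeForm g - wedgeForm g * parB b := by
  rw [pert, muDiff_apply, b_neg_mul, b_mul_neg]
  abel

theorem filt_pert_mem {a c : Fin 3 → ℂ} {k l : ℤ} {g : Fin 3 → CV} (hg : wedgeForm g ∈ filt a c l)
    {b : B} (hb : b ∈ filt a c k) : pert g b ∈ filt a c (k + l) := by
  rw [pert_apply]
  have h := filt_mul_mem hg (filt_parB_mem hb)
  rw [add_comm] at h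
  exact Submodule.sub_mem (filt a c (k + l)) (x := b * wedgeForm g) (filt_mul_mem hb hg) h

theorem intertw_wedgeForm {a c : Fin 3 → ℂ} {ν : ℂ} {g : Fin 3 → CV}
    (hg : ∀ k, c k • scaleCV a (g k) = ν • g k) :
    Intertw a c (wedgeForm g) (ν • wedgeForm g) := by
  have h := Intertw.wedgeLeft (a := a) (c := c) (oneForm g)
  have e : scaleOm a c (oneForm g) = ν • oneForm g := by
    rw [oneForm, map_sum, Finset.smul_sum]
    refine Finset.sum_congr rfl fun k _ => ?_
    rw [scaleOm_tmul, scaleLVd_dvι, tmul_smul, smul_tmul', hg, smul_tmul']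
  rw [e] at h
  have e2 : wedgeLeft (ν • oneForm g) = ν • wedgeLeft (oneForm g) :=
    LinearMap.ext fun ω => by
      rw [wedgeLeft_apply, LinearMap.smul_apply, wedgeLeft_apply, smul_mul_assoc]
  rw [wedgeForm_eq, ← e2]
  exact h

/-! ### The filtration by the degree of differential forms -/

/-- The filtration of `B` by the degree of operators with respect to the degree of forms. -/
abbrev formFilt : ℤ → Submodule ℂ B := filt (fun _ => 1) (fun _ => 2)

theorem mem_formFilt (b : B) : b ∈ formFilt (-3) := by
  induction b using b_induction with
  | hadd x y hx hy => exact add_mem hx hy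
  | hsmul z x hx => exact Submodule.smul_mem _ z hx
  | h m J K =>
    have hJ : (K.card : ℤ) ≤ 3 := by exact_mod_cast K.card_le_univ
    refine mem_filt (j := (J.card : ℤ) - K.card) (by linarith [Int.natCast_nonneg J.card]) ?_
    have h := Intertw.nrm (a := fun _ => 1) (c := fun _ => 2) (c' := fun _ => 2⁻¹)
      (fun _ => by norm_num) (MvPolynomial.monomial m (1 : ℂ) ⊗ₜ dvJ J) (xiJ K)
    rw [scaleOm_tmul, scaleCV_monomial, scaleLVd_dvJ, scaleLV_xiJ, nrm_smul_right] at h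
    simp only [one_pow, Finset.prod_const_one, one_smul, tmul_smul, nrm_smul_left,
      Finset.prod_const, smul_smul] at h
    rw [zpow_sub₀ two_ne_zero, zpow_natCast, zpow_natCast, div_eq_mul_inv, mul_comm, ← inv_pow]
    exact h

/-- No operator raises form degree by four. The rescaling S of Ω(V) is annihilated by a polynomial
with roots 1, 2, 4, 8, whereas b(dv_K), if nonzero, would have an eigenvalue of at least 16. -/
theorem formFilt_eq_zero {k : ℤ} (hk : 4 ≤ k) {b : B} (hb : b ∈ formFilt k) : b = 0 := by
  have key : formFilt k ≤ ⊥ := by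
    refine Submodule.span_le.2 ?_
    rintro b ⟨j, hj, h⟩
    refine b_ext fun K => ?_
    set S : Module.End ℂ Om := (scaleOm (fun _ => 1) (fun _ => 2)).toLinearMap with hS
    set q : Polynomial ℂ := (Polynomial.X - 1) * (Polynomial.X - Polynomial.C 2) *
      (Polynomial.X - Polynomial.C 4) * (Polynomial.X - Polynomial.C 8) with hq
    have hev (z : ℂ) (ω : Om) (h : S ω = z • ω) : Polynomial.aeval S q ω = q.eval z • ω := by
      by_cases h0 : ω = 0
      · rw [h0, map_zero, smul_zero]
      · exact Module.End.aeval_apply_of_hasEigenvector ⟨Module.End.mem_eigenspace_iff.2 h, h0⟩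
    have hsc (m : Fin 3 →₀ ℕ) (J : Finset (Fin 3)) :
        S (MvPolynomial.monomial m (1 : ℂ) ⊗ₜ dvJ J) =
          (2 : ℂ) ^ J.card • (MvPolynomial.monomial m (1 : ℂ) ⊗ₜ dvJ J) := by
      rw [hS, AlgHom.toLinearMap_apply, scaleOm_tmul, scaleCV_monomial, scaleLVd_dvJ]
      simp only [one_pow, Finset.prod_const_one, one_smul, tmul_smul, Finset.prod_const]
    have hz (ω : Om) : Polynomial.aeval S q ω = 0 := by
      induction ω using om_induction with
      | hadd x y hx hy => rw [map_add, hx, hy, add_zero]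
      | hsmul z x hx => rw [map_smul, hx, smul_zero]
      | h m J =>
        rw [hev _ _ (hsc m J)]
        have hJ : J.card ≤ 3 := J.card_le_univ
        have : q.eval ((2 : ℂ) ^ J.card) = 0 := by
          interval_cases J.card <;> simp [hq] <;> norm_num
        rw [this, zero_smul]
    have h1 : S (b (1 ⊗ₜ dvJ K)) = ((2 : ℂ) ^ (j.toNat + K.card)) • b (1 ⊗ₜ dvJ K) := by
      have e1 : S (1 ⊗ₜ dvJ K) = (2 : ℂ) ^ K.card • (1 ⊗ₜ dvJ K) := hsc 0 K
      have e2 : S (b (1 ⊗ₜ dvJ K)) = ((2 : ℂ) ^ j • b) (S (1 ⊗ₜ dvJ K)) := h _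
      have e3 : (2 : ℂ) ^ j = 2 ^ j.toNat := by
        rw [← zpow_natCast, Int.toNat_of_nonneg (by linarith)]
      rw [e2, e1, LinearMap.smul_apply, LinearMap.map_smul_of_tower, smul_smul, e3, pow_add]
    have h2 := hz (b (1 ⊗ₜ dvJ K))
    rw [hev _ _ h1] at h2
    refine (smul_eq_zero.1 h2).resolve_left ?_
    have h3 : 4 ≤ j.toNat := by omega
    obtain ⟨n, hn⟩ := Nat.exists_eq_add_of_le (h3.trans (Nat.le_add_right _ K.card))
    have h4 : (1 : ℝ) ≤ 2 ^ n := one_le_pow₀ (by norm_num)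
    have hne (x : ℝ) (hx : x ≤ 8) : (2 : ℂ) ^ (4 + n) - (x : ℂ) ≠ 0 := by
      rw [sub_ne_zero]
      intro h
      have h' : (2 : ℝ) ^ (4 + n) = x := by exact_mod_cast h
      rw [pow_add] at h'
      linarith
    rw [hn, hq]
    simp only [Polynomial.eval_mul, Polynomial.eval_sub, Polynomial.eval_X, Polynomial.eval_C,
      Polynomial.eval_one]
    refine mul_ne_zero (mul_ne_zero (mul_ne_zero ?_ ?_) ?_) ?_
    · simpa using hne 1 (by norm_num)
    · simpa using hne 2 (by norm_num)
    · simpa using hne 4 (by norm_num)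
    · simpa using hne 8 (by norm_num)
  exact key hb

theorem intertw_wedgeForm_form (g : Fin 3 → CV) :
    Intertw (fun _ => 1) (fun _ => 2) (wedgeForm g) ((2 : ℂ) • wedgeForm g) := by
  refine intertw_wedgeForm fun k => ?_
  have : scaleCV (fun _ => 1) = AlgHom.id ℂ CV := by
    ext k
    simp [scaleCV]
  rw [this, AlgHom.id_apply]

theorem wedgeForm_mem_formFilt (g : Fin 3 → CV) : wedgeForm g ∈ formFilt 1 :=
  mem_filt le_rfl (by simpa using intertw_wedgeForm_form g)

theorem formFilt_edgeL_mem {k : ℤ} {b : B} (hb : b ∈ formFilt k) : edgeL b ∈ formFilt (k + 1) :=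
  filt_edgeL_mem (c' := fun _ => 2⁻¹) (by simp) (by simp) (by simp) hb

/-- Weights start at -3 or above and anything of weight at least 4 is zero, so four steps of size
two suffice. -/
theorem isNilpotent_of_formFilt (f : Module.End ℂ B)
    (hf : ∀ k, ∀ b ∈ formFilt k, f b ∈ formFilt (k + 2)) : IsNilpotent f := by
  have h (n : ℕ) (b : B) : (f ^ n) b ∈ formFilt (-3 + 2 * n) := by
    induction n with
    | zero => simpa using mem_formFilt b
    | succ n ih =>
      rw [pow_succ', Module.End.mul_apply]
      have := hf _ _ ih
      rwa [show (-3 + 2 * ((n + 1 : ℕ) : ℤ)) = -3 + 2 * n + 2 by push_cast; ring]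
  exact ⟨4, LinearMap.ext fun b => formFilt_eq_zero (by norm_num) (h 4 b)⟩

/-! ### The filtration by the degree of polynomials -/

/-- The filtration of `B` by the degree of operators with respect to the degree of polynomials. -/
abbrev polyFilt : ℤ → Submodule ℂ B := filt (fun _ => 2) (fun _ => 1)

theorem scaleLV_one (θ : LV) : scaleLV (fun _ => 1) θ = θ := by
  have : scaleLV (fun _ => 1) = AlgHom.id ℂ LV := by
    ext ξ
    simp [scaleLV, diagV]
  rw [this, AlgHom.id_apply]

theorem intertw_incl {a c c' : Fin 3 → ℂ} (hc : ∀ k, c k * c' k = 1) (θ : LV) :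
    Intertw a c (incl θ) (incl (scaleLV c' θ)) := by
  rw [incl_eq, incl_eq]
  exact Intertw.contrB hc θ

theorem incl_mem_polyFilt (θ : LV) : incl θ ∈ polyFilt 0 := by
  have h := intertw_incl (a := fun _ => 2) (c := fun _ => 1) (c' := fun _ => 1) (by simp) θ
  rw [scaleLV_one] at h
  refine mem_filt (j := 0) le_rfl ?_
  rw [zpow_zero, one_smul]
  exact h

/-- The two parts of γ have weights 2 and 4. As γ itself is not homogeneous, a filtration is used
instead of a grading. -/
theorem wedgeForm_gW_mem_polyFilt : wedgeForm gW ∈ polyFilt 2 := by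
  have e : wedgeForm gW = wedgeForm (fun k => -MvPolynomial.C (1 / 3 : ℂ) *
      MvPolynomial.X (k + 1) * MvPolynomial.X (k + 2)) +
      wedgeForm (fun k => MvPolynomial.X k ^ 4) := by
    rw [wedgeForm, wedgeForm, wedgeForm, ← Finset.sum_add_distrib]
    exact Finset.sum_congr rfl fun k _ => add_smul _ _ _
  rw [e]
  refine add_mem ?_ ?_
  · refine mem_filt (j := 2) le_rfl (intertw_wedgeForm (ν := (2 : ℂ) ^ (2 : ℤ)) fun k => ?_)
    simp only [scaleCV, map_mul, map_neg, MvPolynomial.aeval_C, MvPolynomial.aeval_X, one_smul,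
      MvPolynomial.algebraMap_eq, MvPolynomial.smul_eq_C_mul]
    rw [show (2 : ℂ) ^ (2 : ℤ) = 2 * 2 by norm_num, map_mul]
    ring
  · refine mem_filt (j := 4) (by norm_num) (intertw_wedgeForm (ν := (2 : ℂ) ^ (4 : ℤ)) fun k => ?_)
    simp only [scaleCV, map_pow, MvPolynomial.aeval_X, one_smul, MvPolynomial.smul_eq_C_mul,
      mul_pow]
    rw [show (2 : ℂ) ^ (4 : ℤ) = 2 ^ 4 by norm_num, map_pow]

theorem polyFilt_edgeL_mem {k : ℤ} {b : B} (hb : b ∈ polyFilt k) : edgeL b ∈ polyFilt (k - 1) :=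
  filt_edgeL_mem (c' := fun _ => 1) (by simp) (by simp) (by simp) hb

/-- The projection is invariant under rescaling of the v_k, so it kills every eigenvector of
eigenvalue 2^j ≠ 1. -/
theorem proj_eq_zero_of_polyFilt {k : ℤ} (hk : 1 ≤ k) {b : B} (hb : b ∈ polyFilt k) :
    proj b = 0 := by
  have key : polyFilt k ≤ LinearMap.ker projL := by
    refine Submodule.span_le.2 ?_
    rintro b ⟨j, hj, h⟩
    have h1 := h.proj (c' := fun _ => 1) (r := 2) (by simp) (by simp) (by simp)
    rw [scaleLV_one, proj_smul] at h1
    have h2 : ((2 : ℂ) ^ j - 1) • proj b = 0 := by rw [sub_smul, h1, one_smul, sub_self]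
    refine (smul_eq_zero.1 h2).resolve_left (sub_ne_zero.2 fun h3 => ?_)
    have h4 : (2 : ℝ) ^ j = 1 := Complex.ofReal_injective (by push_cast; exact h3)
    exact absurd h4 (one_lt_zpow₀ (by norm_num) (by linarith)).ne'
  exact key hb

/-! ### The retract -/

theorem aeval_zero_gW (k : Fin 3) : MvPolynomial.aeval (fun _ : Fin 3 => (0 : ℂ)) (gW k) = 0 := by
  simp [gW]

/-- The homotopy retract of `B` onto `Λ(V)`. -/
def koszulRetract : Retract LV B where
  sA := parLV
  s := parB
  d := muDiff iotaEta
  β := pert gW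
  H := edgeL
  i := inclL
  p := projL
  m := muProd
  d_i := muDiff_iotaEta_incl
  p_d := proj_muDiff_iotaEta
  p_β := proj_pert aeval_zero_gW
  p_H b := proj_homotopy (parB b)
  p_i := proj_incl
  homotopy := muDiff_edgeL
  d_d := muDiff_muDiff (f := 0) parB_iotaEta (by rw [iotaEta_mul_iotaEta, zero_smul])
  d_β b := by
    have h1 := muDiff_muDiff (parB_delta gW) (delta_mul_delta gW) b
    have h2 := muDiff_muDiff (f := 0) parB_iotaEta (by rw [iotaEta_mul_iotaEta, zero_smul]) b
    rw [muDiff_delta, muDiff_delta, map_add, map_add, h2, zero_add] at h1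
    rw [← h1]
    abel
  d_m := muDiff_muProd parB_iotaEta
  β_m := muDiff_muProd (by rw [parB_neg, parB_wedgeForm])
  m_m := muProd_muProd
  nilp := isNilpotent_of_formFilt _ fun k b hb => by
    have := formFilt_edgeL_mem (filt_pert_mem (wedgeForm_mem_formFilt gW) hb)
    rwa [add_assoc, one_add_one_eq_two] at this
  nilp_comm := isNilpotent_of_formFilt _ fun k b hb => by
    have h1 := formFilt_edgeL_mem (filt_pert_mem (wedgeForm_mem_formFilt gW) hb)
    have h2 := filt_pert_mem (wedgeForm_mem_formFilt gW) (formFilt_edgeL_mem hb)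
    rw [add_assoc, one_add_one_eq_two] at h1 h2
    exact add_mem h1 h2

/-! ### Ribbon trees by their numbers of leaves and bivalent vertices -/

namespace RTree

/-- The number of bivalent vertices. -/
def bis : RTree → ℕ
  | .leaf => 0
  | .bi t => t.bis + 1
  | .tri t u => t.bis + u.bis

/-- The number of vertices. -/
def vertices : RTree → ℕ
  | .leaf => 0
  | .bi t => t.vertices + 1
  | .tri t u => t.vertices + u.vertices + 1

/-- There is one trivalent vertex less than there are leaves. -/
theorem vertices_add_one (t : RTree) : t.vertices + 1 = t.bis + t.leaves := by
  induction t with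
  | leaf => rfl
  | bi t ih => simp only [vertices, bis, leaves]; omega
  | tri t u iht ihu => simp only [vertices, bis, leaves]; omega

theorem leaves_pos (t : RTree) : 0 < t.leaves := by
  induction t with
  | leaf => exact Nat.one_pos
  | bi t ih => exact ih
  | tri t u iht _ => exact Nat.add_pos_left iht _

/-- Fixing the leaves alone would not do, since bivalent vertices can be strung together
indefinitely. Removing the root vertex lowers d + n, because both branches at a trivalent vertex
have leaves. -/
theorem finite_setOf (d n : ℕ) : {t : RTree | t.leaves = d ∧ t.bis = n}.Finite := by
  induction h : d + n using Nat.strong_induction_on generalizing d n with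
  | _ N ih =>
    subst h
    set S : ℕ → ℕ → Set RTree := fun d n => {t | t.leaves = d ∧ t.bis = n}
    have h1 : ({leaf} ∪ ⋃ j ∈ Set.Iio n, bi '' S d j).Finite := by
      refine (Set.finite_singleton _).union ((Set.finite_Iio n).biUnion fun j hj => ?_)
      have hj : j < n := hj
      exact (ih (d + j) (by omega) d j rfl).image _
    have h2 : (⋃ i ∈ Set.Ioo 0 d, ⋃ j ∈ Set.Iic n,
        Set.image2 tri (S i j) (S (d - i) (n - j))).Finite := by
      refine (Set.finite_Ioo 0 d).biUnion fun i hi => (Set.finite_Iic n).biUnion fun j hj => ?_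
      obtain ⟨hi, hi'⟩ := hi
      have hj : j ≤ n := hj
      exact (ih (i + j) (by omega) _ _ rfl).image2 _ (ih (d - i + (n - j)) (by omega) _ _ rfl)
    refine (h1.union h2).subset ?_
    rintro (_ | t | ⟨t, u⟩) ⟨hd, hn⟩
    · exact Or.inl (Or.inl rfl)
    · refine Or.inl (Or.inr ?_)
      simp only [bis] at hn
      exact Set.mem_biUnion (show t.bis < n by omega) ⟨t, ⟨hd, rfl⟩, rfl⟩
    · refine Or.inr ?_
      simp only [leaves, bis] at hd hn
      have ht := t.leaves_pos
      have hu := u.leaves_pos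
      exact Set.mem_biUnion (x := t.leaves) ⟨ht, by omega⟩
        (Set.mem_biUnion (x := t.bis) (show t.bis ≤ n by omega)
          ⟨t, ⟨rfl, rfl⟩, u, ⟨by omega, by omega⟩, rfl⟩)

/-- The trees with `d` leaves and `n` bivalent vertices. -/
def trees (d n : ℕ) : Finset RTree := (finite_setOf d n).toFinset

theorem mem_trees {d n : ℕ} {t : RTree} : t ∈ trees d n ↔ t.leaves = d ∧ t.bis = n := by
  simp [trees]

variable {X : Type} [AddCommMonoid X]

/-- Summation over trees, by the type of the vertex at the root. -/
theorem sum_trees (f : RTree → X) (d n : ℕ) :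
    ∑ t ∈ trees d n, f t = (if d = 1 ∧ n = 0 then f leaf else 0) +
      ((if n = 0 then 0 else ∑ t ∈ trees d (n - 1), f (bi t)) +
        ∑ x ∈ Finset.HasAntidiagonal.antidiagonal d, ∑ y ∈ Finset.HasAntidiagonal.antidiagonal n,
          ∑ t ∈ trees x.1 y.1, ∑ u ∈ trees x.2 y.2, f (tri t u)) := by
  classical
  set f₀ : RTree → X := fun t => match t with | leaf => f leaf | _ => 0 with hf₀
  set f₁ : RTree → X := fun t => match t with | bi t => f (bi t) | _ => 0 with hf₁
  set f₂ : RTree → X := fun t => match t with | tri t u => f (tri t u) | _ => 0 with hf₂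
  have h : ∀ t, f t = f₀ t + (f₁ t + f₂ t) := by
    rintro (_ | t | ⟨t, u⟩) <;> simp [hf₀, hf₁, hf₂]
  rw [Finset.sum_congr rfl fun t _ => h t, Finset.sum_add_distrib, Finset.sum_add_distrib]
  congr 1
  · have e : ∀ t ∈ trees d n, f₀ t = if t = leaf then f leaf else 0 := by
      rintro (_ | t | ⟨t, u⟩) _ <;> simp [hf₀]
    rw [Finset.sum_congr rfl e, Finset.sum_ite_eq']
    refine if_congr ?_ rfl rfl
    rw [mem_trees]
    simp [leaves, bis, eq_comm]
  congr 1
  · split_ifs with hn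
    · refine Finset.sum_eq_zero ?_
      rintro (_ | t | ⟨t, u⟩) ht
      · rfl
      · rw [mem_trees] at ht
        simp only [bis] at ht
        omega
      · rfl
    · refine (Finset.sum_of_injOn bi (fun t _ u _ h => by injection h) (fun t ht => ?_)
        ?_ fun _ _ => rfl).symm
      · rw [Finset.mem_coe, mem_trees] at *
        simp only [leaves, bis]
        omega
      · rintro (_ | t | ⟨t, u⟩) ht h
        · rfl
        · refine absurd ⟨t, ?_, rfl⟩ h
          rw [Finset.mem_coe, mem_trees] at *
          simp only [leaves, bis] at ht
          omega
        · rfl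
  · simp only [Finset.sum_sigma']
    refine (Finset.sum_of_injOn (fun p : (_ : ℕ × ℕ) × (_ : ℕ × ℕ) × (_ : RTree) × RTree => tri p.2.2.1 p.2.2.2) ?_ ?_ ?_ fun _ _ => rfl).symm
    · rintro ⟨⟨d₁, d₂⟩, ⟨n₁, n₂⟩, t, u⟩ hp ⟨⟨d₁', d₂'⟩, ⟨n₁', n₂'⟩, t', u'⟩ hp' h
      simp only [Finset.coe_sigma, Set.mem_sigma_iff, Finset.mem_coe, mem_trees] at hp hp' h
      injection h with h1 h2
      obtain ⟨_, _, ⟨rfl, rfl⟩, rfl, rfl⟩ := hp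
      obtain ⟨_, _, ⟨rfl, rfl⟩, rfl, rfl⟩ := hp'
      subst h1 h2
      rfl
    · rintro ⟨⟨d₁, d₂⟩, ⟨n₁, n₂⟩, t, u⟩ hp
      simp only [Finset.coe_sigma, Set.mem_sigma_iff, Finset.mem_coe, mem_trees,
        Finset.HasAntidiagonal.mem_antidiagonal] at hp
      rw [Finset.mem_coe, mem_trees]
      simp only [leaves, bis]
      omega
    · rintro (_ | t | ⟨t, u⟩) ht h
      · rfl
      · rfl
      · refine absurd ⟨⟨(t.leaves, u.leaves), (t.bis, u.bis), t, u⟩, ?_, rfl⟩ h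
        rw [mem_trees] at ht
        simp only [Finset.mem_coe, Finset.mem_sigma, mem_trees, Finset.HasAntidiagonal.mem_antidiagonal]
        exact ⟨ht.1, ht.2, ⟨trivial, trivial⟩, trivial, trivial⟩

end RTree

/-! ### The sum over trees in a homotopy retract -/

/-- Relates a count of the bivalent vertices in a whole tree to separate counts in the two branches
at its root. -/
theorem sum_range_antidiagonal {X : Type} [AddCommMonoid X] (h : ℕ → ℕ → X) (N : ℕ) (h1 : ∀ a b, N ≤ a → h a b = 0)
    (h2 : ∀ a b, N ≤ b → h a b = 0) :
    ∑ n ∈ Finset.range (2 * N + 1), ∑ y ∈ Finset.HasAntidiagonal.antidiagonal n, h y.1 y.2 =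
      ∑ a ∈ Finset.range N, ∑ b ∈ Finset.range N, h a b := by
  rw [← Finset.sum_product' (Finset.range N) (Finset.range N) h,
    ← Finset.sum_fiberwise_of_maps_to (s := Finset.range N ×ˢ Finset.range N)
      (t := Finset.range (2 * N + 1)) (g := fun y => y.1 + y.2)]
  · refine Finset.sum_congr rfl fun n _ => ?_
    refine (Finset.sum_subset (fun y hy => ?_) fun y hy hy' => ?_).symm
    · exact Finset.HasAntidiagonal.mem_antidiagonal.2 (Finset.mem_filter.1 hy).2
    · rw [Finset.mem_filter, Finset.mem_product, Finset.mem_range, Finset.mem_range] at hy'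
      rw [Finset.HasAntidiagonal.mem_antidiagonal] at hy
      by_cases h3 : N ≤ y.1
      · exact h1 _ _ h3
      · exact h2 _ _ (by omega)
  · intro y hy
    rw [Finset.mem_product, Finset.mem_range, Finset.mem_range] at hy
    rw [Finset.mem_range]
    omega

namespace Retract

variable {A X : Type} [AddCommGroup A] [Module ℂ A] [AddCommGroup X] [Module ℂ X]
  (T : Retract A X)

/-- The operation of a tree, with the homotopy on the outgoing edge. -/
def val : RTree → List A → X
  | .leaf, l => T.lin l
  | .bi t, l => T.H (T.β (val t l))
  | .tri t u, l => T.H (T.m (val t (l.take t.leaves)) (val u (l.drop t.leaves)))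

/-- The operation of a tree with at least one vertex, before the outgoing edge. -/
def out : RTree → List A → X
  | .leaf, _ => 0
  | .bi t, l => T.β (T.val t l)
  | .tri t u, l => T.m (T.val t (l.take t.leaves)) (T.val u (l.drop t.leaves))

theorem val_eq_of_ne {t : RTree} (ht : t ≠ .leaf) (l : List A) : T.val t l = T.H (T.out t l) := by
  cases t with
  | leaf => exact absurd rfl ht
  | bi t => rfl
  | tri t u => rfl

theorem isLinearMap_val (t : RTree) (x z : List A) (h : x.length + z.length + 1 = t.leaves) :
    IsLinearMap ℂ fun a => T.val t (x ++ a :: z) := by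
  induction t generalizing x z with
  | leaf =>
    simp only [RTree.leaves] at h
    obtain rfl : x = [] := List.length_eq_zero_iff.1 (by omega)
    obtain rfl : z = [] := List.length_eq_zero_iff.1 (by omega)
    exact T.i.isLinear
  | bi t ih =>
    exact ((T.H ∘ₗ T.β) ∘ₗ (ih x z h).mk').isLinear
  | tri t u iht ihu =>
    simp only [RTree.leaves] at h
    simp only [val]
    -- The varied entry sits at a leaf of t or at a leaf of u.
    by_cases hx : x.length < t.leaves
    · obtain ⟨k, hk⟩ := Nat.exists_eq_add_of_lt hx
      have e1 (a : A) : (x ++ a :: z).take t.leaves = x ++ a :: z.take k := by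
        rw [hk, add_assoc, List.take_length_add_append, List.take_succ_cons]
      have e2 (a : A) : (x ++ a :: z).drop t.leaves = z.drop k := by
        rw [hk, add_assoc, List.drop_length_add_append, List.drop_succ_cons]
      simp only [e1, e2]
      exact ((T.H ∘ₗ T.m.flip _) ∘ₗ
        (iht x (z.take k) (by rw [List.length_take]; omega)).mk').isLinear
    · push Not at hx
      have e1 (a : A) : (x ++ a :: z).take t.leaves = x.take t.leaves := List.take_append_of_le_length hx
      have e2 (a : A) : (x ++ a :: z).drop t.leaves = x.drop t.leaves ++ a :: z :=
        List.drop_append_of_le_length hx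
      simp only [e1, e2]
      exact ((T.H ∘ₗ T.m _) ∘ₗ
        (ihu (x.drop t.leaves) z (by rw [List.length_drop]; omega)).mk').isLinear

theorem isLinearMap_out (t : RTree) (x z : List A) (h : x.length + z.length + 1 = t.leaves) :
    IsLinearMap ℂ fun a => T.out t (x ++ a :: z) := by
  cases t with
  | leaf => exact (0 : A →ₗ[ℂ] X).isLinear
  | bi t => exact (T.β ∘ₗ (T.isLinearMap_val t x z h).mk').isLinear
  | tri t u =>
    simp only [RTree.leaves] at h
    simp only [out]
    by_cases hx : x.length < t.leaves
    · obtain ⟨k, hk⟩ := Nat.exists_eq_add_of_lt hx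
      have e1 (a : A) : (x ++ a :: z).take t.leaves = x ++ a :: z.take k := by
        rw [hk, add_assoc, List.take_length_add_append, List.take_succ_cons]
      have e2 (a : A) : (x ++ a :: z).drop t.leaves = z.drop k := by
        rw [hk, add_assoc, List.drop_length_add_append, List.drop_succ_cons]
      simp only [e1, e2]
      exact ((T.m.flip _) ∘ₗ
        (T.isLinearMap_val t x (z.take k) (by rw [List.length_take]; omega)).mk').isLinear
    · push Not at hx
      have e1 (a : A) : (x ++ a :: z).take t.leaves = x.take t.leaves := List.take_append_of_le_length hx
      have e2 (a : A) : (x ++ a :: z).drop t.leaves = x.drop t.leaves ++ a :: z :=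
        List.drop_append_of_le_length hx
      simp only [e1, e2]
      exact ((T.m _) ∘ₗ
        (T.isLinearMap_val u (x.drop t.leaves) z (by rw [List.length_drop]; omega)).mk').isLinear

/-- The sum of `Retract.val` over all trees with `n` bivalent vertices. -/
def valSum (n : ℕ) (l : List A) : X := ∑ t ∈ RTree.trees l.length n, T.val t l

/-- The sum of `Retract.out` over all trees with `n` bivalent vertices. -/
def outSum (n : ℕ) (l : List A) : X := ∑ t ∈ RTree.trees l.length n, T.out t l

theorem isMultilin_sum_trees (f : RTree → List A → X)
    (hf : ∀ t x z, x.length + z.length + 1 = t.leaves → IsLinearMap ℂ fun a => f t (x ++ a :: z))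
    (n : ℕ) : IsMultilin fun l => ∑ t ∈ RTree.trees l.length n, f t l := by
  intro x z
  have e (a : A) : (x ++ a :: z).length = x.length + z.length + 1 := by
    rw [List.length_append, List.length_cons, add_assoc]
  simp only [e]
  constructor
  · intro a b
    rw [← Finset.sum_add_distrib]
    exact Finset.sum_congr rfl fun t ht => (hf t x z (RTree.mem_trees.1 ht).1.symm).map_add a b
  · intro c a
    rw [Finset.smul_sum]
    exact Finset.sum_congr rfl fun t ht => (hf t x z (RTree.mem_trees.1 ht).1.symm).map_smul c a

theorem isMultilin_valSum (n : ℕ) : IsMultilin (T.valSum n) :=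
  isMultilin_sum_trees _ T.isLinearMap_val n

theorem isMultilin_outSum (n : ℕ) : IsMultilin (T.outSum n) :=
  isMultilin_sum_trees _ T.isLinearMap_out n

/-- Trees are cut at the root vertex. At a trivalent root, distributing the leaves over the two
branches is a cut of the input list, which produces the convolution. -/
theorem outSum_eq (n : ℕ) (l : List A) :
    T.outSum n l = (if n = 0 then 0 else T.β (T.valSum (n - 1) l)) +
      ∑ y ∈ Finset.HasAntidiagonal.antidiagonal n, conv T.m (T.valSum y.1) (T.valSum y.2) l := by
  rw [outSum, RTree.sum_trees]
  have h0 : (if l.length = 1 ∧ n = 0 then T.out .leaf l else 0) = 0 := by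
    split_ifs <;> rfl
  rw [h0, zero_add]
  congr 1
  · rw [valSum, map_sum]
    rfl
  · rw [Finset.sum_comm]
    refine Finset.sum_congr rfl fun y _ => ?_
    rw [conv, splitSum_eq_sum_range, ← Nat.succ_eq_add_one,
      ← Finset.Nat.sum_antidiagonal_eq_sum_range_succ
        (fun i _ => T.m (T.valSum y.1 (l.take i)) (T.valSum y.2 (l.drop i)))]
    refine Finset.sum_congr rfl fun x hx => ?_
    rw [Finset.HasAntidiagonal.mem_antidiagonal] at hx
    have e1 : (l.take x.1).length = x.1 := by rw [List.length_take]; omega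
    have e2 : (l.drop x.1).length = x.2 := by rw [List.length_drop]; omega
    rw [valSum, valSum, e1, e2, LinearMap.map_sum₂]
    refine Finset.sum_congr rfl fun t ht => ?_
    rw [map_sum]
    refine Finset.sum_congr rfl fun u _ => ?_
    rw [out, (RTree.mem_trees.1 ht).1]

theorem valSum_eq (n : ℕ) (l : List A) :
    T.valSum n l = (if n = 0 then T.lin l else 0) + T.H (T.outSum n l) := by
  classical
  have h : ∀ t, T.val t l = (if t = .leaf then T.lin l else 0) + T.H (T.out t l) := by
    intro t
    by_cases ht : t = .leaf
    · subst ht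
      rw [if_pos rfl, out, map_zero, add_zero, val]
    · rw [if_neg ht, zero_add, T.val_eq_of_ne ht]
  rw [valSum, Finset.sum_congr rfl fun t _ => h t, Finset.sum_add_distrib, outSum, map_sum,
    Finset.sum_ite_eq']
  congr 1
  simp only [RTree.mem_trees, RTree.leaves, RTree.bis]
  by_cases hn : n = 0
  · subst hn
    by_cases hl : l.length = 1
    · simp [hl]
    · match l, hl with
      | [], _ => simp [lin, single]
      | _ :: _ :: _, _ => simp [lin, single]
  · rw [if_neg hn, if_neg fun h => hn h.2.symm]

theorem valSum_nil (n : ℕ) : T.valSum n [] = 0 := by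
  refine Finset.sum_eq_zero fun t ht => ?_
  have := t.leaves_pos
  rw [RTree.mem_trees, List.length_nil] at ht
  omega

/-- Trees with many bivalent vertices do not contribute. -/
def IsBounded (M : ℕ) : Prop :=
  ∀ (t : RTree) (l : List A), l.length = t.leaves → M + t.leaves ≤ t.bis → T.val t l = 0

/-- The sum over all trees with less than `M + d` bivalent vertices. -/
def total (M : ℕ) (l : List A) : X := ∑ n ∈ Finset.range (M + l.length), T.valSum n l

variable {T} {M : ℕ}

theorem IsBounded.valSum_eq_zero (hM : T.IsBounded M) {n : ℕ} {l : List A}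
    (h : M + l.length ≤ n) : T.valSum n l = 0 := by
  refine Finset.sum_eq_zero fun t ht => ?_
  rw [RTree.mem_trees] at ht
  exact hM t l ht.1.symm (by omega)

theorem IsBounded.total_eq (hM : T.IsBounded M) {N : ℕ} {l : List A} (h : M + l.length ≤ N) :
    T.total M l = ∑ n ∈ Finset.range N, T.valSum n l := by
  refine Finset.sum_subset (Finset.range_subset_range.2 h) fun n _ hn => ?_
  exact hM.valSum_eq_zero (not_lt.1 fun h => hn (Finset.mem_range.2 h))

/-- The cutoff in `total` depends on the length of the list; boundedness permits one cutoff N for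
all pieces of l, and 2N + 1 for the trees assembled from them. -/
theorem IsBounded.root_total (hM : T.IsBounded M) {l : List A} {N : ℕ} (hN : M + l.length ≤ N) :
    T.root (T.total M) l = ∑ n ∈ Finset.range (2 * N + 1), T.outSum n l := by
  simp only [outSum_eq]
  rw [Finset.sum_add_distrib, root]
  congr 1
  · rw [Finset.sum_range_succ', if_pos rfl, add_zero, hM.total_eq (N := 2 * N) (by omega), map_sum]
    exact Finset.sum_congr rfl fun n _ => by rw [if_neg (Nat.succ_ne_zero n), Nat.add_sub_cancel]
  · have h : ∀ x y, x ++ y = l → T.m (T.total M x) (T.total M y) =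
        ∑ n ∈ Finset.range (2 * N + 1), ∑ p ∈ Finset.HasAntidiagonal.antidiagonal n,
          T.m (T.valSum p.1 x) (T.valSum p.2 y) := by
      intro x y hxy
      have hl : x.length + y.length = l.length := by rw [← hxy, List.length_append]
      rw [sum_range_antidiagonal (fun a b => T.m (T.valSum a x) (T.valSum b y)) N
        (fun a b h => by rw [hM.valSum_eq_zero (by omega), map_zero, LinearMap.zero_apply])
        (fun a b h => by rw [hM.valSum_eq_zero (n := b) (by omega), map_zero]),
        hM.total_eq (N := N) (by omega), hM.total_eq (N := N) (by omega),
        LinearMap.map_sum₂]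
      exact Finset.sum_congr rfl fun a _ => map_sum _ _ _
    rw [conv, splitSum_congr h, splitSum_sum]
    refine Finset.sum_congr rfl fun n _ => ?_
    rw [splitSum_sum]
    rfl

theorem IsBounded.isSolution (hM : T.IsBounded M)
    (hs : ∀ l, T.total M (l.map fun a => -T.sA a) = -T.s (T.total M l)) :
    T.IsSolution (T.total M) where
  nil := Finset.sum_eq_zero fun n _ => T.valSum_nil n
  eq l := by
    rw [hM.root_total (N := M + l.length) le_rfl, map_sum,
      hM.total_eq (N := 2 * (M + l.length) + 1) (by omega), Finset.sum_congr rfl fun n _ =>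
        T.valSum_eq n l, Finset.sum_add_distrib, Finset.sum_range_succ', if_pos rfl,
      Finset.sum_eq_zero fun n _ => if_neg (Nat.succ_ne_zero n), zero_add]
  parity := hs

theorem isMultilin_total : IsMultilin (T.total M) := by
  intro x z
  have e (a : A) : (x ++ a :: z).length = x.length + z.length + 1 := by
    rw [List.length_append, List.length_cons, add_assoc]
  simp only [total, e]
  constructor
  · intro a b
    rw [← Finset.sum_add_distrib]
    exact Finset.sum_congr rfl fun n _ => (T.isMultilin_valSum n x z).map_add a b
  · intro c a
    rw [Finset.smul_sum]
    exact Finset.sum_congr rfl fun n _ => (T.isMultilin_valSum n x z).map_smul c a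

end Retract

/-! ### The operations of trees on `Λ(V)` -/

theorem koszul_val_bi (t : RTree) (l : List LV) :
    koszulRetract.val (.bi t) l = edgeL (pert gW (koszulRetract.val t l)) := rfl

theorem koszul_val_tri (t u : RTree) (l : List LV) :
    koszulRetract.val (.tri t u) l = edgeL (muProd (koszulRetract.val t (l.take t.leaves))
      (koszulRetract.val u (l.drop t.leaves))) := rfl

theorem koszul_out_bi (t : RTree) (l : List LV) :
    koszulRetract.out (.bi t) l = pert gW (koszulRetract.val t l) := rfl

theorem koszul_out_tri (t u : RTree) (l : List LV) :
    koszulRetract.out (.tri t u) l = muProd (koszulRetract.val t (l.take t.leaves))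
      (koszulRetract.val u (l.drop t.leaves)) := rfl

section Filtration

variable {a c : Fin 3 → ℂ} {k₀ k₁ e : ℤ}

theorem filt_muProd_mem {k l : ℤ} {b b' : B} (hb : b ∈ filt a c k) (hb' : b' ∈ filt a c l) :
    muProd b b' ∈ filt a c (k + l) := filt_mul_mem hb (filt_parB_mem hb')

/-- Weights add up over the tree. Each vertex accounts for one e, since the edge that leaves it
carries a homotopy; in `out_mem_filt` the root edge does not. -/
theorem val_mem_filt (hi : ∀ θ, incl θ ∈ filt a c k₀) (hw : wedgeForm gW ∈ filt a c k₁)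
    (hH : ∀ k, ∀ b ∈ filt a c k, edgeL b ∈ filt a c (k + e)) (t : RTree) (l : List LV) :
    koszulRetract.val t l ∈ filt a c (k₀ * t.leaves + k₁ * t.bis + e * t.vertices) := by
  induction t generalizing l with
  | leaf =>
    simp only [RTree.leaves, RTree.bis, RTree.vertices, Nat.cast_one, Nat.cast_zero, mul_one,
      mul_zero, add_zero]
    match l with
    | [] => exact zero_mem _
    | [θ] => exact hi θ
    | _ :: _ :: _ => exact zero_mem _
  | bi t ih =>
    have h := hH _ _ (filt_pert_mem hw (ih l))
    rw [koszul_val_bi]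
    convert h using 2
    simp only [RTree.leaves, RTree.bis, RTree.vertices]
    push_cast
    ring
  | tri t u iht ihu =>
    have h := hH _ _ (filt_muProd_mem (iht (l.take t.leaves)) (ihu (l.drop t.leaves)))
    rw [koszul_val_tri]
    convert h using 2
    simp only [RTree.leaves, RTree.bis, RTree.vertices]
    push_cast
    ring

theorem out_mem_filt (hi : ∀ θ, incl θ ∈ filt a c k₀) (hw : wedgeForm gW ∈ filt a c k₁)
    (hH : ∀ k, ∀ b ∈ filt a c k, edgeL b ∈ filt a c (k + e)) (t : RTree) (l : List LV) :
    koszulRetract.out t l ∈ filt a c (k₀ * t.leaves + k₁ * t.bis + e * (t.vertices - 1)) := by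
  cases t with
  | leaf => exact zero_mem _
  | bi t =>
    have h := filt_pert_mem hw (val_mem_filt hi hw hH t l)
    rw [koszul_out_bi]
    convert h using 2
    simp only [RTree.leaves, RTree.bis, RTree.vertices]
    push_cast
    ring
  | tri t u =>
    have h := filt_muProd_mem (val_mem_filt hi hw hH t (l.take t.leaves))
      (val_mem_filt hi hw hH u (l.drop t.leaves))
    rw [koszul_out_tri]
    convert h using 2
    simp only [RTree.leaves, RTree.bis, RTree.vertices]
    push_cast
    ring

end Filtration

/-- With d leaves and n bivalent vertices the form weight is at least -3d + n + (n + d - 1) = 2(n -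
d) - 1, which exceeds 3 once n ≥ d + 3. -/
theorem koszul_isBounded : koszulRetract.IsBounded 3 := by
  intro t l _ h
  refine formFilt_eq_zero ?_ (val_mem_filt (k₀ := -3) (k₁ := 1) (e := 1)
    (fun θ => mem_formFilt _) (wedgeForm_mem_formFilt gW) (fun k b hb => formFilt_edgeL_mem hb) t l)
  have := t.vertices_add_one
  omega

/-- With d leaves and n bivalent vertices the polynomial weight is at least 2n - (n + d - 2) = n - d
+ 2, which is positive here, so no constant term survives. -/
theorem proj_out_eq_zero_of_le {t : RTree} (h : t.leaves ≤ t.bis + 1) (l : List LV) :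
    proj (koszulRetract.out t l) = 0 := by
  refine proj_eq_zero_of_polyFilt ?_ (out_mem_filt (k₀ := 0) (k₁ := 2) (e := -1)
    incl_mem_polyFilt wedgeForm_gW_mem_polyFilt (fun k b hb => polyFilt_edgeL_mem hb) t l)
  have := t.vertices_add_one
  omega

/-! ### Homogeneity of the tree operations under rescaling -/

section Rescaling

variable {a c c' : Fin 3 → ℂ} {r ν : ℂ}

theorem Intertw.pert (hν : Intertw a c (wedgeForm gW) (ν • wedgeForm gW)) {b b' : B}
    (h : Intertw a c b b') : Intertw a c (pert gW b) (ν • pert gW b') := by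
  have h1 := (h.mul hν).sub (hν.mul h.parB)
  rw [mul_smul_comm, smul_mul_assoc] at h1
  rw [pert_apply, pert_apply, b_smul_sub]
  exact h1

theorem Intertw.muProd {b b' x x' : B} (h : Intertw a c b b') (h' : Intertw a c x x') :
    Intertw a c (muProd b x) (muProd b' x') := h.mul h'.parB

theorem Intertw.edgeL (ha : ∀ k, a k ≠ 0) (hc : ∀ k, c k * c' k = 1) (hr : ∀ k, a k = r * c k)
    {b b' : B} (h : Intertw a c b b') : Intertw a c (r • edgeL b) (edgeL b') :=
  h.parB.homotopy ha hc hr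

theorem intertw_val (ha : ∀ k, a k ≠ 0) (hc : ∀ k, c k * c' k = 1) (hr : ∀ k, a k = r * c k)
    (hν : Intertw a c (wedgeForm gW) (ν • wedgeForm gW)) (t : RTree) (l : List LV) :
    Intertw a c (r ^ t.vertices • koszulRetract.val t l)
      (ν ^ t.bis • koszulRetract.val t (l.map (scaleLV c'))) := by
  induction t generalizing l with
  | leaf =>
    simp only [RTree.bis, RTree.vertices, pow_zero, one_smul]
    match l with
    | [] => exact fun ω => map_zero _
    | [θ] => exact intertw_incl hc θ
    | _ :: _ :: _ => exact fun ω => map_zero _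
  | bi t ih =>
    have h := Intertw.edgeL ha hc hr (Intertw.pert hν (ih l))
    simp only [map_smul, smul_smul] at h
    simp only [koszul_val_bi, RTree.bis, RTree.vertices, pow_succ']
    exact h
  | tri t u iht ihu =>
    have h := Intertw.edgeL ha hc hr ((iht (l.take t.leaves)).muProd (ihu (l.drop t.leaves)))
    simp only [map_smul, LinearMap.smul_apply, smul_smul] at h
    simp only [koszul_val_tri, RTree.bis, RTree.vertices, pow_succ', pow_add, ← List.map_take,
      ← List.map_drop]
    rw [mul_comm (r ^ t.vertices), mul_comm (ν ^ t.bis)]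
    exact h

/-- Each bivalent vertex contributes ν and each finite edge r. The extra r on the left accounts for
the outgoing edge, which carries no homotopy. -/
theorem proj_out_map (ha : ∀ k, a k ≠ 0) (hc : ∀ k, c k * c' k = 1) (hr : ∀ k, a k = r * c k)
    (hν : Intertw a c (wedgeForm gW) (ν • wedgeForm gW)) (t : RTree) (l : List LV) :
    (r * ν ^ t.bis) • proj (koszulRetract.out t (l.map (scaleLV c'))) =
      r ^ t.vertices • scaleLV c' (proj (koszulRetract.out t l)) := by
  have key {ρ σ : ℂ} {b b' : B} (h : Intertw a c (ρ • b) (σ • b')) :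
      (r * σ) • proj b' = (r * ρ) • scaleLV c' (proj b) := by
    have := h.proj ha hc hr
    rw [proj_smul, proj_smul, map_smul] at this
    rw [mul_smul, this, mul_smul]
  cases t with
  | leaf =>
    have h0 (l : List LV) : proj (koszulRetract.out .leaf l) = 0 := map_zero projL
    rw [h0, h0, map_zero, smul_zero, smul_zero]
  | bi t =>
    have h := Intertw.pert hν (intertw_val ha hc hr hν t l)
    simp only [map_smul, smul_smul] at h
    simp only [koszul_out_bi, RTree.bis, RTree.vertices, pow_succ']
    exact key h
  | tri t u =>
    have h := (intertw_val ha hc hr hν t (l.take t.leaves)).muProd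
      (intertw_val ha hc hr hν u (l.drop t.leaves))
    simp only [map_smul, LinearMap.smul_apply, smul_smul] at h
    simp only [koszul_out_tri, RTree.bis, RTree.vertices, pow_succ', pow_add, ← List.map_take,
      ← List.map_drop]
    rw [mul_comm (r ^ t.vertices), mul_comm (ν ^ t.bis)]
    exact key h

/-- The part of the transferred operations from trees with `n` bivalent vertices. -/
def muPart (n : ℕ) (l : List LV) : LV := proj (koszulRetract.outSum n l)

theorem muPart_eq (n : ℕ) (l : List LV) :
    muPart n l = ∑ t ∈ RTree.trees l.length n, proj (koszulRetract.out t l) :=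
  map_sum projL _ _

theorem isMultilin_muPart (n : ℕ) : IsMultilin (muPart n) := fun x z =>
  (projL ∘ₗ (koszulRetract.isMultilin_outSum n x z).mk').isLinear

theorem muPart_map (ha : ∀ k, a k ≠ 0) (hc : ∀ k, c k * c' k = 1) (hr : ∀ k, a k = r * c k)
    (hν : Intertw a c (wedgeForm gW) (ν • wedgeForm gW)) (n : ℕ) (l : List LV) :
    (r * ν ^ n) • muPart n (l.map (scaleLV c')) =
      r ^ (n + l.length - 1) • scaleLV c' (muPart n l) := by
  rw [muPart_eq, muPart_eq, map_sum, Finset.smul_sum, Finset.smul_sum, List.length_map]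
  refine Finset.sum_congr rfl fun t ht => ?_
  have h := proj_out_map ha hc hr hν t l
  have hv := t.vertices_add_one
  rw [RTree.mem_trees] at ht
  rwa [ht.2, show t.vertices = n + l.length - 1 by omega] at h

theorem valSum_map (ha : ∀ k, a k ≠ 0) (hc : ∀ k, c k * c' k = 1) (hr : ∀ k, a k = r * c k)
    (hν : Intertw a c (wedgeForm gW) (ν • wedgeForm gW)) (n : ℕ) (l : List LV) :
    Intertw a c (r ^ (n + l.length - 1) • koszulRetract.valSum n l)
      (ν ^ n • koszulRetract.valSum n (l.map (scaleLV c'))) := by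
  intro ω
  rw [Retract.valSum, Retract.valSum, List.length_map, Finset.smul_sum, Finset.smul_sum,
    LinearMap.sum_apply, LinearMap.sum_apply, map_sum]
  refine Finset.sum_congr rfl fun t ht => ?_
  have h := intertw_val ha hc hr hν t l
  have hv := t.vertices_add_one
  rw [RTree.mem_trees] at ht
  rw [ht.2, show t.vertices = n + l.length - 1 by omega] at h
  exact h ω

end Rescaling

/-! ### The parity of the number of edges -/

theorem intertw_wedgeForm_neg :
    Intertw (fun _ => -1) (fun _ => 1) (wedgeForm gW) ((1 : ℂ) • wedgeForm gW) := by
  refine intertw_wedgeForm fun k => ?_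
  simp only [gW, scaleCV, map_add, map_mul, map_pow, map_neg, MvPolynomial.aeval_C,
    MvPolynomial.aeval_X, one_smul, MvPolynomial.algebraMap_eq, map_one]
  ring

/-- Under v ↦ -v the form coefficients of γ are even and each h is odd. A tree has one finite edge
less than it has vertices, so for an even number of vertices the constant term is its own negative.
-/
theorem proj_out_eq_zero_of_even {t : RTree} (h : Even t.vertices) (l : List LV) :
    proj (koszulRetract.out t l) = 0 := by
  have h1 := proj_out_map (c' := fun _ => 1) (r := -1) (by simp) (by simp) (by simp)
    intertw_wedgeForm_neg t l
  rw [one_pow, h.neg_one_pow, scaleLV_one, List.map_congr_left fun θ _ => scaleLV_one θ,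
    List.map_id', mul_one, one_smul, neg_one_smul] at h1
  have h2 : (2 : ℂ) • proj (koszulRetract.out t l) = 0 := by
    rw [two_smul]
    nth_rewrite 1 [← h1]
    exact neg_add_cancel _
  exact (smul_eq_zero.1 h2).resolve_left two_ne_zero

/-- The prescribed operation on finite edges is -H for the homotopy H of the retract, so the two
evaluations differ by one sign per edge. The second claim excludes the leaf, for which `Retract.out`
is set to zero. -/
theorem edge_out_eq (t : RTree) (l : List LV) (hl : l.length = t.leaves) :
    t.edge (t.out gW l) = (-1 : ℂ) ^ t.vertices • koszulRetract.val t l ∧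
      (t ≠ .leaf → t.out gW l = (-1 : ℂ) ^ (t.vertices + 1) • koszulRetract.out t l) := by
  induction t generalizing l with
  | leaf =>
    obtain ⟨θ, rfl⟩ := List.length_eq_one_iff.1 hl
    refine ⟨?_, fun h => absurd rfl h⟩
    rw [RTree.vertices, pow_zero, one_smul]
    rfl
  | bi t ih =>
    have h : RTree.out gW (.bi t) l =
        (-1 : ℂ) ^ (t.bi.vertices + 1) • koszulRetract.out (.bi t) l := by
      rw [RTree.out, inducedDiff_sub_inducedDiff, (ih l hl).1, map_smul, koszul_out_bi, RTree.vertices,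
        pow_succ, pow_succ, mul_assoc, neg_one_mul, neg_neg, mul_one]
    refine ⟨?_, fun _ => h⟩
    change -edgeL _ = _
    rw [h, map_smul, pow_succ, mul_neg_one, koszul_val_bi, koszul_out_bi]
    module
  | tri t u iht ihu =>
    rw [RTree.leaves] at hl
    have h : RTree.out gW (.tri t u) l =
        (-1 : ℂ) ^ ((t.tri u).vertices + 1) • koszulRetract.out (.tri t u) l := by
      rw [RTree.out, (iht _ (by rw [List.length_take]; omega)).1,
        (ihu _ (by rw [List.length_drop]; omega)).1, koszul_out_tri, RTree.vertices,
        pow_succ, pow_succ, mul_assoc, neg_one_mul, neg_neg, mul_one, pow_add, mul_smul,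
        ← muProd_apply, map_smul, map_smul, LinearMap.smul_apply, smul_comm]
    refine ⟨?_, fun _ => h⟩
    change -edgeL _ = _
    rw [h, map_smul, pow_succ, mul_neg_one, koszul_val_tri, koszul_out_tri]
    module

/-- The sign between the two conventions is -1 only for an even number of vertices, and then both
sides vanish. -/
theorem op_eq {t : RTree} (ht : t ≠ .leaf) {l : List LV} (hl : l.length = t.leaves) :
    t.op gW l = proj (koszulRetract.out t l) := by
  rw [RTree.op, (edge_out_eq t l hl).2 ht, proj_smul]
  rcases Nat.even_or_odd t.vertices with h | h
  · rw [proj_out_eq_zero_of_even h, smul_zero]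
  · rw [h.add_one.neg_one_pow, one_smul]

theorem finite_contributing (d : ℕ) :
    {t : RTree | t.leaves = d ∧ ∃ l : List LV, l.length = d ∧ t.op gW l ≠ 0}.Finite := by
  refine ((Set.finite_singleton RTree.leaf).union ((Set.finite_Iio d).biUnion fun n _ =>
    RTree.finite_setOf d n)).subset ?_
  rintro t ⟨ht, l, hl, h⟩
  by_cases h0 : t = .leaf
  · exact Or.inl h0
  · rw [op_eq h0 (by omega)] at h
    refine Or.inr (Set.mem_biUnion (x := t.bis) ?_ ⟨ht, rfl⟩)
    by_contra h1
    refine h (proj_out_eq_zero_of_le ?_ l)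
    have : ¬ t.bis < d := h1
    omega

/-- For d inputs only trees with at most d - 2 bivalent vertices survive the projection, so the sum
over infinitely many trees is finite. For d = 1 nothing is left. -/
theorem muTree_eq {l : List LV} {N : ℕ} (hN : l.length ≤ N + 1) :
    muTree gW l = ∑ n ∈ Finset.range N, muPart n l := by
  classical
  have h1 : muTree gW l = ∑ᶠ t ∈ {t : RTree | t.leaves = l.length ∧ t ≠ RTree.leaf},
      proj (koszulRetract.out t l) :=
    finsum_mem_congr rfl fun t ht => op_eq ht.2 ht.1.symm
  rw [h1, finsum_mem_eq_sum_of_inter_support_eq (t := (Finset.range N).biUnion fun n =>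
    RTree.trees l.length n), Finset.sum_biUnion]
  · simp only [muPart_eq]
  · intro n _ m _ hnm
    refine Finset.disjoint_left.2 fun t ht ht' => hnm ?_
    rw [RTree.mem_trees] at ht ht'
    exact ht.2.symm.trans ht'.2
  · ext t
    refine and_congr_left fun ht => ?_
    rw [Function.mem_support] at ht
    simp only [Set.mem_ofPred_eq, Finset.coe_biUnion, Finset.coe_range, Set.mem_iUnion, Finset.mem_coe,
      RTree.mem_trees, Set.mem_Iio, exists_prop]
    constructor
    · rintro ⟨h2, h3⟩
      refine ⟨t.bis, ?_, h2, rfl⟩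
      by_contra h4
      exact ht (proj_out_eq_zero_of_le (by omega) l)
    · rintro ⟨n, _, h2, _⟩
      refine ⟨h2, ?_⟩
      rintro rfl
      exact ht (map_zero projL)

theorem muTree_eq_transfer (l : List LV) :
    muTree gW l = koszulRetract.transfer (koszulRetract.total 3) l := by
  rw [Retract.transfer, koszul_isBounded.root_total le_rfl, map_sum,
    muTree_eq (N := 2 * (3 + l.length) + 1) (by omega)]
  rfl

theorem isMultilin_muTree : IsMultilin (muTree gW) := by
  intro x z
  have e (a : LV) : muTree gW (x ++ a :: z) =
      ∑ n ∈ Finset.range (x.length + z.length), muPart n (x ++ a :: z) :=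
    muTree_eq (by simp only [List.length_append, List.length_cons]; omega)
  simp only [e]
  constructor
  · intro a b
    rw [← Finset.sum_add_distrib]
    exact Finset.sum_congr rfl fun n _ => (isMultilin_muPart n x z).map_add a b
  · intro c a
    rw [Finset.smul_sum]
    exact Finset.sum_congr rfl fun n _ => (isMultilin_muPart n x z).map_smul c a

/-! ### Parity -/

theorem IsMultilin.map_smul_list {A X : Type} [AddCommGroup A] [Module ℂ A] [AddCommGroup X]
    [Module ℂ X] {m : List A → X} (hm : IsMultilin m) (l : List (ℂ × A)) :
    m (l.map fun p => p.1 • p.2) = (l.map Prod.fst).prod • m (l.map Prod.snd) := by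
  have h : ∀ (l : List (ℂ × A)) (x : List A),
      m (x ++ l.map fun p => p.1 • p.2) = (l.map Prod.fst).prod • m (x ++ l.map Prod.snd) := by
    intro l
    induction l with
    | nil => intro x; simp
    | cons p l ih =>
      intro x
      rw [List.map_cons, (hm x _).map_smul, List.map_cons, List.map_cons, List.prod_cons, mul_smul]
      have := ih (x ++ [p.2])
      simp only [List.append_assoc, List.singleton_append] at this
      rw [this]
  exact h l []

theorem IsMultilin.map_neg {A X : Type} [AddCommGroup A] [Module ℂ A] [AddCommGroup X]
    [Module ℂ X] {m : List A → X} (hm : IsMultilin m) (l : List A) :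
    m (l.map fun a => -a) = (-1 : ℂ) ^ l.length • m l := by
  have h := hm.map_smul_list (l.map fun a => ((-1 : ℂ), a))
  simp only [List.map_map, Function.comp_def, neg_one_smul, List.map_const', List.prod_replicate,
    List.map_id'] at h
  exact h

theorem intertw_wedgeForm_par :
    Intertw (fun _ => 1) (fun _ => -1) (wedgeForm gW) ((-1 : ℂ) • wedgeForm gW) := by
  refine intertw_wedgeForm fun k => ?_
  have : scaleCV (fun _ => 1) = AlgHom.id ℂ CV := by
    ext k
    simp [scaleCV]
  rw [this, AlgHom.id_apply]

theorem map_parLV (l : List LV) : l.map parLV = l.map (scaleLV fun _ => -1) :=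
  List.map_congr_left fun θ _ => parLV_eq θ

theorem neg_one_pow_mul_neg_one_pow {n d : ℕ} (hd : 0 < d) :
    (-1 : ℂ) ^ n * (-1) ^ (n + d - 1) = (-1) ^ (d + 1) := by
  obtain ⟨d, rfl⟩ := Nat.exists_eq_succ_of_ne_zero hd.ne'
  rw [← pow_add, show n + (n + (d + 1) - 1) = 2 * n + d by omega,
    show d + 1 + 1 = 2 * 1 + d by ring, pow_add, pow_add, pow_mul, pow_mul]
  simp

theorem total_parity {l : List LV} (hl : l ≠ []) :
    koszulRetract.total 3 (l.map parLV) =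
      (-1 : ℂ) ^ (l.length + 1) • parB (koszulRetract.total 3 l) := by
  rw [Retract.total, Retract.total, map_sum, Finset.smul_sum, List.length_map]
  refine Finset.sum_congr rfl fun n _ => ?_
  have h := (valSum_map (c' := fun _ => -1) (r := -1) (by simp) (by simp) (by simp)
    intertw_wedgeForm_par n l).parB_eq
  rw [map_smul, ← map_parLV] at h
  rw [← neg_one_pow_mul_neg_one_pow (n := n) (List.length_pos_iff.2 hl), mul_smul, h, smul_smul, ← mul_pow]
  simp

theorem total_isSolution : koszulRetract.IsSolution (koszulRetract.total 3) := by
  refine koszul_isBounded.isSolution fun l => ?_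
  by_cases hl : l = []
  · subst hl
    have h0 : koszulRetract.total 3 [] = 0 :=
      Finset.sum_eq_zero fun n _ => koszulRetract.valSum_nil n
    rw [List.map_nil, h0, map_zero]
    exact (neg_zero (G := B)).symm
  · have e : (l.map fun a => -koszulRetract.sA a) = (l.map parLV).map fun a => -a := by
      rw [List.map_map]
      rfl
    rw [e, Retract.isMultilin_total.map_neg, total_parity hl, List.length_map, smul_smul,
      pow_succ, ← mul_assoc, ← mul_pow]
    simp only [neg_neg, one_pow, mul_neg, mul_one]
    change _ = -parB _
    module

theorem muTree_parity {l : List LV} (hl : l ≠ []) :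
    muTree gW (l.map parLV) = (-1 : ℂ) ^ l.length • parLV (muTree gW l) := by
  rw [muTree_eq (N := l.length) (by simp), muTree_eq (N := l.length) (by simp), map_sum,
    Finset.smul_sum]
  refine Finset.sum_congr rfl fun n _ => ?_
  have h := muPart_map (c' := fun _ => -1) (r := -1) (by simp) (by simp) (by simp)
    intertw_wedgeForm_par n l
  rw [← map_parLV, ← parLV_eq] at h
  have h2 := congrArg (fun x => ((-1 : ℂ) * (-1) ^ n) • x) h
  simp only [smul_smul] at h2
  -- The factor r ν^n is a sign, so multiplying by it once more removes it.
  rw [show (-1 : ℂ) * (-1) ^ n * (-1 * (-1) ^ n) = 1 by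
      rw [mul_mul_mul_comm, ← mul_pow]; simp, one_smul, mul_assoc,
    neg_one_pow_mul_neg_one_pow (List.length_pos_iff.2 hl), pow_succ', ← mul_assoc] at h2
  simpa using h2

theorem isAInf_muTree : IsAInf parLV (muTree gW) where
  parity_sq := parLV_parLV
  multilin := isMultilin_muTree
  parity _ := muTree_parity
  assoc l _ := by
    have h : muTree gW = koszulRetract.transfer (koszulRetract.total 3) :=
      funext muTree_eq_transfer
    rw [h]
    exact total_isSolution.assoc l

/-! ### The trees with at most one bivalent vertex -/

theorem edgeL_incl (θ : LV) : edgeL (incl θ) = 0 := by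
  rw [edgeL_apply, parB_incl, homotopy_incl]

theorem muProd_incl (θ θ' : LV) : muProd (incl θ) (incl θ') = incl (θ * parLV θ') := by
  rw [muProd_apply, parB_incl, incl_eq, incl_eq, incl_eq, contrB_mul]

theorem koszul_outSum_zero (l : List LV) :
    koszulRetract.outSum 0 l = conv muProd (koszulRetract.valSum 0) (koszulRetract.valSum 0) l := by
  rw [Retract.outSum_eq, if_pos rfl, zero_add, Finset.HasAntidiagonal.antidiagonal_zero,
    Finset.sum_singleton]
  rfl

theorem koszul_valSum_zero_single (θ : LV) : koszulRetract.valSum 0 [θ] = incl θ := by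
  rw [Retract.valSum_eq, if_pos rfl, koszul_outSum_zero]
  have : conv muProd (koszulRetract.valSum 0) (koszulRetract.valSum 0) [θ] = 0 := by
    rw [conv_cons, conv, splitSum, Retract.valSum_nil, map_zero, map_zero, LinearMap.zero_apply,
      add_zero]
  rw [this, map_zero, add_zero]
  rfl

theorem koszul_outSum_zero_pair (θ θ' : LV) :
    koszulRetract.outSum 0 [θ, θ'] = incl (θ * parLV θ') := by
  rw [koszul_outSum_zero, conv_cons, conv_cons, conv, splitSum, Retract.valSum_nil, map_zero,
    map_zero, LinearMap.zero_apply, add_zero, zero_add, koszul_valSum_zero_single,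
    koszul_valSum_zero_single, muProd_incl]

/-- Products of elements of i(Λ(V)) stay in i(Λ(V)), where h vanishes. Hence without bivalent
vertices no finite edge can occur. -/
theorem koszul_valSum_zero_of_two_le {l : List LV} (hl : 2 ≤ l.length) :
    koszulRetract.valSum 0 l = 0 := by
  induction h : l.length using Nat.strong_induction_on generalizing l with
  | _ n ih =>
    subst h
    have h0 : koszulRetract.lin l = 0 := by
      match l, hl with
      | _ :: _ :: _, _ => rfl
    rw [Retract.valSum_eq, if_pos rfl, h0, zero_add]
    match l, hl with
    | [θ, θ'], _ =>
      rw [koszul_outSum_zero_pair]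
      exact edgeL_incl _
    | a :: b :: c :: l, _ =>
      have : koszulRetract.outSum 0 (a :: b :: c :: l) = 0 := by
        rw [koszul_outSum_zero]
        refine splitSum_eq_zero fun x y hxy => ?_
        have hlen : x.length + y.length = l.length + 3 := by
          rw [← List.length_append, hxy]
          rfl
        by_cases hx0 : x = []
        · rw [hx0, Retract.valSum_nil, map_zero, LinearMap.zero_apply]
        by_cases hy0 : y = []
        · rw [hy0, Retract.valSum_nil, map_zero]
        have hx1 := List.length_pos_iff.2 hx0
        have hy1 := List.length_pos_iff.2 hy0
        by_cases hx : 2 ≤ x.length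
        · rw [ih x.length (by simp; omega) hx rfl, map_zero, LinearMap.zero_apply]
        · rw [ih y.length (by simp; omega) (by omega) rfl, map_zero]
      rw [this, map_zero]

theorem muTree_single (θ : LV) : muTree gW [θ] = 0 := muTree_eq (N := 0) le_rfl

theorem muTree_pair (θ θ' : LV) : muTree gW [θ, θ'] = θ * parLV θ' := by
  rw [muTree_eq (N := 1) le_rfl, Finset.sum_range_one, muPart, koszul_outSum_zero_pair, proj_incl]

theorem koszul_outSum_one (l : List LV) :
    koszulRetract.outSum 1 l = pert gW (koszulRetract.valSum 0 l) +
      (conv muProd (koszulRetract.valSum 0) (koszulRetract.valSum 1) l +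
        conv muProd (koszulRetract.valSum 1) (koszulRetract.valSum 0) l) := by
  rw [Retract.outSum_eq, if_neg one_ne_zero]
  have : Finset.HasAntidiagonal.antidiagonal 1 = {(0, 1), (1, 0)} := rfl
  rw [this, Finset.sum_pair (by simp)]
  rfl

theorem koszul_valSum_one (l : List LV) :
    koszulRetract.valSum 1 l = edgeL (koszulRetract.outSum 1 l) := by
  rw [Retract.valSum_eq, if_neg one_ne_zero, zero_add]
  rfl

theorem koszul_outSum_one_single (θ : LV) : koszulRetract.outSum 1 [θ] = pert gW (incl θ) := by
  rw [koszul_outSum_one, conv_cons, conv_cons, conv, conv, splitSum, splitSum]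
  simp only [Retract.valSum_nil, map_zero, LinearMap.zero_apply, add_zero,
    koszul_valSum_zero_single]

theorem conv_valSum_zero_left (a : LV) (l : List LV) (G : List LV → B) :
    conv muProd (koszulRetract.valSum 0) G (a :: l) = muProd (incl a) (G l) := by
  rw [conv_cons, Retract.valSum_nil, map_zero, LinearMap.zero_apply, zero_add]
  have h (x : List LV) (hx : x ≠ []) : koszulRetract.valSum 0 (a :: x) = 0 :=
    koszul_valSum_zero_of_two_le (by
      have := List.length_pos_iff.2 hx
      rw [List.length_cons]
      omega)
  cases l with
  | nil => rw [conv, splitSum, koszul_valSum_zero_single]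
  | cons b l =>
    rw [conv_cons, koszul_valSum_zero_single, conv, splitSum_eq_zero, add_zero]
    intro x y _
    rw [h _ (by simp), map_zero, LinearMap.zero_apply]

theorem conv_valSum_zero_right (l : List LV) (a : LV) (G : List LV → B) :
    conv muProd G (koszulRetract.valSum 0) (l ++ [a]) = muProd (G l) (incl a) := by
  have h0 (x : B) : muProd x (koszulRetract.valSum 0 []) = 0 := by
    rw [Retract.valSum_nil, map_zero]
  rw [conv, splitSum_append_cons, splitSum, h0, add_zero]
  induction l generalizing G with
  | nil => rw [splitSum, List.nil_append, koszul_valSum_zero_single]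
  | cons b l ih =>
    rw [splitSum_cons, ih (fun x => G (b :: x)), koszul_valSum_zero_of_two_le (by simp), map_zero,
      zero_add]

/-- At a trivalent root, the branch without the bivalent vertex must be a single leaf, attached
either before or after the other branch. -/
theorem koszul_outSum_one_replicate (θ : LV) (d : ℕ) :
    koszulRetract.outSum 1 (List.replicate (d + 2) θ) =
      muProd (incl θ) (edgeL (koszulRetract.outSum 1 (List.replicate (d + 1) θ))) +
        muProd (edgeL (koszulRetract.outSum 1 (List.replicate (d + 1) θ))) (incl θ) := by
  rw [koszul_outSum_one, koszul_valSum_zero_of_two_le (by simp), map_zero, zero_add]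
  congr 1
  · rw [List.replicate_succ, conv_valSum_zero_left, koszul_valSum_one]
  · rw [List.replicate_succ', conv_valSum_zero_right, koszul_valSum_one]

/-! ### Multiplication by polynomials -/

theorem wedgeForm_tmul (g : Fin 3 → CV) (f : CV) (β : LVd) :
    wedgeForm g (f ⊗ₜ β) = ∑ k, (g k * f) ⊗ₜ (dvι k * β) := by
  rw [wedgeForm_eq, wedgeLeft_apply, oneForm, Finset.sum_mul]
  simp only [Algebra.TensorProduct.tmul_mul_tmul]

/-- The Clifford relation between contraction and exterior multiplication. -/
theorem incl_mul_wedgeForm (ξ : V) (g : Fin 3 → CV) :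
    incl (ExteriorAlgebra.ι ℂ ξ) * wedgeForm g + wedgeForm g * incl (ExteriorAlgebra.ι ℂ ξ) =
      (∑ k, ξ k • g k) • (1 : B) := by
  refine b_ext fun J => ?_
  rw [incl_eq, LinearMap.add_apply, Module.End.mul_apply, Module.End.mul_apply, contrB_tmul,
    wedgeForm_tmul, wedgeForm_tmul, map_sum, ← Finset.sum_add_distrib, LinearMap.smul_apply,
    Finset.sum_smul, Module.End.one_apply]
  refine Finset.sum_congr rfl fun k _ => ?_
  have h : contr ξ (dvι k * dvJ J) = ξ k • dvJ J - dvι k * contr ξ (dvJ J) :=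
    contr_ι_mul ξ (dv k) (dvJ J)
  rw [contrB_tmul, contrAlg_ι, h, tmul_sub, sub_add_cancel, tmul_smul, mul_one, smul_tmul',
    smul_tmul', smul_eq_mul, mul_one]

theorem nrm_tmul_one (f : CV) : nrm (f ⊗ₜ 1) 1 = f • (1 : B) := by
  rw [nrm, contrB_one, mul_one]
  exact LinearMap.ext fun ω => (Algebra.smul_def f ω).symm

theorem parB_smul_one (f : CV) : parB (f • (1 : B)) = f • (1 : B) := by
  rw [parB_apply, mul_smul_comm, smul_mul_assoc, mul_one, parOm_mul_parOm]

theorem koszulHomotopy_tmul_one {f : CV} {r : ℕ} (hf : f.IsHomogeneous r) :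
    koszulHomotopy (f ⊗ₜ 1) = oneForm fun k => (1 / (r : ℂ)) • MvPolynomial.pderiv k f := by
  set Φ : CV →ₗ[ℂ] Om := koszulHomotopy ∘ₗ (TensorProduct.mk ℂ CV LVd).flip 1 with hΦ
  set Ψ : CV →ₗ[ℂ] Om := ∑ k, ((TensorProduct.mk ℂ CV LVd).flip (dvι k)) ∘ₗ
    ((1 / (r : ℂ)) • (MvPolynomial.pderiv (R := ℂ) k).toLinearMap) with hΨ
  have h : Φ f = Ψ f := by
    rw [f.as_sum, map_sum, map_sum]
    refine Finset.sum_congr rfl fun m hm => ?_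
    have hr : m.degree = r := by
      by_contra h
      exact MvPolynomial.mem_support_iff.1 hm (hf.coeff_eq_zero h)
    have e : MvPolynomial.monomial m (MvPolynomial.coeff m f) =
        MvPolynomial.coeff m f • MvPolynomial.monomial m (1 : ℂ) := by
      rw [MvPolynomial.smul_monomial, smul_eq_mul, mul_one]
    rw [e, map_smul, map_smul]
    congr 1
    have h1 := koszulHomotopy_monomial m (dvJ_mem ∅)
    rw [dvJ_values.1, Finset.card_empty, add_zero, hr] at h1
    rw [hΦ, LinearMap.comp_apply, LinearMap.flip_apply, TensorProduct.mk_apply, hΨ,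
      LinearMap.sum_apply]
    refine h1.trans ?_
    rw [Finset.smul_sum]
    refine Finset.sum_congr rfl fun k _ => ?_
    rw [mul_one, smul_tmul']
    rfl
  refine h.trans ?_
  rw [hΨ, LinearMap.sum_apply, oneForm]
  rfl

theorem edgeL_smul_one {f : CV} {r : ℕ} (hf : f.IsHomogeneous r) :
    edgeL (f • (1 : B)) = wedgeForm fun k => (1 / (r : ℂ)) • MvPolynomial.pderiv k f := by
  rw [edgeL_apply, parB_smul_one, ← nrm_tmul_one, homotopy_nrm, koszulHomotopy_tmul_one hf,
    wedgeForm_eq, nrm, contrB_one, mul_one]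

/-- The contribution of two trivalent vertices, which attach a new leaf `ξ` on either side. -/
def attach (ξ : V) : Module.End ℂ B :=
  (muProd (incl (ExteriorAlgebra.ι ℂ ξ)) + muProd.flip (incl (ExteriorAlgebra.ι ℂ ξ))) ∘ₗ edgeL

theorem attach_apply (ξ : V) (b : B) :
    attach ξ b = muProd (incl (ExteriorAlgebra.ι ℂ ξ)) (edgeL b) +
      muProd (edgeL b) (incl (ExteriorAlgebra.ι ℂ ξ)) := rfl

theorem incl_neg (θ : LV) : incl (-θ) = -incl θ := map_neg inclL θ

/-- The homotopy turns f into df / r, and attaching on both sides forms minus the anticommutator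
with ι_ξ, so the result is -(1/r) ∂_ξ f. -/
theorem attach_smul_one (ξ : V) {f : CV} {r : ℕ} (hf : f.IsHomogeneous r) :
    attach ξ (f • (1 : B)) =
      (∑ k, (-(1 / (r : ℂ)) * ξ k) • MvPolynomial.pderiv k f) • (1 : B) := by
  rw [attach_apply, edgeL_smul_one hf, muProd_apply, muProd_apply, parB_wedgeForm, parB_incl,
    parLV_ι, incl_neg, b_mul_neg, b_mul_neg]
  have h := incl_mul_wedgeForm ξ (fun k => (1 / (r : ℂ)) • MvPolynomial.pderiv k f)
  have e : (∑ k, (-(1 / (r : ℂ)) * ξ k) • MvPolynomial.pderiv k f) =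
      -∑ k, ξ k • (1 / (r : ℂ)) • MvPolynomial.pderiv k f := by
    rw [← Finset.sum_neg_distrib]
    refine Finset.sum_congr rfl fun k _ => ?_
    rw [smul_smul, neg_mul, neg_smul, mul_comm]
  have e2 (q : CV) : (-q) • (1 : B) = -(q • (1 : B)) := neg_smul q (1 : B)
  rw [e, e2, ← h]
  abel

theorem isHomogeneous_sum_pderiv (z : Fin 3 → ℂ) {f : CV} {r : ℕ} (hf : f.IsHomogeneous (r + 1)) :
    (∑ k, z k • MvPolynomial.pderiv k f).IsHomogeneous r := by
  refine MvPolynomial.IsHomogeneous.sum _ _ _ fun k _ => ?_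
  rw [MvPolynomial.smul_eq_C_mul]
  have := (MvPolynomial.isHomogeneous_C (Fin 3) (z k)).mul (hf.pderiv (i := k))
  rwa [zero_add, Nat.add_sub_cancel] at this

/-- By Euler's identity (1/r) ∂_ξ f has the same value at ξ as f. Each step thus changes the value
at ξ only by a sign, until a constant remains. -/
theorem attach_pow_smul_one (ξ : V) {r : ℕ} {f : CV} (hf : f.IsHomogeneous r) :
    (attach ξ ^ r) (f • (1 : B)) = ((-1) ^ r * MvPolynomial.eval ξ f) • (1 : B) := by
  induction r generalizing f with
  | zero =>
    have h : f = MvPolynomial.C (MvPolynomial.coeff 0 f) :=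
      MvPolynomial.totalDegree_eq_zero_iff_eq_C.1 (Nat.le_zero.1 hf.totalDegree_le)
    rw [h, pow_zero, pow_zero, one_mul, MvPolynomial.eval_C, Module.End.one_apply]
    exact LinearMap.ext fun ω => algebraMap_smul CV _ ω
  | succ r ih =>
    rw [pow_succ, Module.End.mul_apply, attach_smul_one ξ hf, ih (isHomogeneous_sum_pderiv _ hf)]
    congr 1
    have h := congrArg (MvPolynomial.eval ξ) hf.sum_X_mul_pderiv
    rw [map_sum, map_nsmul, nsmul_eq_mul] at h
    have e : MvPolynomial.eval ξ (∑ k, (-(1 / ((r + 1 : ℕ) : ℂ)) * ξ k) •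
        MvPolynomial.pderiv k f) = -(1 / ((r + 1 : ℕ) : ℂ)) *
          ∑ k, MvPolynomial.eval ξ (MvPolynomial.X k * MvPolynomial.pderiv k f) := by
      rw [map_sum, Finset.mul_sum]
      refine Finset.sum_congr rfl fun k _ => ?_
      rw [MvPolynomial.smul_eval, map_mul, MvPolynomial.eval_X, mul_assoc]
    have hr : ((r + 1 : ℕ) : ℂ) ≠ 0 := Nat.cast_ne_zero.2 r.succ_ne_zero
    rw [e, h, pow_succ]
    field_simp

theorem proj_attach_pow_smul_one (ξ : V) {r d : ℕ} {f : CV} (hf : f.IsHomogeneous (r + 1 + d)) :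
    proj ((attach ξ ^ d) (f • (1 : B))) = 0 := by
  induction d generalizing f with
  | zero =>
    rw [pow_zero, Module.End.one_apply, ← nrm_tmul_one, proj_nrm, augOm_tmul]
    have : MvPolynomial.aeval (fun _ : Fin 3 => (0 : ℂ)) f = 0 := by
      rw [MvPolynomial.aeval_zero', MvPolynomial.constantCoeff_eq, hf.coeff_eq_zero (by simp),
        map_zero]
    rw [this, zero_mul, zero_smul]
  | succ d ih =>
    rw [pow_succ, Module.End.mul_apply, attach_smul_one ξ hf]
    exact ih (isHomogeneous_sum_pderiv _ hf)

theorem attach_smul_one_const (ξ : V) (z : ℂ) : attach ξ (z • (1 : B)) = 0 := by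
  have : edgeL (1 : B) = 0 := by
    have := edgeL_incl 1
    rwa [incl_eq, contrB_one] at this
  rw [map_smul, attach_apply, this, map_zero, map_zero, LinearMap.zero_apply, add_zero, smul_zero]

theorem koszul_outSum_one_replicate_ι (ξ : V) (d : ℕ) :
    koszulRetract.outSum 1 (List.replicate (d + 1) (ExteriorAlgebra.ι ℂ ξ)) =
      (attach ξ ^ d) ((∑ k, ξ k • gW k) • (1 : B)) := by
  induction d with
  | zero =>
    rw [pow_zero, Module.End.one_apply, ← incl_mul_wedgeForm]
    refine (koszul_outSum_one_single _).trans ?_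
    rw [pert_apply, parB_incl, parLV_ι, incl_neg, b_mul_neg]
    abel
  | succ d ih => rw [koszul_outSum_one_replicate, ih, pow_succ', Module.End.mul_apply, attach_apply]

theorem muPart_one_replicate (ξ : V) :
    muPart 1 (List.replicate 3 (ExteriorAlgebra.ι ℂ ξ)) =
        algebraMap ℂ LV (-(ξ 0 * ξ 1 * ξ 2)) ∧
      muPart 1 (List.replicate 5 (ExteriorAlgebra.ι ℂ ξ)) =
        algebraMap ℂ LV (ξ 0 ^ 5 + ξ 1 ^ 5 + ξ 2 ^ 5) := by
  set q : CV := ∑ k, ξ k • (-MvPolynomial.C (1 / 3 : ℂ) * MvPolynomial.X (k + 1) *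
    MvPolynomial.X (k + 2)) with hq
  set q' : CV := ∑ k, ξ k • (MvPolynomial.X k ^ 4 : CV) with hq'
  have e : (∑ k, ξ k • gW k) • (1 : B) = q • (1 : B) + q' • (1 : B) := by
    rw [← add_smul, hq, hq', ← Finset.sum_add_distrib]
    simp only [gW, smul_add]
  have hom : q.IsHomogeneous 2 := by
    refine MvPolynomial.IsHomogeneous.sum _ _ _ fun k _ => ?_
    rw [MvPolynomial.smul_eq_C_mul, ← MvPolynomial.C_neg, mul_assoc]
    exact ((MvPolynomial.isHomogeneous_C _ _).mul ((MvPolynomial.isHomogeneous_C _ _).mul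
      ((MvPolynomial.isHomogeneous_X _ _).mul (MvPolynomial.isHomogeneous_X _ _))))
  have hom' : q'.IsHomogeneous 4 := by
    refine MvPolynomial.IsHomogeneous.sum _ _ _ fun k _ => ?_
    rw [MvPolynomial.smul_eq_C_mul]
    exact (MvPolynomial.isHomogeneous_C _ _).mul (MvPolynomial.isHomogeneous_X_pow _ _)
  have hone : proj (1 : B) = 1 := by
    have := proj_incl 1
    rwa [incl_eq, contrB_one] at this
  constructor
  -- After two attachments the quadratic part has become its value at ξ, while the quartic part
  -- still has degree two and is killed by p.
  · rw [muPart, koszul_outSum_one_replicate_ι ξ 2, e, map_add, proj_add,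
      attach_pow_smul_one ξ hom, proj_attach_pow_smul_one (r := 1) ξ hom', add_zero, proj_smul,
      hone, Algebra.algebraMap_eq_smul_one]
    congr 1
    simp only [hq, Fin.sum_univ_three, map_add, MvPolynomial.smul_eval, map_mul, map_neg,
      MvPolynomial.eval_C, MvPolynomial.eval_X]
    simp only [Fin.isValue, show (0 : Fin 3) + 1 = 1 from rfl, show (0 : Fin 3) + 2 = 2 from rfl,
      show (1 : Fin 3) + 1 = 2 from rfl, show (1 : Fin 3) + 2 = 0 from rfl,
      show (2 : Fin 3) + 1 = 0 from rfl, show (2 : Fin 3) + 2 = 1 from rfl]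
    ring
  -- After two attachments the quadratic part is constant, and the third one annihilates constants.
  · have h0 : (attach ξ ^ 4) (q • (1 : B)) = 0 := by
      rw [show 4 = 1 + 1 + 2 from rfl, pow_add, Module.End.mul_apply, attach_pow_smul_one ξ hom,
        pow_succ, Module.End.mul_apply, attach_smul_one_const, map_zero]
    rw [muPart, koszul_outSum_one_replicate_ι ξ 4, e, map_add, h0, zero_add,
      attach_pow_smul_one ξ hom', proj_smul, hone, Algebra.algebraMap_eq_smul_one]
    congr 1
    simp only [hq', Fin.sum_univ_three, map_add, MvPolynomial.smul_eval, map_pow,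
      MvPolynomial.eval_X]
    ring

/-! ### The components of the transferred structure -/

/-- The component `μ_k` of the transferred structure. -/
def muComp (k : ℕ) (l : List LV) : LV :=
  if 2 * k + 2 ≤ l.length then muPart (l.length - 2 - 2 * k) l else 0

theorem isMultilin_muComp (k : ℕ) : IsMultilin (muComp k) := by
  intro x z
  have e (a : LV) : (x ++ a :: z).length = x.length + z.length + 1 := by
    rw [List.length_append, List.length_cons, add_assoc]
  simp only [muComp, e]
  split_ifs
  · exact isMultilin_muPart _ x z
  · exact (0 : LV →ₗ[ℂ] LV).isLinear

theorem muPart_eq_zero_of_odd {n : ℕ} {l : List LV} (h : Odd (n + l.length)) : muPart n l = 0 := by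
  rw [muPart_eq]
  refine Finset.sum_eq_zero fun t ht => proj_out_eq_zero_of_even ?_ l
  have hv := t.vertices_add_one
  rw [RTree.mem_trees] at ht
  rw [← ht.1, ← ht.2, ← hv] at h
  exact (Nat.odd_add_one.1 h |> Nat.not_odd_iff_even.1)

theorem muTree_eq_sum_muComp {l : List LV} (hl : 3 ≤ l.length) :
    muTree gW l = ∑ k ∈ Finset.range (l.length + 1), muComp k l := by
  rw [muTree_eq (N := l.length - 1) (by omega)]
  simp only [muComp]
  rw [← Finset.sum_filter]
  symm
  refine Finset.sum_of_injOn (fun k => l.length - 2 - 2 * k) ?_ ?_ ?_ fun _ _ => rfl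
  · intro k hk k' hk' h
    simp only [Finset.coe_filter, Finset.mem_range, Set.mem_ofPred_eq] at hk hk' h
    omega
  · intro k hk
    simp only [Finset.coe_filter, Finset.mem_range, Set.mem_ofPred_eq] at hk
    simp only [Finset.mem_coe, Finset.mem_range]
    omega
  · intro n hn h
    rw [Finset.mem_range] at hn
    refine muPart_eq_zero_of_odd (Nat.not_even_iff_odd.1 fun he => h ?_)
    obtain ⟨j, hj⟩ := he
    -- With n + d = 2j, the equation n = d - 2 - 2k has the solution k = d - 1 - j.
    refine ⟨l.length - 1 - j, ?_, ?_⟩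
    · simp only [Finset.coe_filter, Finset.mem_range, Set.mem_ofPred_eq]
      omega
    · simp only
      omega

theorem scaleLV_of_mem (c : ℂ) {q : ℕ} {θ : LV} (h : θ ∈ ⋀[ℂ]^q V) :
    scaleLV (fun _ => c) θ = c ^ q • θ := by
  induction h using Submodule.pow_induction_on_left' with
  | algebraMap r => rw [AlgHom.commutes, pow_zero, one_smul]
  | add x y i _ _ hx hy => rw [map_add, hx, hy, smul_add]
  | mem_mul m hm i x _ hx =>
    obtain ⟨ξ, rfl⟩ := hm
    have h1 : diagV (fun _ => c) ξ = c • ξ := by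
      ext k
      simp [Matrix.mulVec_diagonal]
    rw [map_mul, hx, scaleLV, ExteriorAlgebra.map_apply_ι, h1, map_smul, smul_mul_smul_comm,
      pow_succ']

/-- The coefficient of `ξ_J` scales by 2^(-|J|), so only those with |J| = e can be nonzero; for
negative e there are none. -/
theorem mem_extPow_of_scaleLV {e : ℤ} {θ : LV}
    (h : scaleLV (fun _ => 2⁻¹) θ = ((2 : ℂ) ^ (-e)) • θ) : θ ∈ extPow e := by
  rw [← sum_pairing_xiJ θ]
  refine sum_mem fun J _ => ?_
  by_cases hJ : (J.card : ℤ) = e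
  · rw [extPow, if_pos (by omega), ← hJ, Int.toNat_natCast]
    exact Submodule.smul_mem _ _ (xiJ_mem J)
  · have h1 : pairing (scaleLV (fun _ => 2⁻¹) θ) (scaleLVd (fun _ => 2) (dvJ J)) =
        pairing θ (dvJ J) := by
      have := contrAlg_scale (c := fun _ => 2) (c' := fun _ => 2⁻¹) (by simp) θ (dvJ J)
      exact (congrArg ExteriorAlgebra.algebraMapInv this).trans (algebraMapInv_scaleLVd _ _)
    rw [h, scaleLVd_dvJ, pairing_smul, LinearMap.smul_apply, map_smul, Finset.prod_const,
      smul_eq_mul, smul_eq_mul, ← mul_assoc, ← zpow_natCast, ← zpow_add₀ two_ne_zero] at h1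
    have h2 : ((2 : ℂ) ^ (-e + J.card) - 1) * pairing θ (dvJ J) = 0 := by
      rw [sub_mul, h1, one_mul, sub_self]
    have h3 : (2 : ℂ) ^ (-e + J.card) ≠ 1 := by
      intro h3
      have h4 : (2 : ℝ) ^ (-e + J.card) = 1 := Complex.ofReal_injective (by push_cast; exact h3)
      have := zpow_right_injective₀ (a := (2 : ℝ)) (by norm_num) (by norm_num)
        (h4.trans (zpow_zero 2).symm)
      omega
    rw [(mul_eq_zero.1 h2).resolve_left (sub_ne_zero.2 h3), zero_smul]
    exact zero_mem _

/-- Each bivalent vertex and each of the n + d - 2 finite edges raises form degree by one, and the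
degree in Λ(V) drops by the total 2n + d - 2. For n = d - 2 - 2k this is 3d - 6 - 4k. -/
theorem muPart_mem_extPow (n : ℕ) {l : List LV} (hl : l ≠ []) {q : List ℕ}
    (h : List.Forall₂ (fun a q => a ∈ ⋀[ℂ]^q V) l q) :
    muPart n l ∈ extPow (q.sum - (2 * n + l.length - 2)) := by
  have h1 : muPart n (l.map (scaleLV fun _ => 2⁻¹)) = (2⁻¹ : ℂ) ^ q.sum • muPart n l := by
    have key : ∃ L : List (ℂ × LV), L.map Prod.snd = l ∧
        (L.map fun p => p.1 • p.2) = l.map (scaleLV fun _ => 2⁻¹) ∧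
        (L.map Prod.fst).prod = (2⁻¹ : ℂ) ^ q.sum := by
      clear hl
      induction h with
      | nil => exact ⟨[], rfl, rfl, by simp⟩
      | @cons a n _ _ ha _ ih =>
        obtain ⟨L, h1, h2, h3⟩ := ih
        refine ⟨(2⁻¹ ^ n, a) :: L, by rw [List.map_cons, h1], ?_, ?_⟩
        · rw [List.map_cons, h2, List.map_cons, scaleLV_of_mem _ ha]
        · rw [List.map_cons, List.prod_cons, h3, List.sum_cons, pow_add]
    obtain ⟨L, h1, h2, h3⟩ := key
    rw [← h2, (isMultilin_muPart n).map_smul_list, h1, h3]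
  have h2 := muPart_map (c' := fun _ => 2⁻¹) (r := 2⁻¹) (by simp) (by simp) (by simp)
    (intertw_wedgeForm_form gW) n l
  rw [h1, smul_smul] at h2
  refine mem_extPow_of_scaleLV ?_
  have h3 := congrArg (fun x => (2 : ℂ) ^ (n + l.length - 1) • x) h2
  simp only [smul_smul, ← mul_pow] at h3
  rw [mul_inv_cancel₀ two_ne_zero, one_pow, one_smul] at h3
  rw [← h3]
  congr 1
  have hpos := List.length_pos_iff.2 hl
  rw [inv_pow, ← zpow_natCast, ← zpow_natCast, ← zpow_natCast, ← zpow_neg, ← zpow_neg_one,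
    ← zpow_add₀ two_ne_zero, ← zpow_add₀ two_ne_zero, ← zpow_add₀ two_ne_zero]
  congr 1
  omega

theorem hasDegree_muComp (k i : ℕ) (hi : 3 ≤ i) : HasDegree (muComp k) i (6 - 3 * i + 4 * k) := by
  rintro l q rfl h
  rw [muComp]
  split_ifs with hk
  · have := muPart_mem_extPow (l.length - 2 - 2 * k) (List.length_pos_iff.1 (by omega)) h
    convert this using 2
    omega
  · exact zero_mem _

theorem hasLeadingTerms_muComp : HasLeadingTerms muComp := by
  intro ξ
  simp only [muComp, List.length_replicate]
  exact muPart_one_replicate ξ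

/-! ### Equivariance -/

/-- A diagonal matrix with entries t_k acts on Ω(V) by rescaling with a = c = t⁻¹, so r = 1. The
form γ is invariant: the quadratic part because t_1 t_2 t_3 = 1, the quartic part because t_k^5 = 1.
-/
theorem exists_scale_of_mem_G {A : Matrix.SpecialLinearGroup (Fin 3) ℂ} (hA : A ∈ G) :
    ∃ a c : Fin 3 → ℂ, (∀ k, a k ≠ 0) ∧ (∀ k, a k * c k = 1) ∧
      (∀ θ, actLV A θ = scaleLV c θ) ∧ (∀ ω, actOm A ω = scaleOm a a ω) ∧
      Intertw a a (wedgeForm gW) ((1 : ℂ) • wedgeForm gW) := by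
  obtain ⟨t, ht, hAt⟩ := hA
  have h0 : ∀ i, t i ≠ 0 := fun i h => by simpa [h] using ht i
  have hdet : t 0 * t 1 * t 2 = 1 := by
    have := A.2
    rwa [hAt, Matrix.det_diagonal, Fin.prod_univ_three] at this
  have hinv : (A⁻¹).1 = Matrix.diagonal fun i => (t i)⁻¹ := by
    have h1 : A.1 * Matrix.diagonal (fun i => (t i)⁻¹) = 1 := by
      rw [hAt, Matrix.diagonal_mul_diagonal, ← Matrix.diagonal_one]
      exact congrArg _ (funext fun i => mul_inv_cancel₀ (h0 i))
    have h2 : (A⁻¹).1 * A.1 = 1 := by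
      rw [← Matrix.SpecialLinearGroup.coe_mul, inv_mul_cancel, Matrix.SpecialLinearGroup.coe_one]
    exact left_inv_eq_right_inv h2 h1
  refine ⟨fun k => (t k)⁻¹, t, fun k => inv_ne_zero (h0 k), fun k => inv_mul_cancel₀ (h0 k),
    fun θ => ?_, fun ω => ?_, ?_⟩
  · rw [actLV, hAt]
    rfl
  · have e : (MvPolynomial.aeval fun k : Fin 3 =>
        ∑ j, MvPolynomial.C ((A⁻¹).1 k j) * (MvPolynomial.X j : CV)) =
          scaleCV fun k => (t k)⁻¹ := by
      rw [scaleCV]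
      congr 1
      funext k
      rw [hinv, Finset.sum_eq_single k, Matrix.diagonal_apply_eq]
      · intro j _ hj
        rw [Matrix.diagonal_apply_ne _ hj.symm, map_zero, zero_mul]
      · simp
    rw [actOm, e, hinv]
    rfl
  · refine intertw_wedgeForm fun k => ?_
    have h1 : (t k)⁻¹ * (t (k + 1))⁻¹ * (t (k + 2))⁻¹ = 1 := by
      have : t k * t (k + 1) * t (k + 2) = 1 := by
        rw [← hdet]
        fin_cases k
        · rfl
        · change t 1 * t 2 * t 0 = _
          ring
        · change t 2 * t 0 * t 1 = _
          ring
      rw [← mul_inv, ← mul_inv, this, inv_one]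
    have h2 : (t k)⁻¹ * (t k)⁻¹ ^ 4 = 1 := by
      rw [← pow_succ', inv_pow, ht, inv_one]
    have h1' := congrArg (MvPolynomial.C (σ := Fin 3)) h1
    have h2' := congrArg (MvPolynomial.C (σ := Fin 3)) h2
    simp only [map_mul, map_pow, map_one] at h1' h2'
    simp only [gW, scaleCV, map_add, map_mul, map_pow, map_neg, MvPolynomial.aeval_C,
      MvPolynomial.aeval_X, one_smul, MvPolynomial.algebraMap_eq, MvPolynomial.smul_eq_C_mul]
    linear_combination (-MvPolynomial.C (1 / 3 : ℂ) * MvPolynomial.X (k + 1) *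
      MvPolynomial.X (k + 2)) * h1' + MvPolynomial.X k ^ 4 * h2'

theorem isGEquivariant_muTree : IsGEquivariant (muTree gW) := by
  intro A hA l _
  obtain ⟨a, c, ha, hc, hL, -, hν⟩ := exists_scale_of_mem_G hA
  rw [List.map_congr_left fun θ _ => hL θ, hL, muTree_eq (N := l.length) (by simp),
    muTree_eq (N := l.length) (by simp), map_sum]
  refine Finset.sum_congr rfl fun n _ => ?_
  have := muPart_map (r := 1) ha hc (fun k => (one_mul _).symm) hν n l
  simpa using this

theorem isGEquivariantB_total : IsGEquivariantB (koszulRetract.total 3) := by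
  intro A hA l _ ω
  obtain ⟨a, c, ha, hc, hL, hO, hν⟩ := exists_scale_of_mem_G hA
  rw [List.map_congr_left fun θ _ => hL θ, hO, hO, Retract.total, Retract.total, List.length_map,
    LinearMap.sum_apply, LinearMap.sum_apply, map_sum]
  refine Finset.sum_congr rfl fun n _ => ?_
  have := valSum_map (r := 1) ha hc (fun k => (one_mul _).symm) hν n l
  rw [one_pow, one_pow, one_smul, one_smul] at this
  exact (this ω).symm

/-! ### The quasi-isomorphism -/

theorem muTree_eq_transfer_total :
    muTree gW = koszulRetract.transfer (koszulRetract.total 3) := funext muTree_eq_transfer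

theorem muB_single_eq (b : B) : muB gW [b] = koszulRetract.d b + koszulRetract.β b :=
  muDiff_delta gW b

theorem isAInfHom_total :
    IsAInfHom parLV (muTree gW) parB (muB gW) (koszulRetract.total 3) where
  multilin := Retract.isMultilin_total
  parity _ := total_parity
  hom l hl := by
    have h0 := total_isSolution.nil
    rw [sum_composition_eq _ _ (fun l => muB_of_three_le gW)
      (fun y => by rw [h0, muB_pair, map_zero, LinearMap.zero_apply])
      (fun y => by rw [h0, muB_pair, map_zero]) l hl, muB_single_eq, muTree_eq_transfer_total]
    exact total_isSolution.hom l

theorem proj_muB_single (b : B) : proj (muB gW [b]) = 0 := by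
  rw [muB_single_eq, proj_add]
  exact (congrArg₂ (· + ·) (koszulRetract.p_d b) (koszulRetract.p_β b)).trans (add_zero _)

theorem muB_total_single (a : LV) : muB gW [koszulRetract.total 3 [a]] = 0 := by
  have h := total_isSolution.hom [a]
  have h0 := total_isSolution.nil
  have h1 : conv koszulRetract.m (koszulRetract.total 3) (koszulRetract.total 3) [a] = 0 := by
    rw [conv_cons, conv, splitSum, h0, map_zero, map_zero, LinearMap.zero_apply, add_zero]
  rw [h1, add_zero, ← muTree_eq_transfer_total, insertSum_cons, insertSum_nil, add_zero, splitSum,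
    muTree_single] at h
  rw [muB_single_eq, h]
  exact Retract.isMultilin_total.map_zero [] []

/-- Injectivity holds because p is a left inverse of the linear part and kills coboundaries. For
surjectivity, b minus the image of p(b) is a cocycle in the kernel of p, hence exact. -/
theorem isQuasiIso_total : IsQuasiIso (muTree gW) (muB gW) (koszulRetract.total 3) := by
  have hp (a : LV) : proj (koszulRetract.total 3 [a]) = a := total_isSolution.p_apply a
  constructor
  · rintro a _ ⟨b, hb⟩
    refine ⟨0, ?_⟩
    rw [muTree_single, ← hp a, hb, proj_muB_single]
  · intro b hb
    obtain ⟨y, hy⟩ := koszulRetract.exists_of_cocycle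
      (b + (-1 : ℂ) • koszulRetract.total 3 [proj b]) (by
        have h1 := hb
        have h2 := muB_total_single (proj b)
        rw [muB_single_eq] at h1 h2
        rw [map_add, map_add, map_smul, map_smul, add_add_add_comm, ← smul_add, h1, h2, smul_zero,
          add_zero]) (by
        rw [map_add, map_smul]
        change proj b + (-1 : ℂ) • proj _ = 0
        rw [hp, neg_one_smul, add_neg_cancel])
    refine ⟨proj b, y, muTree_single _, ?_⟩
    rw [muB_single_eq, ← hy]
    module

/-! ### The identity -/

theorem isMultilin_single {A X : Type} [AddCommGroup A] [Module ℂ A] [AddCommGroup X] [Module ℂ X]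
    (f : A →ₗ[ℂ] X) : IsMultilin (single f) := by
  intro x z
  match x, z with
  | [], [] => exact f.isLinear
  | [], _ :: _ => exact (0 : A →ₗ[ℂ] X).isLinear
  | [_], _ => exact (0 : A →ₗ[ℂ] X).isLinear
  | _ :: _ :: _, _ => exact (0 : A →ₗ[ℂ] X).isLinear

theorem single_eq_zero {A X : Type} [AddCommGroup A] [Module ℂ A] [AddCommGroup X] [Module ℂ X]
    (f : A →ₗ[ℂ] X) {l : List A} (hl : l.length ≠ 1) : single f l = 0 := by
  match l, hl with
  | [], _ => rfl
  | _ :: _ :: _, _ => rfl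

/-- A block of length other than one makes an entry zero, so only the cut into single entries
contributes. -/
theorem sum_composition_single {A : Type} [AddCommGroup A] [Module ℂ A] {μ : List A → A}
    (hμ : IsMultilin μ) (l : List A) :
    ∑ c : Composition l.length, μ ((l.splitWrtComposition c).map (single LinearMap.id)) = μ l := by
  have h1 : ∀ L : List (List A), (∀ x ∈ L, x.length = 1) →
      L.map (single (LinearMap.id : A →ₗ[ℂ] A)) = L.flatten := by
    intro L hL
    induction L with
    | nil => rfl
    | cons x L ih =>
      obtain ⟨a, rfl⟩ := List.length_eq_one_iff.1 (hL x (by simp))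
      rw [List.map_cons, ih fun y hy => hL y (List.mem_cons_of_mem _ hy)]
      rfl
  rw [Finset.sum_eq_single (Composition.ones l.length)]
  · rw [h1, List.flatten_splitWrtComposition]
    intro x hx
    have h2 : x.length ∈ (Composition.ones l.length).blocks := by
      rw [← List.map_length_splitWrtComposition l]
      exact List.mem_map_of_mem hx
    exact (Composition.eq_ones_iff.1 rfl) _ h2
  · intro c _ hc
    rw [Ne, Composition.eq_ones_iff] at hc
    push Not at hc
    obtain ⟨i, hi, hi1⟩ := hc
    rw [← List.map_length_splitWrtComposition l] at hi
    obtain ⟨x, hx, rfl⟩ := List.mem_map.1 hi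
    obtain ⟨L, L', hL⟩ := List.append_of_mem hx
    rw [hL, List.map_append, List.map_cons, single_eq_zero _ hi1]
    exact hμ.map_zero _ _
  · intro h
    exact absurd (Finset.mem_univ _) h

theorem isAInfHom_single {A : Type} [AddCommGroup A] [Module ℂ A] {s : A →ₗ[ℂ] A} {μ : List A → A}
    (hμ : IsMultilin μ) (h0 : μ [] = 0) : IsAInfHom s μ s μ (single LinearMap.id) where
  multilin := isMultilin_single _
  parity l _ := by
    by_cases hl : l.length = 1
    · obtain ⟨a, rfl⟩ := List.length_eq_one_iff.1 hl
      simp [single]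
    · rw [single_eq_zero _ (by simpa using hl), single_eq_zero _ hl, map_zero, smul_zero]
  hom l _ := by
    rw [sum_composition_single hμ, insertSum_single _ _ _ h0, LinearMap.id_apply]

theorem isGEquivariant_single : IsGEquivariant (single LinearMap.id) := by
  intro A _ l _
  by_cases hl : l.length = 1
  · obtain ⟨a, rfl⟩ := List.length_eq_one_iff.1 hl
    rfl
  · rw [single_eq_zero _ (by simpa using hl), single_eq_zero _ hl, map_zero]

/-! ### The transferred structure and its isomorphism class -/

theorem isDeformation_muTree : IsDeformation (muTree gW) muComp where
  ainf := isAInf_muTree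
  equivariant := isGEquivariant_muTree
  mu_one := muTree_single
  mu_two := muTree_pair
  comp_multilin := isMultilin_muComp
  comp_degree := hasDegree_muComp
  comp_sum _ := muTree_eq_sum_muComp

theorem belongsToClass_muTree : BelongsToClass (muTree gW) :=
  ⟨muTree gW, muComp, single LinearMap.id, isDeformation_muTree, hasLeadingTerms_muComp,
    isAInfHom_single isMultilin_muTree (muTree_eq (N := 0) (by simp)), isGEquivariant_single,
    Function.bijective_id⟩

theorem delta_gW_mul_delta_gW : delta gW * delta gW = (-W) • (1 : B) := by
  rw [delta_mul_delta, sum_X_mul_gW]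

end

end KoszulMF

theorem mainTheorem6 :
    -- the differential `ι_η - γ ∧ ·` squares to a function times the identity
    KoszulMF.delta KoszulMF.gW * KoszulMF.delta KoszulMF.gW = (-KoszulMF.W) • (1 : KoszulMF.B) ∧
    -- the endomorphism dg algebra
    KoszulMF.IsAInf KoszulMF.parB (KoszulMF.muB KoszulMF.gW) ∧
    -- all the sums over trees are finite
    (∀ d : ℕ, {t : KoszulMF.RTree | t.leaves = d ∧
      ∃ l : List KoszulMF.LV, l.length = d ∧ t.op KoszulMF.gW l ≠ 0}.Finite) ∧
    -- the transferred structure on `Λ(V)` is quasi-isomorphic to the endomorphism dg algebra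
    (∃ F : List KoszulMF.LV → KoszulMF.B,
      KoszulMF.IsAInfHom KoszulMF.parLV (KoszulMF.muTree KoszulMF.gW)
        KoszulMF.parB (KoszulMF.muB KoszulMF.gW) F ∧
      KoszulMF.IsGEquivariantB F ∧
      KoszulMF.IsQuasiIso (KoszulMF.muTree KoszulMF.gW) (KoszulMF.muB KoszulMF.gW) F) ∧
    -- it satisfies the requirements on `μ^1`, `μ^2`, `μ^3_0` and `μ^5_1`
    (∃ m : ℕ → List KoszulMF.LV → KoszulMF.LV,
      KoszulMF.IsDeformation (KoszulMF.muTree KoszulMF.gW) m ∧ KoszulMF.HasLeadingTerms m) ∧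
    -- it lies in the isomorphism class that they determine
    KoszulMF.BelongsToClass (KoszulMF.muTree KoszulMF.gW) := by
  exact ⟨KoszulMF.delta_gW_mul_delta_gW, KoszulMF.isAInf_muB, KoszulMF.finite_contributing,
    ⟨_, KoszulMF.isAInfHom_total, KoszulMF.isGEquivariantB_total, KoszulMF.isQuasiIso_total⟩,
    ⟨_, KoszulMF.isDeformation_muTree, KoszulMF.hasLeadingTerms_muComp⟩,
    KoszulMF.belongsToClass_muTree⟩
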